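/- **Setting.** Let $T$ be an ideal triangulation of an oriented bordered surface $(S,M)$ with marked points (self-folded triangles are allowed). Curves are considered up to isotopy and in minimal position with respect to $T$. Let $\gamma$ be a directed arc (it may even cross itself) which is not in $T$, whose first endpoint $p$ and last endpoint $q$ are punctures (possibly $p=q$), and let $\gamma^{(pq)}$ be the doubly notched arc obtained by notching both of its ends. Suppose that neither $p$ nor $q$ is the puncture enclosed by a self-folded triangle of $T$. Let $k\ge 1$ be the number of crossings of $\gamma$ with $T$, and let $l_p,l_q\ge 2$ be the degrees of $p,q$ in $T$. *Snake graphs.* For a directed curve $\beta$ crossing the arcs $\tau_{i_1},\dots,\tau_{i_d}$ of $T$ in this order, $\mathcal G_{\beta,T}=(G_1,\dots,G_d)$ is the following labelled graph. The tile $G_j$ is a unit square in the plane, obtained from the two triangles (two copies of one triangle, if it is self-folded and $\tau_{i_j}$ is its radius) before and after the $j$-th crossing, glued along the crossed side. This side is the deleted diagonal of $G_j$, from the NW to the SE vertex, and the triangle before the crossing is the lower half. The relative orientation $\mathrm{rel}(G_j)=\pm1$ says whether this embedding preserves or reverses orientation; it alternates with $j$, and $\mathrm{rel}(G_1)$ may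 be chosen. $G_{j+1}$ is glued to the N or E edge of $G_j$ along the third side of the triangle between the two crossings. *Loops and hooks.* $\ell_q$ is the loop that runs along $\gamma$, goes once round $q$ (crossing each end of an arc of $T$ at $q$ once) and returns along $\gamma^{-1}$ to $p$; $\ell_p$ is the loop that runs along $\gamma^{-1}$ from $q$ to $p$, goes once round $p$ and returns along $\gamma$ to $q$. Their snake graphs have $2k+l_q$ and $2k+l_p$ tiles. The first $k$ tiles and the last $k$ tiles of each form two copies $\mathcal G_{\gamma,1},\mathcal G_{\gamma,2}$ of the snake graph of $\gamma$ (up to the direction of $\gamma$), with canonical isomorphisms between all these copies, matching the same sides of the quadrilaterals around the same crossings of $\gamma$. The hooked arc goes once round $p$, follows $\gamma$, and goes once round $q$. The directions of the four turns are arbitrary. *The loop graph.* Let $(G_1,\dots,G_d)$, $d=l_p+k+l_q$, be the snake graph of the hooked arc, and $k_1=l_p+1$, $k_2=l_p+k$. Let $c_1'$ be the edge of $G_{k_1}$ among S, W which is not glued to $G_{k_1-1}$, and let $c_1$ be the edge of $G_1$ among S, W which lies on the same side of the same triangle of $T$ as $c_1'$. Glue $c_1$ to $c_1'$ so that the SW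 vertex of $G_{k_1}$ is glued to the vertex of $c_1$ other than the SW vertex of $G_1$. Do the same with $c_2'\subset G_{k_2}$ and $c_2\subset G_d$, using N, E, NE and $G_{k_2+1}$. The result is the loop graph $\mathcal G_{\gamma^{(pq)},T}$. A *good matching* of it is a perfect matching $P$ (a set of edges such that every vertex lies on exactly one of them) which can be extended to a perfect matching $\widehat P$ of the snake graph $(G_1,\dots,G_d)$ by adding edges among $c_1,c_1',c_2,c_2'$ (an edge of $P$ obtained by gluing $c_i$ to $c_i'$ is regarded as $c_i'$). *Monomials.* In the field of rational functions over $\mathbb Q$ in variables $x_i,y_i$, one pair for each arc $\tau_i$ of $T$, put $x_{\tau}=1$ for a boundary segment, $x_{\tau_i}=x_ix_j$ if $\tau_i$ encloses a once-punctured monogon with radius $\tau_j$, and $x_{\tau_i}=x_i$ otherwise. Put $w_{\tau_i}=y_iy_j^{-1}$ if $\tau_i$ is the radius of a self-folded triangle with loop $\tau_j$, and $w_{\tau_i}=y_i$ otherwise. For a set $P$ of edges, $x(P)$ is the product of $x_\tau$ over the labels $\tau$ of the edges in $P$. For a perfect matching $P$ of a snake graph, travel from the SW vertex of the first tile to the NE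 vertex of the last tile, alternately along edges of $P$ and diagonals. The diagonal of $G_j$ is positive if it is traversed downwards and $\mathrm{rel}(G_j)=1$, or upwards and $\mathrm{rel}(G_j)=-1$; $y(P)$ is the product of $w_{\tau_{i_j}}$ over the positive diagonals. For a good matching $P$ of the loop graph, $y(P):=y(\widehat P)$. *Compatible pairs.* For $r\in\{p,q\}$, a perfect matching $P_r$ of $\mathcal G_{\ell_r,T}$ is *$\gamma$-symmetric* if its restrictions to $\mathcal G_{\gamma,1}$ without its last NE vertex (and the two edges at it) and to $\mathcal G_{\gamma,2}$ without its first SW vertex (and the two edges at it) correspond to each other. A pair $(P_p,P_q)$ of $\gamma$-symmetric perfect matchings of $(\mathcal G_{\ell_p,T},\mathcal G_{\ell_q,T})$ is *$\gamma$-compatible* if for some $i,j\in\{1,2\}$ the restrictions of $P_p$ and $P_q$ to $\mathcal G_{\gamma,i}\subset\mathcal G_{\ell_p,T}$ and $\mathcal G_{\gamma,j}\subset\mathcal G_{\ell_q,T}$ are perfect matchings of these subgraphs, which correspond to each other under the canonical isomorphism. With such an $i$, put $$\overline{\overline{x}}(P_p,P_q)=\frac{x(P_p)x(P_q)}{x(P_p|_{\mathcal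 G_{\gamma,i}})^3},\qquad \overline{\overline{y}}(P_p,P_q)=\frac{y(P_p)y(P_q)}{y(P_p|_{\mathcal G_{\gamma,i}})^3}.$$ **Proposition.** There is a bijection $\Phi$ from the set of $\gamma$-compatible pairs $(P_p,P_q)$ of $\gamma$-symmetric perfect matchings of $(\mathcal G_{\ell_p,T},\mathcal G_{\ell_q,T})$ to the set of good matchings of $\mathcal G_{\gamma^{(pq)},T}$ such that $$\overline{\overline{x}}(P_p,P_q)=x(\Phi(P_p,P_q))\quad\text{and}\quad\overline{\overline{y}}(P_p,P_q)=y(\Phi(P_p,P_q))$$ for all $\gamma$-compatible pairs, for every admissible choice of $i$ in the definition of $\overline{\overline{x}},\overline{\overline{y}}$ and of the extension $\widehat P$ in the definition of $y$. -/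

import Mathlib

open Finset

/-! ### Triangulated bordered surfaces -/

/-- A side of one of the triangles `Tri`. The sides `(t, 0)`, `(t, 1)`, `(t, 2)` of `t` are listed
in the cyclic order given by the orientation of the surface. The same type indexes the corners of
the triangles: the corner `(t, i)` is the one opposite to the side `(t, i)`, so it lies between the
sides `(t, i + 1)` and `(t, i + 2)`. -/
abbrev TriSide (Tri : Type*) := Tri × ZMod 3

/-- An ideal triangulation of an oriented bordered surface with marked points, given by its
triangles together with the way their sides are glued in pairs (compatibly with the orientations of
the triangles). The sides fixed by `glue` are the unglued ones, i.e. the boundary segments. The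
surface is recovered by gluing the triangles, and its marked points are the images of the corners.
Two sides of the same triangle may be glued to each other; such a triangle is self-folded. -/
structure IdealTriangulation (Tri : Type*) where
  glue : TriSide Tri → TriSide Tri
  glue_glue : ∀ h, glue (glue h) = h

namespace IdealTriangulation

variable {Tri : Type*} (T : IdealTriangulation Tri)

/-- The edges of the triangulation: the arcs of `T` (two sides glued together) and the boundary
segments (one unglued side). -/
def Edge : Type _ := Quot fun a b : TriSide Tri => T.glue a = b

/-- The edge of the triangulation on which a side lies. -/
def edgeOf (h : TriSide Tri) : T.Edge := Quot.mk _ h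

/-- The side `h` is a boundary segment. -/
def IsBoundary (h : TriSide Tri) : Prop := T.glue h = h

/-- The corner `c` is the corner at the enclosed puncture of a self-folded triangle: the two sides
of the triangle that meet at `c` are glued to each other. (That puncture has no other corner.) -/
def IsFoldedCorner (c : TriSide Tri) : Prop := T.glue (c.1, c.2 + 1) = (c.1, c.2 + 2)

/-- Turn about the marked point at the corner `c`, counter-clockwise, into the next triangle:
one crosses the side `(c.1, c.2 + 1)`. -/
def rotate (c : TriSide Tri) : TriSide Tri :=
  ((T.glue (c.1, c.2 + 1)).1, (T.glue (c.1, c.2 + 1)).2 + 1)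

/-- The marked point at the corner `c` is a puncture: turning about it one never meets the boundary
and comes back to `c`. -/
def IsPuncture (c : TriSide Tri) : Prop :=
  c ∈ Function.periodicPts T.rotate ∧
    ∀ n, ¬ T.IsBoundary ((T.rotate^[n] c).1, (T.rotate^[n] c).2 + 1)

/-- The degree in `T` of the puncture at the corner `c`: the number of ends of arcs of `T`
at it, which is the number of crossings in one turn about it. -/
noncomputable def degree (c : TriSide Tri) : ℕ := Function.minimalPeriod T.rotate c

/-! ### Curves as sequences of crossings -/

/-- A curve between two marked points, not contained in `T` and considered up to isotopy, given by
the sequence of its crossings with the arcs of `T` (in minimal position). For `j < len` its `j`-th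
crossing leaves the triangle `(cross j).1` through the side `cross j`, and enters the next triangle
through the side `glue (cross j)`; minimality says that it does not leave that triangle through the
side by which it came in. The curve starts at the corner opposite to its first crossing, and ends
at the corner opposite to the last side by which it enters a triangle. The curve may cross itself;
in particular, every arc which is not in `T` is of this form. The values `cross j` for `len ≤ j`
have no meaning. -/
structure Curve where
  len : ℕ
  len_pos : 0 < len
  cross : ℕ → TriSide Tri
  interior : ∀ j, j < len → ¬ T.IsBoundary (cross j)
  chain : ∀ j, j + 1 < len →
    (cross (j + 1)).1 = (T.glue (cross j)).1 ∧ cross (j + 1) ≠ T.glue (cross j)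

variable {T}

theorem glue_injective : Function.Injective T.glue := fun a b h => by
  rw [← T.glue_glue a, h, T.glue_glue]

theorem not_isBoundary_glue {h : TriSide Tri} (hh : ¬ T.IsBoundary h) :
    ¬ T.IsBoundary (T.glue h) := fun H => hh (glue_injective H)

theorem degree_pos {c : TriSide Tri} (h : T.IsPuncture c) : 0 < T.degree c :=
  Function.minimalPeriod_pos_of_mem_periodicPts h.1

namespace Curve

/-- The corner at which the curve starts. -/
def start (γ : T.Curve) : TriSide Tri := γ.cross 0

/-- The corner at which the curve ends. -/
def finish (γ : T.Curve) : TriSide Tri := T.glue (γ.cross (γ.len - 1))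

/-- The same curve with the opposite direction. -/
def reverse (γ : T.Curve) : T.Curve where
  len := γ.len
  len_pos := γ.len_pos
  cross j := T.glue (γ.cross (γ.len - 1 - j))
  interior j _ := not_isBoundary_glue (γ.interior _ (by have := γ.len_pos; omega))
  chain j hj := by
    have h := γ.chain (γ.len - 1 - (j + 1)) (by omega)
    rw [show γ.len - 1 - (j + 1) + 1 = γ.len - 1 - j by omega] at h
    rw [T.glue_glue]
    exact ⟨h.1.symm, h.2.symm⟩

/-- Concatenation of two sequences of crossings. -/
def append (α β : T.Curve)
    (h : β.start.1 = α.finish.1 ∧ β.start ≠ α.finish) : T.Curve where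
  len := α.len + β.len
  len_pos := Nat.add_pos_left α.len_pos _
  cross j := if j < α.len then α.cross j else β.cross (j - α.len)
  interior j hj := by
    split_ifs with h1
    · exact α.interior j h1
    · exact β.interior _ (by omega)
  chain j hj := by
    have := α.len_pos
    by_cases h1 : j + 1 < α.len
    · rw [if_pos h1, if_pos (by omega)]
      exact α.chain j h1
    · rw [if_neg h1]
      by_cases h2 : j < α.len
      · rw [if_pos h2, show j + 1 - α.len = 0 by omega, show j = α.len - 1 by omega]
        exact h
      · rw [if_neg h2, show j + 1 - α.len = j - α.len + 1 by omega]
        exact β.chain _ (by omega)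

end Curve

/-- The two ways to go round a puncture. -/
inductive Sense
  | ccw
  | cw

/-- The crossings in one counter-clockwise turn about the puncture at the corner `c`, which begins
and ends in the triangle of `c`. -/
noncomputable def turnCCW (c : TriSide Tri) (h : T.IsPuncture c) : T.Curve where
  len := T.degree c
  len_pos := degree_pos h
  cross j := ((T.rotate^[j] c).1, (T.rotate^[j] c).2 + 1)
  interior j _ := h.2 j
  chain j _ := by
    rw [Function.iterate_succ_apply']
    refine ⟨rfl, fun H => ?_⟩
    have H2 := congrArg Prod.snd H
    simp only [rotate, add_assoc, add_eq_left] at H2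
    exact absurd H2 (by decide)

/-- The crossings in one turn about the puncture at the corner `c`, counter-clockwise or clockwise,
which begins and ends in the triangle of `c`. -/
noncomputable def turn (c : TriSide Tri) (h : T.IsPuncture c) : Sense → T.Curve
  | .ccw => turnCCW c h
  | .cw => (turnCCW c h).reverse

theorem turnCCW_start (c : TriSide Tri) (h : T.IsPuncture c) :
    (turnCCW c h).start = (c.1, c.2 + 1) := rfl

theorem turnCCW_finish (c : TriSide Tri) (h : T.IsPuncture c) :
    (turnCCW c h).finish = (c.1, c.2 + 2) := by
  have h1 : T.rotate (T.rotate^[T.degree c - 1] c) = c := by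
    rw [← Function.iterate_succ_apply' T.rotate, Nat.succ_eq_add_one,
      Nat.sub_add_cancel (degree_pos h)]
    exact Function.iterate_minimalPeriod
  set d := T.rotate^[T.degree c - 1] c with hd
  have h2 : (turnCCW c h).finish = T.glue (d.1, d.2 + 1) := rfl
  rw [h2]
  have ha := congrArg Prod.fst h1
  have hb := congrArg Prod.snd h1
  simp only [rotate] at ha hb
  refine Prod.ext ha ?_
  change (T.glue (d.1, d.2 + 1)).2 = c.2 + 2
  rw [← hb, add_assoc, show (1 + 2 : ZMod 3) = 0 by decide, add_zero]

theorem reverse_start (γ : T.Curve) : γ.reverse.start = γ.finish := rfl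

theorem reverse_finish (γ : T.Curve) : γ.reverse.finish = γ.start := by
  simp [Curve.finish, Curve.reverse, Curve.start, T.glue_glue]

theorem append_start (α β : T.Curve) (h) : (α.append β h).start = α.start := by
  simp [Curve.append, Curve.start, α.len_pos]

theorem append_finish (α β : T.Curve) (h) : (α.append β h).finish = β.finish := by
  have := β.len_pos
  simp only [Curve.finish, Curve.append]
  rw [if_neg (by omega), show α.len + β.len - 1 - α.len = β.len - 1 by omega]

theorem turn_start (c : TriSide Tri) (h : T.IsPuncture c) (s : Sense) :
    (turn c h s).start.1 = c.1 ∧ (turn c h s).start ≠ c := by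
  cases s
  · exact ⟨rfl, fun H => absurd (congrArg Prod.snd H) (by simp [turn, turnCCW_start])⟩
  · change (turnCCW c h).finish.1 = c.1 ∧ (turnCCW c h).finish ≠ c
    rw [turnCCW_finish]
    exact ⟨rfl, fun H => absurd (add_eq_left.mp (congrArg Prod.snd H)) (by decide)⟩

theorem turn_finish (c : TriSide Tri) (h : T.IsPuncture c) (s : Sense) :
    (turn c h s).finish.1 = c.1 ∧ (turn c h s).finish ≠ c := by
  cases s
  · change (turnCCW c h).finish.1 = c.1 ∧ (turnCCW c h).finish ≠ c
    rw [turnCCW_finish]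
    exact ⟨rfl, fun H => absurd (add_eq_left.mp (congrArg Prod.snd H)) (by decide)⟩
  · change (turnCCW c h).reverse.finish.1 = c.1 ∧ (turnCCW c h).reverse.finish ≠ c
    rw [reverse_finish]
    exact ⟨rfl, fun H => absurd (congrArg Prod.snd H) (by simp [turnCCW_start])⟩

namespace Curve

/-- The loop based at the start of `γ` which encloses `γ` in a monogon whose only puncture is the
endpoint of `γ`: it runs along `γ`, goes once round that puncture, and returns along `γ`. -/
noncomputable def enclose (γ : T.Curve) (h : T.IsPuncture γ.finish) (s : Sense) : T.Curve :=
  (γ.append (turn γ.finish h s) (turn_start _ h s)).append γ.reverse (by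
    rw [append_finish, reverse_start]
    exact ⟨(turn_finish _ h s).1.symm, (turn_finish _ h s).2.symm⟩)

/-- The hooked curve of `γ`, with a hook at each of its two ends: it goes once round the first
puncture, follows `γ`, and goes once round the second puncture. -/
noncomputable def hooked (γ : T.Curve) (h₁ : T.IsPuncture γ.start) (h₂ : T.IsPuncture γ.finish)
    (s₁ s₂ : Sense) : T.Curve :=
  ((turn γ.start h₁ s₁).append γ
    ⟨(turn_finish _ h₁ s₁).1.symm, (turn_finish _ h₁ s₁).2.symm⟩).append
    (turn γ.finish h₂ s₂) (by
      rw [append_finish]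
      exact turn_start _ h₂ s₂)

end Curve

end IdealTriangulation

/-! ### Graphs and perfect matchings -/

/-- A graph (parallel edges allowed), given by its vertices, its edges and their incidence. -/
structure IncGraph (V E : Type*) where
  verts : Set V
  edges : Set E
  Inc : E → V → Prop

namespace IncGraph

variable {V E V' E' : Type*}

/-- A set of edges such that every vertex is contained in exactly one of them. -/
def IsPerfectMatching (G : IncGraph V E) (P : Finset E) : Prop :=
  (∀ e ∈ P, e ∈ G.edges) ∧ ∀ v ∈ G.verts, ∃! e, e ∈ P ∧ G.Inc e v

/-- The graph obtained by identifying vertices which have the same image under `f` and edges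
which have the same image under `g`. -/
def glueAlong (G : IncGraph V E) (f : V → V') (g : E → E') : IncGraph V' E' where
  verts := f '' G.verts
  edges := g '' G.edges
  Inc e' v' := ∃ e ∈ G.edges, ∃ v ∈ G.verts, G.Inc e v ∧ g e = e' ∧ f v = v'

end IncGraph

/-! ### Snake graphs -/

/-- The four sides of a tile. -/
inductive Dir
  | N
  | E
  | S
  | W
  deriving DecidableEq

/-- Points of the plane lattice, which serve as vertices of snake graphs. -/
abbrev LatticePt := ℤ × ℤ

/-- The side `s` of the unit tile with South-West vertex `p`. -/
def tileSide (p : LatticePt) : Dir → Sym2 LatticePt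
  | .N => s(p + (0, 1), p + (1, 1))
  | .E => s(p + (1, 0), p + (1, 1))
  | .S => s(p, p + (1, 0))
  | .W => s(p, p + (0, 1))

/-- A snake graph embedded in the plane lattice, with tiles `0, …, numTiles - 1`: the tile `j` is
the unit square with South-West vertex `corner j`, and the next tile is glued to its East or to its
North edge. Every tile has a relative orientation `rel j`, its (deleted) diagonal from North-West to
South-East is labelled by `diag j`, and its sides are labelled consistently. Values at indices
`≥ numTiles` have no meaning. -/
structure SnakeGraph (L : Type*) where
  numTiles : ℕ
  corner : ℕ → LatticePt
  step : ∀ j, j + 1 < numTiles →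
    corner (j + 1) = corner j + (1, 0) ∨ corner (j + 1) = corner j + (0, 1)
  rel : ℕ → ℤˣ
  diag : ℕ → L
  label : ℕ → Dir → L
  label_eq : ∀ j j' s s', j < numTiles → j' < numTiles →
    tileSide (corner j) s = tileSide (corner j') s' → label j s = label j' s'

namespace SnakeGraph

variable {L K : Type*}

/-- The South-West vertex of a tile. -/
def sw (G : SnakeGraph L) (j : ℕ) : LatticePt := G.corner j
/-- The South-East vertex of a tile. -/
def se (G : SnakeGraph L) (j : ℕ) : LatticePt := G.corner j + (1, 0)
/-- The North-West vertex of a tile. -/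
def nw (G : SnakeGraph L) (j : ℕ) : LatticePt := G.corner j + (0, 1)
/-- The North-East vertex of a tile. -/
def ne (G : SnakeGraph L) (j : ℕ) : LatticePt := G.corner j + (1, 1)

/-- The side `s` of the tile `j`, as an edge of the snake graph. -/
def edge (G : SnakeGraph L) (j : ℕ) (s : Dir) : Sym2 LatticePt := tileSide (G.corner j) s

/-- The underlying graph: the vertices and sides of the tiles. -/
def graph (G : SnakeGraph L) : IncGraph LatticePt (Sym2 LatticePt) where
  verts := {v | ∃ j < G.numTiles, v = G.sw j ∨ v = G.se j ∨ v = G.nw j ∨ v = G.ne j}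
  edges := {e | ∃ j < G.numTiles, ∃ s, e = G.edge j s}
  Inc e v := v ∈ e

/-- The sub snake graph on the `n` consecutive tiles `a, …, a + n - 1`. -/
def sub (G : SnakeGraph L) (a n : ℕ) (h : a + n ≤ G.numTiles) : SnakeGraph L where
  numTiles := n
  corner j := G.corner (a + j)
  step j hj := G.step (a + j) (by omega)
  rel j := G.rel (a + j)
  diag j := G.diag (a + j)
  label j := G.label (a + j)
  label_eq j j' s s' hj hj' he := G.label_eq (a + j) (a + j') s s' (by omega) (by omega) he

open Classical in
/-- The restriction to the subgraph `H` of a set `P` of edges. -/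
noncomputable def restrict (P : Finset (Sym2 LatticePt)) (H : SnakeGraph L) :
    Finset (Sym2 LatticePt) :=
  P.filter fun e => e ∈ H.graph.edges

open Classical in
/-- The weight `w l` of the label `l` of an edge of the snake graph (and `1` off the graph). -/
noncomputable def edgeWeight [One K] (G : SnakeGraph L) (w : L → K) (e : Sym2 LatticePt) : K :=
  if h : ∃ p : ℕ × Dir, p.1 < G.numTiles ∧ e = G.edge p.1 p.2 then
    w (G.label h.choose.1 h.choose.2) else 1

theorem edgeWeight_edge [One K] (G : SnakeGraph L) (w : L → K) {j : ℕ} (hj : j < G.numTiles)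
    (s : Dir) : G.edgeWeight w (G.edge j s) = w (G.label j s) := by
  have h : ∃ p : ℕ × Dir, p.1 < G.numTiles ∧ G.edge j s = G.edge p.1 p.2 := ⟨(j, s), hj, rfl⟩
  rw [edgeWeight, dif_pos h]
  exact congrArg w (G.label_eq _ _ _ _ h.choose_spec.1 hj h.choose_spec.2.symm)

/-- The product of the weights of the edges in `P`. -/
noncomputable def weightProd [CommMonoid K] (G : SnakeGraph L) (w : L → K)
    (P : Finset (Sym2 LatticePt)) : K :=
  ∏ e ∈ P, G.edgeWeight w e

/-- The path from the South-West vertex of the first tile which travels alternately along edges of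
`P` and diagonals: `Walk P j v` says that it is at the vertex `v` after it has traversed `j`
diagonals. -/
inductive Walk (G : SnakeGraph L) (P : Finset (Sym2 LatticePt)) : ℕ → LatticePt → Prop
  | start : Walk G P 0 (G.sw 0)
  | down {j v} : Walk G P j v → s(v, G.nw j) ∈ P → Walk G P (j + 1) (G.se j)
  | up {j v} : Walk G P j v → s(v, G.se j) ∈ P → Walk G P (j + 1) (G.nw j)

/-- The perfect matching `P` orients the diagonal of the tile `j` down (North-West to
South-East). -/
def IsDown (G : SnakeGraph L) (P : Finset (Sym2 LatticePt)) (j : ℕ) : Prop :=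
  ∃ v, G.Walk P j v ∧ s(v, G.nw j) ∈ P

/-- The perfect matching `P` orients the diagonal of the tile `j` up (South-East to
North-West). -/
def IsUp (G : SnakeGraph L) (P : Finset (Sym2 LatticePt)) (j : ℕ) : Prop :=
  ∃ v, G.Walk P j v ∧ s(v, G.se j) ∈ P

/-- The diagonal of the tile `j` is positive with respect to `P`. -/
def IsPositive (G : SnakeGraph L) (P : Finset (Sym2 LatticePt)) (j : ℕ) : Prop :=
  (G.IsDown P j ∧ G.rel j = 1) ∨ (G.IsUp P j ∧ G.rel j = -1)

open Classical in
/-- The product of the weights of the positive diagonals. -/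
noncomputable def positiveProd [CommMonoid K] (G : SnakeGraph L) (w : L → K)
    (P : Finset (Sym2 LatticePt)) : K :=
  ∏ j ∈ (range G.numTiles).filter (fun j => G.IsPositive P j), w (G.diag j)

end SnakeGraph

/-! ### Loop graphs -/

/-- The data of a loop graph: a snake graph together with the tiles `k₁` and `k₂` to which its
first and last tile are glued, and the sides of the first and of the last tile that are glued. There
is no loop at the first (last) tile if `k₁` (`k₂`) is that tile itself. -/
structure LoopGraph (L : Type*) where
  snake : SnakeGraph L
  k₁ : ℕ
  k₂ : ℕ
  k₁_le : k₁ ≤ k₂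
  k₂_lt : k₂ < snake.numTiles
  cut₁ : Dir
  cut₂ : Dir
  cut₁_mem : cut₁ = .S ∨ cut₁ = .W
  cut₂_mem : cut₂ = .N ∨ cut₂ = .E

/-- The side of the tile `k` (with `0 < k`) among South and West which is not glued to the
preceding tile. -/
def SnakeGraph.freeSide₁ {L : Type*} (G : SnakeGraph L) (k : ℕ) : Dir :=
  if G.corner k = G.corner (k - 1) + (1, 0) then .S else .W

/-- The side of the tile `k` (with `k + 1 < numTiles`) among North and East which is not glued to
the following tile. -/
def SnakeGraph.freeSide₂ {L : Type*} (G : SnakeGraph L) (k : ℕ) : Dir :=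
  if G.corner (k + 1) = G.corner k + (1, 0) then .N else .E

namespace LoopGraph

variable {L K : Type*} (B : LoopGraph L)

/-- The index of the last tile. -/
def last : ℕ := B.snake.numTiles - 1

/-- There is a loop at the first tile. -/
def HasLoop₁ : Prop := B.k₁ ≠ 0

/-- There is a loop at the last tile. -/
def HasLoop₂ : Prop := B.k₂ ≠ B.last

/-- The edge `c` of the first tile. -/
def c₁ : Sym2 LatticePt := B.snake.edge 0 B.cut₁
/-- The boundary edge `c'` of the tile `k₁`. -/
def c₁' : Sym2 LatticePt := B.snake.edge B.k₁ (B.snake.freeSide₁ B.k₁)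
/-- The edge `c` of the last tile. -/
def c₂ : Sym2 LatticePt := B.snake.edge B.last B.cut₂
/-- The boundary edge `c'` of the tile `k₂`. -/
def c₂' : Sym2 LatticePt := B.snake.edge B.k₂ (B.snake.freeSide₂ B.k₂)

/-- The South-West vertex `x` of the first tile. -/
def x₁ : LatticePt := B.snake.sw 0
/-- The other vertex `y` of the edge `c₁`. -/
def y₁ : LatticePt := if B.cut₁ = .S then B.snake.se 0 else B.snake.nw 0
/-- The South-West vertex `y'` of the tile `k₁`. -/
def y₁' : LatticePt := B.snake.sw B.k₁
/-- The other vertex `x'` of the edge `c₁'`. -/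
def x₁' : LatticePt :=
  if B.snake.freeSide₁ B.k₁ = .S then B.snake.se B.k₁ else B.snake.nw B.k₁

/-- The North-East vertex `x` of the last tile. -/
def x₂ : LatticePt := B.snake.ne B.last
/-- The other vertex `y` of the edge `c₂`. -/
def y₂ : LatticePt := if B.cut₂ = .N then B.snake.nw B.last else B.snake.se B.last
/-- The North-East vertex `y'` of the tile `k₂`. -/
def y₂' : LatticePt := B.snake.ne B.k₂
/-- The other vertex `x'` of the edge `c₂'`. -/
def x₂' : LatticePt :=
  if B.snake.freeSide₂ B.k₂ = .N then B.snake.nw B.k₂ else B.snake.se B.k₂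

open Classical in
/-- The gluing of the vertices: `x` to `x'` and `y` to `y'`, at every loop. The vertices `x'` and
`y'` represent the glued ones. -/
noncomputable def glueVert (v : LatticePt) : LatticePt :=
  if B.HasLoop₁ ∧ v = B.x₁ then B.x₁'
  else if B.HasLoop₁ ∧ v = B.y₁ then B.y₁'
  else if B.HasLoop₂ ∧ v = B.x₂ then B.x₂'
  else if B.HasLoop₂ ∧ v = B.y₂ then B.y₂'
  else v

open Classical in
/-- The gluing of the edges: `c` to `c'`, at every loop. The edge `c'` represents the glued one. -/
noncomputable def glueEdge (e : Sym2 LatticePt) : Sym2 LatticePt :=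
  if B.HasLoop₁ ∧ e = B.c₁ then B.c₁'
  else if B.HasLoop₂ ∧ e = B.c₂ then B.c₂'
  else e

/-- The underlying graph of the loop graph. -/
noncomputable def graph : IncGraph LatticePt (Sym2 LatticePt) :=
  B.snake.graph.glueAlong B.glueVert B.glueEdge

/-- `e` is one of the edges `c`, `c'` of the snake graph that are glued to each other. -/
def IsCutEdge (e : Sym2 LatticePt) : Prop :=
  (B.HasLoop₁ ∧ (e = B.c₁ ∨ e = B.c₁')) ∨ (B.HasLoop₂ ∧ (e = B.c₂ ∨ e = B.c₂'))

/-- `Q` is a perfect matching of the underlying snake graph which extends the set `P` of edges of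
the loop graph, by edges that lie on the cuts. -/
def Extends (P Q : Finset (Sym2 LatticePt)) : Prop :=
  B.snake.graph.IsPerfectMatching Q ∧ P ⊆ Q ∧ ∀ e ∈ Q, e ∉ P → B.IsCutEdge e

/-- A good matching: a perfect matching of the loop graph which can be extended to a perfect
matching of the underlying snake graph. -/
def IsGoodMatching (P : Finset (Sym2 LatticePt)) : Prop :=
  B.graph.IsPerfectMatching P ∧ ∃ Q, B.Extends P Q

end LoopGraph

/-! ### Snake graphs and loop graphs from surfaces -/

/-- The sides of the quadrilateral around a crossing of a directed curve: `back` and `front` say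
whether the side belongs to the triangle before or after the crossing, `left` and `right` whether it
lies on the left or on the right of the curve. -/
inductive Slot
  | backLeft
  | backRight
  | frontLeft
  | frontRight

namespace Slot

/-- The same side of the quadrilateral, as seen from the curve with the opposite direction. -/
def opp : Slot → Slot
  | backLeft => frontRight
  | backRight => frontLeft
  | frontLeft => backRight
  | frontRight => backLeft

/-- The side belongs to the triangle after the crossing. -/
def IsFront (s : Slot) : Prop := s = frontLeft ∨ s = frontRight

/-- The position of the sides of the quadrilateral in a tile whose diagonal from North-West to
South-East is the crossed side, and whose lower half is the triangle before the crossing. If the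
relative orientation is `1` then the embedding preserves the orientation; if it is `-1` then the
embedding reverses it. -/
def dir (ε : ℤˣ) : Slot → Dir
  | backLeft => if ε = 1 then .W else .S
  | backRight => if ε = 1 then .S else .W
  | frontLeft => if ε = 1 then .N else .E
  | frontRight => if ε = 1 then .E else .N

/-- The side of the quadrilateral which is put in a given position of the tile. -/
def ofDir (ε : ℤˣ) : Dir → Slot
  | .N => if ε = 1 then frontLeft else frontRight
  | .E => if ε = 1 then frontRight else frontLeft
  | .S => if ε = 1 then backRight else backLeft
  | .W => if ε = 1 then backLeft else backRight

end Slot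

namespace IdealTriangulation

variable {Tri : Type*} {T : IdealTriangulation Tri}

namespace Curve

/-- The sides of the quadrilateral formed by the two triangles around the `j`-th crossing. -/
def quadSide (γ : T.Curve) (j : ℕ) : Slot → TriSide Tri
  | .backLeft => ((γ.cross j).1, (γ.cross j).2 + 1)
  | .backRight => ((γ.cross j).1, (γ.cross j).2 + 2)
  | .frontLeft => ((T.glue (γ.cross j)).1, (T.glue (γ.cross j)).2 + 2)
  | .frontRight => ((T.glue (γ.cross j)).1, (T.glue (γ.cross j)).2 + 1)

/-- The side by which the quadrilateral around the `j`-th crossing is glued to the next one: the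
third side of the triangle between the two crossings. -/
noncomputable def glueSlot (γ : T.Curve) (j : ℕ) : Slot :=
  if (γ.cross (j + 1)).2 = (T.glue (γ.cross j)).2 + 1 then .frontLeft else .frontRight

/-- The relative orientations of the tiles: they alternate, and the first one is `ε`. -/
def relOr (ε : ℤˣ) (j : ℕ) : ℤˣ := ε * (-1) ^ j

/-- The positions of the tiles in the plane. -/
noncomputable def tilePos (γ : T.Curve) (ε : ℤˣ) : ℕ → LatticePt
  | 0 => (0, 0)
  | j + 1 => γ.tilePos ε j +
      if (γ.glueSlot j).dir (relOr ε j) = .E then (1, 0) else (0, 1)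

theorem tilePos_step (γ : T.Curve) (ε : ℤˣ) (j : ℕ) :
    γ.tilePos ε (j + 1) = γ.tilePos ε j + (1, 0) ∨
      γ.tilePos ε (j + 1) = γ.tilePos ε j + (0, 1) := by
  simp only [tilePos]
  split_ifs <;> simp

theorem tilePos_sum (γ : T.Curve) (ε : ℤˣ) (j : ℕ) :
    (γ.tilePos ε j).1 + (γ.tilePos ε j).2 = j := by
  induction j with
  | zero => rfl
  | succ j ih =>
    rcases γ.tilePos_step ε j with h | h <;> rw [h] <;> simp <;> linarith

theorem glueSlot_spec (γ : T.Curve) {j : ℕ} (hj : j + 1 < γ.len) :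
    (γ.glueSlot j = .frontLeft ∧
      γ.cross (j + 1) = ((T.glue (γ.cross j)).1, (T.glue (γ.cross j)).2 + 1)) ∨
    (γ.glueSlot j = .frontRight ∧
      γ.cross (j + 1) = ((T.glue (γ.cross j)).1, (T.glue (γ.cross j)).2 + 2)) := by
  obtain ⟨h1, h2⟩ := γ.chain j hj
  by_cases h : (γ.cross (j + 1)).2 = (T.glue (γ.cross j)).2 + 1
  · exact Or.inl ⟨if_pos h, Prod.ext h1 h⟩
  · refine Or.inr ⟨if_neg h, Prod.ext h1 ?_⟩
    have h3 : (γ.cross (j + 1)).2 ≠ (T.glue (γ.cross j)).2 := fun h4 => h2 (Prod.ext h1 h4)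
    exact (by decide : ∀ a b : ZMod 3, ¬ a = b + 1 → a ≠ b → a = b + 2) _ _ h h3

theorem label_glue (γ : T.Curve) (ε : ℤˣ) {j : ℕ} (hj : j + 1 < γ.len) :
    (γ.tilePos ε (j + 1) = γ.tilePos ε j + (0, 1) →
      γ.quadSide j (Slot.ofDir (relOr ε j) .N) =
        γ.quadSide (j + 1) (Slot.ofDir (relOr ε (j + 1)) .S)) ∧
    (γ.tilePos ε (j + 1) = γ.tilePos ε j + (1, 0) →
      γ.quadSide j (Slot.ofDir (relOr ε j) .E) =
        γ.quadSide (j + 1) (Slot.ofDir (relOr ε (j + 1)) .W)) := by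
  have hr : relOr ε (j + 1) = - relOr ε j := by simp [relOr, pow_succ]
  have h22 : (2 + 2 : ZMod 3) = 1 := by decide
  have h11 : (1 + 1 : ZMod 3) = 2 := by decide
  rw [hr]
  simp only [tilePos]
  rcases Int.units_eq_one_or (relOr ε j) with h | h <;>
  rcases γ.glueSlot_spec hj with ⟨h1, h2⟩ | ⟨h1, h2⟩ <;>
  simp [h, h1, h2, Slot.dir, Slot.ofDir, quadSide, add_assoc, h22, h11]

theorem tileSide_eq {p q : LatticePt} {s s' : Dir} (h : tileSide p s = tileSide q s') :
    (p = q ∧ s = s') ∨ (s = .N ∧ s' = .S ∧ q = p + (0, 1)) ∨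
    (s = .S ∧ s' = .N ∧ p = q + (0, 1)) ∨ (s = .E ∧ s' = .W ∧ q = p + (1, 0)) ∨
    (s = .W ∧ s' = .E ∧ p = q + (1, 0)) := by
  obtain ⟨a, b⟩ := p
  obtain ⟨c, d⟩ := q
  cases s <;> cases s' <;>
    simp [tileSide] at h ⊢ <;> omega

/-- The snake graph of a curve; its edges are labelled by sides of triangles, and its first tile has
relative orientation `ε`. -/
noncomputable def snakeGraph (γ : T.Curve) (ε : ℤˣ) : SnakeGraph (TriSide Tri) where
  numTiles := γ.len
  corner := γ.tilePos ε
  step j _ := γ.tilePos_step ε j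
  rel := relOr ε
  diag := γ.cross
  label j s := γ.quadSide j (Slot.ofDir (relOr ε j) s)
  label_eq j j' s s' hj hj' h := by
    have e1 := γ.tilePos_sum ε j
    have e2 := γ.tilePos_sum ε j'
    rcases tileSide_eq h with ⟨h1, h2⟩ | ⟨h1, h2, h3⟩ | ⟨h1, h2, h3⟩ | ⟨h1, h2, h3⟩ | ⟨h1, h2, h3⟩
    · rw [h1, e2] at e1
      obtain rfl : j' = j := by exact_mod_cast e1
      rw [h2]
    · subst h1 h2
      have e3 := h3
      rw [h3] at e2
      simp only [Prod.fst_add, Prod.snd_add] at e2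
      obtain rfl : j' = j + 1 := by omega
      exact (γ.label_glue ε hj').1 e3
    · subst h1 h2
      have e3 := h3
      rw [h3] at e1
      simp only [Prod.fst_add, Prod.snd_add] at e1
      obtain rfl : j = j' + 1 := by omega
      exact ((γ.label_glue ε hj).1 e3).symm
    · subst h1 h2
      have e3 := h3
      rw [h3] at e2
      simp only [Prod.fst_add, Prod.snd_add] at e2
      obtain rfl : j' = j + 1 := by omega
      exact (γ.label_glue ε hj').2 e3
    · subst h1 h2
      have e3 := h3
      rw [h3] at e1
      simp only [Prod.fst_add, Prod.snd_add] at e1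
      obtain rfl : j = j' + 1 := by omega
      exact ((γ.label_glue ε hj).2 e3).symm

end Curve

/-! ### Variables -/

variable (T) in
/-- The field of rational functions in variables `x_e` and `y_e`, for the edges `e` of the
triangulation. (The variables of boundary segments are not used.) The variables with the index `e`
are those of the tagged arc that corresponds to the arc `e` of `T`. -/
abbrev FunctionField : Type _ := FractionRing (MvPolynomial (T.Edge ⊕ T.Edge) ℚ)

variable (T) in
/-- The variable `x` of the edge on which the side `h` lies. -/
noncomputable def xVar (h : TriSide Tri) : T.FunctionField :=
  algebraMap (MvPolynomial (T.Edge ⊕ T.Edge) ℚ) _ (MvPolynomial.X (Sum.inl (T.edgeOf h)))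

variable (T) in
/-- The variable `y` of the edge on which the side `h` lies. -/
noncomputable def yVar (h : TriSide Tri) : T.FunctionField :=
  algebraMap (MvPolynomial (T.Edge ⊕ T.Edge) ℚ) _ (MvPolynomial.X (Sum.inr (T.edgeOf h)))

open Classical in
variable (T) in
/-- The variable `x` of the radius of the self-folded triangle whose outer side is `h`, and `1` if
`h` is not the outer side of a self-folded triangle. -/
noncomputable def radiusVar (h : TriSide Tri) : T.FunctionField :=
  if T.IsFoldedCorner h then T.xVar (h.1, h.2 + 1) else 1

open Classical in
variable (T) in
/-- The element `x_τ` for the edge `τ` on which the side `h` lies: `1` for a boundary segment,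
the product of the variables of `τ` and of the enclosed radius if `τ` encloses a
once-punctured monogon (on either side of `τ`), and the variable of `τ` otherwise. -/
noncomputable def xWeight (h : TriSide Tri) : T.FunctionField :=
  if T.IsBoundary h then 1 else T.xVar h * T.radiusVar h * T.radiusVar (T.glue h)

open Classical in
variable (T) in
/-- The contribution to the coefficient monomial of a positive diagonal labelled by the side `h` of
an arc `τ`: it is `y_τ`, divided by the variable `y` of the enclosing loop if `τ` is the radius of a
self-folded triangle. (That loop corresponds to the tagged arc obtained from `τ` by adding a notch
at the enclosed puncture.) -/
noncomputable def yWeight (h : TriSide Tri) : T.FunctionField :=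
  T.yVar h *
    (if T.glue h = (h.1, h.2 + 1) then (T.yVar (h.1, h.2 + 2))⁻¹
    else if T.glue h = (h.1, h.2 + 2) then (T.yVar (h.1, h.2 + 1))⁻¹ else 1)

/-- The weight monomial `x(P)` of a set of edges of a snake graph or loop graph. -/
noncomputable def xMonomial (G : SnakeGraph (TriSide Tri)) (P : Finset (Sym2 LatticePt)) :
    T.FunctionField :=
  G.weightProd T.xWeight P

/-- The coefficient monomial `y(P)` of a perfect matching of a snake graph. -/
noncomputable def yMonomial (G : SnakeGraph (TriSide Tri)) (P : Finset (Sym2 LatticePt)) :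
    T.FunctionField :=
  G.positiveProd T.yWeight P

namespace Curve

/-! ### Symmetric perfect matchings -/

variable (γ : T.Curve) (h : T.IsPuncture γ.finish) (s : Sense) (ε : ℤˣ)

/-- The snake graph of the loop which encloses `γ` and the puncture at its end. -/
noncomputable def loopSnake : SnakeGraph (TriSide Tri) := (γ.enclose h s).snakeGraph ε

/-- The two copies of (the sides of) the snake graph of `γ` in the snake graph of the loop. -/
inductive Copy
  | first
  | second

/-- The tile which corresponds to the `m`-th crossing of `γ`, in each of the two copies. The second
copy is traversed in the opposite direction. -/
noncomputable def copyTile : Copy → ℕ → ℕ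
  | .first, m => m
  | .second, m => (γ.enclose h s).len - 1 - m

/-- The edge, in each of the two copies, which corresponds to a given side of the quadrilateral
around the `m`-th crossing of `γ`, as seen from `γ`. The canonical isomorphisms between copies
of the snake graph of `γ` match the edges with equal `m` and `σ`. -/
noncomputable def copyEdge (i : Copy) (m : ℕ) (σ : Slot) : Sym2 LatticePt :=
  (γ.loopSnake h s ε).edge (γ.copyTile h s i m)
    (match i with
      | .first => σ.dir ((γ.loopSnake h s ε).rel (γ.copyTile h s i m))
      | .second => σ.opp.dir ((γ.loopSnake h s ε).rel (γ.copyTile h s i m)))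

/-- The two copies of the snake graph of `γ`, which are the sub snake graphs on the first and on
the last `γ.len` tiles. -/
noncomputable def copyGraph : Copy → SnakeGraph (TriSide Tri)
  | .first => (γ.loopSnake h s ε).sub 0 γ.len (by
      simp [loopSnake, snakeGraph, enclose, append, reverse])
  | .second => (γ.loopSnake h s ε).sub (γ.len + T.degree γ.finish) γ.len (by
      cases s <;>
        simp [loopSnake, snakeGraph, enclose, append, reverse, turn, turnCCW])

/-- A perfect matching of the snake graph of the loop is `γ`-symmetric if its restrictions to the
two copies, with the vertex at the puncture and the two edges at it removed, correspond to each
other. The removed edges are those in front of the last crossing of `γ`. -/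
def IsSymmetric (P : Finset (Sym2 LatticePt)) : Prop :=
  (γ.loopSnake h s ε).graph.IsPerfectMatching P ∧
    ∀ m < γ.len, ∀ σ : Slot, ¬ (m = γ.len - 1 ∧ σ.IsFront) →
      (γ.copyEdge h s ε .first m σ ∈ P ↔ γ.copyEdge h s ε .second m σ ∈ P)

end Curve

/-! ### Doubly notched arcs -/

variable (T) in
/-- An arc, not in `T`, both of whose ends are notched at a puncture (possibly the same one). -/
structure DoublyNotched extends Curve T where
  puncture_start : T.IsPuncture toCurve.start
  puncture_finish : T.IsPuncture toCurve.finish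

namespace DoublyNotched

variable (γ : T.DoublyNotched)

/-- The choices made in the construction of a snake graph of the loop at an end of a doubly notched
arc: the direction of the loop, and the relative orientation of the first tile. -/
structure Choice where
  sense : Sense
  rel : ℤˣ

/-- The hypothesis that the start of the reversed arc is a puncture. -/
theorem puncture_reverse : T.IsPuncture γ.toCurve.reverse.finish := by
  rw [reverse_finish]
  exact γ.puncture_start

/-- The snake graph of `ℓ_p`, where `p` is the puncture at the start of `γ`. The loop `ℓ_p` starts
at the other end of `γ`. -/
noncomputable def snakeP (a : Choice) : SnakeGraph (TriSide Tri) :=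
  γ.toCurve.reverse.loopSnake γ.puncture_reverse a.sense a.rel

/-- The snake graph of `ℓ_q`, where `q` is the puncture at the end of `γ`. -/
noncomputable def snakeQ (b : Choice) : SnakeGraph (TriSide Tri) :=
  γ.toCurve.loopSnake γ.puncture_finish b.sense b.rel

/-- The copies of the snake graph of `γ` in that of `ℓ_p`. -/
noncomputable def copyP (a : Choice) (i : Curve.Copy) : SnakeGraph (TriSide Tri) :=
  γ.toCurve.reverse.copyGraph γ.puncture_reverse a.sense a.rel i

/-- The copies of the snake graph of `γ` in that of `ℓ_q`. -/
noncomputable def copyQ (b : Choice) (j : Curve.Copy) : SnakeGraph (TriSide Tri) :=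
  γ.toCurve.copyGraph γ.puncture_finish b.sense b.rel j

/-- The edges of the copies in the snake graph of `ℓ_p`, indexed as seen from `γ`. -/
noncomputable def copyEdgeP (a : Choice) (i : Curve.Copy) (m : ℕ) (σ : Slot) : Sym2 LatticePt :=
  γ.toCurve.reverse.copyEdge γ.puncture_reverse a.sense a.rel i (γ.len - 1 - m) σ.opp

/-- The edges of the copies in the snake graph of `ℓ_q`, indexed as seen from `γ`. -/
noncomputable def copyEdgeQ (b : Choice) (j : Curve.Copy) (m : ℕ) (σ : Slot) : Sym2 LatticePt :=
  γ.toCurve.copyEdge γ.puncture_finish b.sense b.rel j m σ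

/-- The restrictions of `Pp` and `Pq` to the copies `i` and `j` are perfect matchings of these
copies, which correspond to each other under the canonical isomorphism. -/
def MatchAlong (a b : Choice) (i j : Curve.Copy) (Pp Pq : Finset (Sym2 LatticePt)) : Prop :=
  (γ.copyP a i).graph.IsPerfectMatching (SnakeGraph.restrict Pp (γ.copyP a i)) ∧
  (γ.copyQ b j).graph.IsPerfectMatching (SnakeGraph.restrict Pq (γ.copyQ b j)) ∧
  ∀ m < γ.len, ∀ σ : Slot, γ.copyEdgeP a i m σ ∈ Pp ↔ γ.copyEdgeQ b j m σ ∈ Pq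

/-- A `γ`-compatible pair of `γ`-symmetric perfect matchings. -/
def IsCompatiblePair (a b : Choice) (P : Finset (Sym2 LatticePt) × Finset (Sym2 LatticePt)) :
    Prop :=
  γ.toCurve.reverse.IsSymmetric γ.puncture_reverse a.sense a.rel P.1 ∧
  γ.toCurve.IsSymmetric γ.puncture_finish b.sense b.rel P.2 ∧
  ∃ i j, γ.MatchAlong a b i j P.1 P.2

/-- The cluster monomial of a compatible pair, computed with the copy `i`. -/
noncomputable def pairX (a b : Choice) (i : Curve.Copy)
    (P : Finset (Sym2 LatticePt) × Finset (Sym2 LatticePt)) : T.FunctionField :=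
  xMonomial (γ.snakeP a) P.1 * xMonomial (γ.snakeQ b) P.2 /
    xMonomial (γ.copyP a i) (SnakeGraph.restrict P.1 (γ.copyP a i)) ^ 3

/-- The coefficient monomial of a compatible pair, computed with the copy `i`. -/
noncomputable def pairY (a b : Choice) (i : Curve.Copy)
    (P : Finset (Sym2 LatticePt) × Finset (Sym2 LatticePt)) : T.FunctionField :=
  yMonomial (γ.snakeP a) P.1 * yMonomial (γ.snakeQ b) P.2 /
    yMonomial (γ.copyP a i) (SnakeGraph.restrict P.1 (γ.copyP a i)) ^ 3

/-- The snake graph of the hooked arc. -/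
noncomputable def hookedSnake (s₁ s₂ : Sense) (ε : ℤˣ) : SnakeGraph (TriSide Tri) :=
  (γ.toCurve.hooked γ.puncture_start γ.puncture_finish s₁ s₂).snakeGraph ε

/-- The loop graph of a doubly notched arc. It is obtained from the snake graph of the hooked arc by
loops at its first and last tile and at the first and last tile of the snake graph of `γ` in it. The
glued edges of the end tiles are those which lie on the same side of the same triangle as the
boundary edges they are glued to. -/
noncomputable def loopGraph (s₁ s₂ : Sense) (ε : ℤˣ) : LoopGraph (TriSide Tri) :=
  open Classical in
  let G := γ.hookedSnake s₁ s₂ ε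
  let k₁ := T.degree γ.start
  let k₂ := T.degree γ.start + γ.len - 1
  { snake := G
    k₁ := k₁
    k₂ := k₂
    k₁_le := by
      have := γ.len_pos
      omega
    k₂_lt := by
      have := γ.len_pos
      have := degree_pos γ.puncture_finish
      have h : G.numTiles = T.degree γ.start + γ.len + T.degree γ.finish := by
        cases s₁ <;> cases s₂ <;> rfl
      omega
    cut₁ := if G.label 0 .S = G.label k₁ (G.freeSide₁ k₁) then .S else .W
    cut₂ := if G.label (G.numTiles - 1) .N = G.label k₂ (G.freeSide₂ k₂) then .N else .E
    cut₁_mem := by split_ifs <;> simp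
    cut₂_mem := by split_ifs <;> simp }

end DoublyNotched

end IdealTriangulation

/-! ### Perfect matchings of snake graphs as sequences of bits -/

/-! A perfect matching of a snake graph is determined by the directions in which its alternating
walk runs along the diagonals (`SnakeGraph.exists_eq_matching`). A sequence of directions occurs
exactly when every two consecutive tiles satisfy one condition. Recording signs (positive or
negative) instead of directions removes the embedding. The condition becomes an implication between
two signs that depends only on the triangle between the two crossings (`Compat`, `admissible_iff`),
and it survives reversal of the curve (`compat_swap`). A matching along a concatenation is therefore
a tuple of sign sequences on the pieces, with one extra implication at each joint.

Along a counter-clockwise turn about a puncture the signs can only fall from positive to negative.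
Let x be the sign at the crossing of γ nearest to the puncture. The loop passes this crossing before
and after the turn, which gives two bounds: if x is positive then so is the first sign of the turn,
and if the last sign is positive then so is x (`TurnOK`). Symmetry says that both copies of γ carry
the same signs (`isSymmetric_iff`). Compatibility says that the two loops carry the same signs on γ;
the copies i, j that it asks for always exist, because the signs on a turn decrease
(`exists_copyFree`). So compatible pairs are triples (u, a, w) of signs on the turn at p, on γ and
on the turn at q, with both bounds at both punctures (`isCompatiblePair_iff`).

The hooked arc carries the same kind of triple, but each of its turns touches γ at one end only, so
validity gives only one bound per turn (`hook_valid`). The missing bound says exactly that the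
matching contains c or c' at that hook (`DoublyNotched.meets_iff`). Such matchings are the ones that
descend to the loop graph: removing one edge of each glued pair gives a good matching, every good
matching arises in this way, and its extension is unique (`IsCutting.isGluedMatching_core`,
`IsCutting.meets_and_eq_core`, `IsCutting.core_injective`). Degrees at least two keep the glued
edges far enough apart. Good matchings are thus given by the same triples, and this is the
bijection.

The monomials are products over crossings. For y this is immediate; for x it holds after
multiplication by the weights of the edges between consecutive tiles (`weightProd_matching`). If A,
U, W are the contributions of γ and of the two turns, the loops give A²U and A²W and the copy gives
A, so the quotient is AUW, as for the hooked arc. The weights of the edges between tiles balance as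
well: of the two sides of the triangle of `γ.start` (or of `γ.finish`) that meet at the puncture,
one lies between two tiles of the hooked snake graph and the other carries the removed edge c
(`thirdSide_turn`, `xMonomial_core`). -/

/-- The sum of the coordinates; it increases by one along every edge of a snake graph. -/
def latticeLevel (v : LatticePt) : ℤ := v.1 + v.2

theorem latticeLevel_add (v w : LatticePt) :
    latticeLevel (v + w) = latticeLevel v + latticeLevel w := by
  simp only [latticeLevel, Prod.fst_add, Prod.snd_add]; ring

@[simp] theorem latticeLevel_east : latticeLevel (1, 0) = 1 := rfl
@[simp] theorem latticeLevel_north : latticeLevel (0, 1) = 1 := rfl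
@[simp] theorem latticeLevel_diag : latticeLevel (1, 1) = 2 := rfl

/-- The level orients every edge from its lower to its upper end, so unordered pairs can be compared
as ordered ones. -/
theorem sym2_eq_iff_of_level {v w v' w' : LatticePt} (h : latticeLevel w = latticeLevel v + 1)
    (h' : latticeLevel w' = latticeLevel v' + 1) :
    s(v, w) = s(v', w') ↔ v = v' ∧ w = w' := by
  rw [Sym2.eq_iff]
  constructor
  · rintro (h1 | ⟨h1, h2⟩)
    · exact h1
    · rw [h1, h2] at h
      omega
  · exact Or.inl

namespace SnakeGraph

variable {L K : Type*} (G : SnakeGraph L)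

theorem level_corner {j : ℕ} (hj : j < G.numTiles) :
    latticeLevel (G.corner j) = latticeLevel (G.corner 0) + j := by
  induction j with
  | zero => simp
  | succ j ih =>
    have := ih (by omega)
    rcases G.step j hj with h | h <;> rw [h, latticeLevel_add, this] <;> push_cast <;>
      simp <;> ring

/-- The vertex at which the walk given by the bits `D` (`true` for downwards) arrives at the
diagonal of the tile `j`, or at which it ends. -/
def enter (D : ℕ → Bool) (j : ℕ) : LatticePt :=
  if j < G.numTiles then (if D j then G.nw j else G.se j) else G.ne (j - 1)

/-- The vertex at which the walk given by the bits `D` is before its `j`-th edge. -/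
def leave (D : ℕ → Bool) : ℕ → LatticePt
  | 0 => G.sw 0
  | j + 1 => if D j then G.se j else G.nw j

/-- The `j`-th edge of the walk given by the bits `D`. -/
def link (D : ℕ → Bool) (j : ℕ) : Sym2 LatticePt := s(G.leave D j, G.enter D j)

/-- The set of edges in the walk given by the bits `D`. -/
def matching (D : ℕ → Bool) : Finset (Sym2 LatticePt) :=
  (range (G.numTiles + 1)).image (G.link D)

/-- The walk given by the bits `D` uses edges of the snake graph only. -/
def Admissible (D : ℕ → Bool) : Prop :=
  ∀ j, j + 1 < G.numTiles →
    (G.corner (j + 1) = G.corner j + (1, 0) → D j = true ∨ D (j + 1) = true) ∧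
    (G.corner (j + 1) = G.corner j + (0, 1) → ¬ (D j = true ∧ D (j + 1) = true))

variable {G} {D D' : ℕ → Bool}

theorem level_leave {j : ℕ} (hj : j ≤ G.numTiles) :
    latticeLevel (G.leave D j) = latticeLevel (G.corner 0) + j := by
  cases j with
  | zero => simp [leave, sw]
  | succ j =>
    have := G.level_corner (j := j) (by omega)
    simp only [leave]
    split_ifs <;> simp [se, nw, latticeLevel_add, this] <;> ring

theorem level_enter {j : ℕ} (h0 : 0 < G.numTiles) (hj : j ≤ G.numTiles) :
    latticeLevel (G.enter D j) = latticeLevel (G.corner 0) + j + 1 := by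
  simp only [enter]
  split_ifs with h1 h2
  · simp [nw, latticeLevel_add, G.level_corner h1]
  · simp [se, latticeLevel_add, G.level_corner h1]
  · obtain rfl : j = G.numTiles := by omega
    have := G.level_corner (j := G.numTiles - 1) (by omega)
    simp only [ne, latticeLevel_add, this, latticeLevel_diag]
    push_cast [Nat.cast_sub (Nat.one_le_iff_ne_zero.mpr h0.ne')]
    ring

theorem mem_matching_iff (h0 : 0 < G.numTiles) {j : ℕ} (hj : j ≤ G.numTiles) {v w : LatticePt}
    (hv : latticeLevel v = latticeLevel (G.corner 0) + j) (hw : latticeLevel w = latticeLevel v + 1) :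
    s(v, w) ∈ G.matching D ↔ v = G.leave D j ∧ w = G.enter D j := by
  simp only [matching, mem_image, mem_range, link]
  constructor
  · rintro ⟨i, hi, h⟩
    have h1 := level_leave (G := G) (D := D) (j := i) (by omega)
    have h2 := level_enter (G := G) (D := D) h0 (j := i) (by omega)
    obtain ⟨rfl, rfl⟩ := (sym2_eq_iff_of_level (by omega) hw).1 h
    obtain rfl : i = j := by omega
    exact ⟨rfl, rfl⟩
  · rintro ⟨rfl, rfl⟩
    exact ⟨j, by omega, rfl⟩

theorem link_mem {j : ℕ} (hj : j ≤ G.numTiles) : G.link D j ∈ G.matching D :=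
  mem_image_of_mem _ (mem_range.2 (by omega))

/-- Comparing levels leaves only `i = j` and `i = j + 1`. In the second case `leave (j + 1)` and
`enter j` are the two different ends of the diagonal of the tile `j`. -/
theorem leave_mem_link {i j : ℕ} (h0 : 0 < G.numTiles) (hi : i ≤ G.numTiles)
    (hj : j ≤ G.numTiles) : G.leave D i ∈ G.link D j ↔ i = j := by
  have h1 := level_leave (G := G) (D := D) hi
  have h2 := level_leave (G := G) (D := D) hj
  have h3 := level_enter (G := G) (D := D) h0 hj
  simp only [link, Sym2.mem_iff]
  constructor
  · rintro (h | h)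
    · rw [h] at h1; omega
    · rw [h] at h1
      obtain rfl : i = j + 1 := by omega
      simp only [leave, enter, if_pos (show j < G.numTiles by omega)] at h
      split_ifs at h <;> simp [se, nw] at h
  · rintro rfl
    exact Or.inl rfl

theorem enter_mem_link {i j : ℕ} (h0 : 0 < G.numTiles) (hi : i ≤ G.numTiles)
    (hj : j ≤ G.numTiles) : G.enter D i ∈ G.link D j ↔ i = j := by
  have h1 := level_enter (G := G) (D := D) h0 hi
  have h2 := level_leave (G := G) (D := D) hj
  have h3 := level_enter (G := G) (D := D) h0 hj
  simp only [link, Sym2.mem_iff]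
  constructor
  · rintro (h | h)
    · rw [h] at h1
      obtain rfl : j = i + 1 := by omega
      simp only [leave, enter, if_pos (show i < G.numTiles by omega)] at h
      split_ifs at h <;> simp [se, nw] at h
    · rw [h] at h1; omega
  · rintro rfl
    exact Or.inr rfl

/-- The ends of the diagonal `j` are `enter j` and `leave (j + 1)`, in an order chosen by the bit.
Every other corner of a tile is an end of a neighbouring diagonal, except the first South-West and
the last North-East vertex, where the walk starts and ends. Hence the links of any bit sequence
partition the vertices, admissible or not. -/
theorem mem_verts_iff (h0 : 0 < G.numTiles) (D : ℕ → Bool) {v : LatticePt} :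
    v ∈ G.graph.verts ↔ ∃ i ≤ G.numTiles, v = G.leave D i ∨ v = G.enter D i := by
  have key : ∀ j < G.numTiles, (G.nw j = G.enter D j ∧ G.se j = G.leave D (j + 1)) ∨
      (G.se j = G.enter D j ∧ G.nw j = G.leave D (j + 1)) := by
    intro j hj
    simp only [enter, leave, if_pos hj]
    split_ifs <;> simp
  have hse : ∀ j < G.numTiles, ∃ i ≤ G.numTiles, G.se j = G.leave D i ∨ G.se j = G.enter D i := by
    intro j hj
    rcases key j hj with h | h
    · exact ⟨j + 1, hj, Or.inl h.2⟩
    · exact ⟨j, hj.le, Or.inr h.1⟩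
  have hnw : ∀ j < G.numTiles, ∃ i ≤ G.numTiles, G.nw j = G.leave D i ∨ G.nw j = G.enter D i := by
    intro j hj
    rcases key j hj with h | h
    · exact ⟨j, hj.le, Or.inr h.1⟩
    · exact ⟨j + 1, hj, Or.inl h.2⟩
  constructor
  · rintro ⟨j, hj, rfl | rfl | rfl | rfl⟩
    · cases j with
      | zero => exact ⟨0, h0.le, Or.inl rfl⟩
      | succ j =>
        rcases G.step j hj with h | h
        · have := hse j (by omega)
          rwa [se, ← h] at this
        · have := hnw j (by omega)
          rwa [nw, ← h] at this
    · exact hse j hj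
    · exact hnw j hj
    · by_cases hj' : j + 1 < G.numTiles
      · rcases G.step j hj' with h | h
        · have := hnw (j + 1) hj'
          rwa [nw, h, add_assoc] at this
        · have := hse (j + 1) hj'
          rwa [se, h, add_assoc] at this
      · refine ⟨j + 1, hj, Or.inr ?_⟩
        rw [enter, if_neg hj', Nat.add_sub_cancel]
  · rintro ⟨i, hi, rfl | rfl⟩
    · cases i with
      | zero => exact ⟨0, h0, Or.inl rfl⟩
      | succ j =>
        refine ⟨j, hi, ?_⟩
        simp only [leave]
        split_ifs <;> simp
    · simp only [enter]
      split_ifs with h1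
      · exact ⟨i, h1, by simp⟩
      · exact ⟨i, h1, by simp⟩
      · exact ⟨i - 1, by omega, by simp⟩

theorem edge_eq (j : ℕ) (s : Dir) : G.edge j s =
    match s with
    | .N => s(G.nw j, G.ne j)
    | .E => s(G.se j, G.ne j)
    | .S => s(G.sw j, G.se j)
    | .W => s(G.sw j, G.nw j) := by
  cases s <;> rfl

/-- Of the four pairs of consecutive bits, three give a side of one of the two tiles. For the pair
forbidden by admissibility, the link would join two vertices that are not neighbours in the lattice.
-/
theorem link_mem_edges (h0 : 0 < G.numTiles) (hD : G.Admissible D) {j : ℕ}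
    (hj : j ≤ G.numTiles) : G.link D j ∈ G.graph.edges := by
  cases j with
  | zero =>
    by_cases h : D 0 = true
    · exact ⟨0, h0, .W, by simp [link, leave, enter, h0, h, edge_eq]⟩
    · exact ⟨0, h0, .S, by simp [link, leave, enter, h0, h, edge_eq]⟩
  | succ j =>
    by_cases hj' : j + 1 < G.numTiles
    · obtain ⟨h1, h2⟩ := hD j hj'
      rcases G.step j hj' with h | h
      · have h3 := h1 h
        by_cases h4 : D j = true <;> by_cases h5 : D (j + 1) = true
        · exact ⟨j, hj, .E, by simp [link, leave, enter, hj', h4, h5, edge, tileSide, nw, se, h,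
            add_assoc]⟩
        · exact ⟨j + 1, hj', .S, by simp [link, leave, enter, hj', h4, h5, edge, tileSide, se, h]⟩
        · exact ⟨j, hj, .N, by simp [link, leave, enter, hj', h4, h5, edge, tileSide, nw, h,
            add_assoc]⟩
        · simp [h4, h5] at h3
      · have h3 := h2 h
        by_cases h4 : D j = true <;> by_cases h5 : D (j + 1) = true
        · simp [h4, h5] at h3
        · exact ⟨j, hj, .E, by simp [link, leave, enter, hj', h4, h5, edge, tileSide, se, h,
            add_assoc]⟩
        · exact ⟨j + 1, hj', .W, by simp [link, leave, enter, hj', h4, h5, edge, tileSide, nw, h]⟩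
        · exact ⟨j, hj, .N, by simp [link, leave, enter, hj', h4, h5, edge, tileSide, nw, se, h,
            add_assoc]⟩
    · by_cases h : D j = true
      · exact ⟨j, hj, .E, by simp [link, leave, enter, hj', h, edge_eq]⟩
      · exact ⟨j, hj, .N, by simp [link, leave, enter, hj', h, edge_eq]⟩

theorem isPerfectMatching_matching (h0 : 0 < G.numTiles) (hD : G.Admissible D) :
    G.graph.IsPerfectMatching (G.matching D) := by
  constructor
  · intro e he
    obtain ⟨j, hj, rfl⟩ := mem_image.1 he
    exact link_mem_edges h0 hD (by simpa [Nat.lt_succ_iff] using hj)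
  · intro v hv
    obtain ⟨i, hi, hv⟩ := (mem_verts_iff h0 D).1 hv
    refine ⟨G.link D i, ⟨link_mem hi, ?_⟩, ?_⟩
    · rcases hv with rfl | rfl
      · exact (leave_mem_link h0 hi hi).2 rfl
      · exact (enter_mem_link h0 hi hi).2 rfl
    · rintro e ⟨he, hve⟩
      obtain ⟨j, hj, rfl⟩ := mem_image.1 he
      have hj' : j ≤ G.numTiles := by simpa [Nat.lt_succ_iff] using hj
      rcases hv with rfl | rfl
      · rw [(leave_mem_link h0 hi hj').1 hve]
      · rw [(enter_mem_link h0 hi hj').1 hve]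

theorem exists_of_mem_edges {e : Sym2 LatticePt} (he : e ∈ G.graph.edges) :
    ∃ v w, e = s(v, w) ∧ v ∈ G.graph.verts ∧ w ∈ G.graph.verts ∧
      (w = v + (1, 0) ∨ w = v + (0, 1)) := by
  obtain ⟨j, hj, s, rfl⟩ := he
  cases s
  · exact ⟨_, _, edge_eq j .N, ⟨j, hj, by simp⟩, ⟨j, hj, by simp⟩, by simp [nw, ne, add_assoc]⟩
  · exact ⟨_, _, edge_eq j .E, ⟨j, hj, by simp⟩, ⟨j, hj, by simp⟩, by simp [se, ne, add_assoc]⟩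
  · exact ⟨_, _, edge_eq j .S, ⟨j, hj, by simp⟩, ⟨j, hj, by simp⟩, by simp [sw, se]⟩
  · exact ⟨_, _, edge_eq j .W, ⟨j, hj, by simp⟩, ⟨j, hj, by simp⟩, by simp [sw, nw]⟩

open Classical in
/-- The vertices at which the walk along the set `P` of edges is after each diagonal. -/
noncomputable def walkVert (G : SnakeGraph L) (P : Finset (Sym2 LatticePt)) : ℕ → LatticePt
  | 0 => G.sw 0
  | j + 1 => if s(walkVert G P j, G.nw j) ∈ P then G.se j else G.nw j

-- The bits are read off from the walk along `P`, and the links are shown to lie in `P` by induction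
-- on their index. Since they already cover every vertex, `P` has no further edge.
open Classical in
theorem exists_eq_matching (h0 : 0 < G.numTiles) {P : Finset (Sym2 LatticePt)}
    (hP : G.graph.IsPerfectMatching P) : ∃ D, G.Admissible D ∧ P = G.matching D := by
  obtain ⟨D, hD⟩ : ∃ D : ℕ → Bool, ∀ j, D j = true ↔ s(G.walkVert P j, G.nw j) ∈ P :=
    ⟨fun j => decide (s(G.walkVert P j, G.nw j) ∈ P), fun j => by simp⟩
  have hw : ∀ j, G.leave D j = G.walkVert P j := by
    intro j
    cases j with
    | zero => rfl
    | succ j => simp only [leave, walkVert, hD]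
  simp only [← hw] at hD
  have uniq : ∀ {v e e'}, v ∈ G.graph.verts → e ∈ P → e' ∈ P → v ∈ e → v ∈ e' → e = e' :=
    fun hv he he' h h' => (hP.2 _ hv).unique ⟨he, h⟩ ⟨he', h'⟩
  have leave_mem : ∀ i ≤ G.numTiles, G.leave D i ∈ G.graph.verts := fun i hi =>
    (mem_verts_iff h0 D).2 ⟨i, hi, Or.inl rfl⟩
  have enter_mem : ∀ i ≤ G.numTiles, G.enter D i ∈ G.graph.verts := fun i hi =>
    (mem_verts_iff h0 D).2 ⟨i, hi, Or.inr rfl⟩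
  have links : ∀ j ≤ G.numTiles, G.link D j ∈ P := by
    intro j
    induction j using Nat.strong_induction_on with
    | _ j ih =>
    intro hj
    obtain ⟨e, ⟨he, hve⟩, -⟩ := hP.2 _ (leave_mem j hj)
    change G.leave D j ∈ e at hve
    obtain ⟨v, w, rfl, hv, hw', hvw⟩ := exists_of_mem_edges (hP.1 e he)
    have hlev : latticeLevel w = latticeLevel v + 1 := by
      rcases hvw with rfl | rfl <;> simp [latticeLevel_add]
    have hl := level_leave (G := G) (D := D) hj
    -- The edge of `P` at `leave j` goes either up or down in level. Upwards it ends at one of the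
    -- ends of the diagonal `j`, and the bit `D j` was defined to say which.
    rcases Sym2.mem_iff.1 hve with h | h
    · subst h
      obtain ⟨i, hi, h1⟩ := (mem_verts_iff h0 D).1 hw'
      have h2 := level_leave (G := G) (D := D) hi
      have h3 := level_enter (G := G) (D := D) h0 hi
      rcases h1 with rfl | rfl
      · obtain rfl : i = j + 1 := by omega
        by_cases hDj : D j = true
        · simpa only [link, enter, if_pos (show j < G.numTiles by omega), if_pos hDj]
            using (hD j).1 hDj
        · exfalso
          simp only [leave, if_neg hDj] at he
          exact hDj ((hD j).2 he)
      · obtain rfl : i = j := by omega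
        exact he
    -- Downwards it would end at a vertex of an earlier link. That link is in `P` by induction, so
    -- it would be the same edge, although it does not contain `leave j`.
    · obtain ⟨i, hi, h1⟩ := (mem_verts_iff h0 D).1 hv
      have h2 := level_leave (G := G) (D := D) hi
      have h3 := level_enter (G := G) (D := D) h0 hi
      have h4 : ∃ i < j, v ∈ G.link D i := by
        rcases h1 with rfl | rfl
        · exact ⟨i, by rw [h] at hl; omega, (leave_mem_link h0 hi hi).2 rfl⟩
        · exact ⟨i, by rw [h] at hl; omega, (enter_mem_link h0 hi hi).2 rfl⟩
      obtain ⟨i', hi', h5⟩ := h4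
      have h6 := uniq hv he (ih i' hi' (by omega)) (Sym2.mem_mk_left _ _) h5
      rw [h6] at hve
      have := (leave_mem_link h0 hj (by omega)).1 hve
      omega
  have hPD : P = G.matching D := by
    ext e
    constructor
    · intro he
      obtain ⟨v, w, rfl, hv, -, -⟩ := exists_of_mem_edges (hP.1 e he)
      obtain ⟨i, hi, h1⟩ := (mem_verts_iff h0 D).1 hv
      have h2 : v ∈ G.link D i := by
        rcases h1 with rfl | rfl
        · exact (leave_mem_link h0 hi hi).2 rfl
        · exact (enter_mem_link h0 hi hi).2 rfl
      rw [uniq hv he (links i hi) (Sym2.mem_mk_left _ _) h2]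
      exact link_mem hi
    · intro he
      obtain ⟨j, hj, rfl⟩ := mem_image.1 he
      exact links j (by simpa [Nat.lt_succ_iff] using hj)
  refine ⟨D, fun j hj => ?_, hPD⟩
  -- The link `j + 1` is an edge of the graph, hence a unit step East or North. This excludes the
  -- forbidden pair of bits.
  obtain ⟨v, w, h1, -, -, h2⟩ := exists_of_mem_edges (hP.1 _ (links (j + 1) hj.le))
  have hlev : latticeLevel w = latticeLevel v + 1 := by
    rcases h2 with rfl | rfl <;> simp [latticeLevel_add]
  have hl := level_leave (G := G) (D := D) hj.le
  have hl' := level_enter (G := G) (D := D) h0 hj.le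
  obtain ⟨h3, h4⟩ := (sym2_eq_iff_of_level (by omega) hlev).1 h1
  rw [← h3, ← h4] at h2
  simp only [leave, enter, if_pos hj] at h2
  constructor
  · intro hc
    rw [nw, se, nw, se, hc] at h2
    by_contra hcon
    simp only [not_or, Bool.not_eq_true] at hcon
    simp only [hcon.1, hcon.2, Prod.ext_iff] at h2
    simp at h2
    omega
  · intro hc hcon
    rw [nw, se, nw, se, hc] at h2
    simp only [hcon.1, hcon.2, Prod.ext_iff] at h2
    simp at h2
    omega

/-! ### The walk along a matching, and its monomials -/

theorem walk_matching_iff (h0 : 0 < G.numTiles) {j : ℕ} (hj : j ≤ G.numTiles) {v : LatticePt} :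
    G.Walk (G.matching D) j v ↔ v = G.leave D j := by
  constructor
  · intro h
    induction h with
    | start => rfl
    | @down j v _ h ih =>
      have hv := ih (by omega)
      subst hv
      have h1 := level_leave (G := G) (D := D) (show j ≤ G.numTiles by omega)
      have h2 := G.level_corner (j := j) (by omega)
      -- Only the link `j` of the matching starts at this level, so the walk has no choice.
      have h3 := ((mem_matching_iff h0 (by omega) h1
        (by simp only [nw, latticeLevel_add, latticeLevel_north]; omega)).1 h).2
      rw [enter, if_pos (by omega)] at h3
      by_cases hD : D j = true
      · simp [leave, hD]
      · simp [hD, nw, se] at h3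
    | @up j v _ h ih =>
      have hv := ih (by omega)
      subst hv
      have h1 := level_leave (G := G) (D := D) (show j ≤ G.numTiles by omega)
      have h2 := G.level_corner (j := j) (by omega)
      have h3 := ((mem_matching_iff h0 (by omega) h1
        (by simp only [se, latticeLevel_add, latticeLevel_east]; omega)).1 h).2
      rw [enter, if_pos (by omega)] at h3
      by_cases hD : D j = true
      · simp [hD, nw, se] at h3
      · simp [leave, hD]
  · rintro rfl
    induction j with
    | zero => exact Walk.start
    | succ j ih =>
      have h1 := ih (by omega)
      have h2 := link_mem (D := D) (show j ≤ G.numTiles by omega)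
      simp only [link, enter, if_pos (show j < G.numTiles by omega)] at h2
      by_cases hD : D j = true
      · simp only [leave, if_pos hD] at h2 ⊢
        exact Walk.down h1 h2
      · simp only [leave, if_neg hD] at h2 ⊢
        exact Walk.up h1 h2

theorem isDown_matching_iff (h0 : 0 < G.numTiles) {j : ℕ} (hj : j < G.numTiles) :
    G.IsDown (G.matching D) j ↔ D j = true := by
  have h1 := level_leave (G := G) (D := D) hj.le
  have h2 := G.level_corner hj
  simp only [IsDown, walk_matching_iff h0 hj.le, exists_eq_left]
  rw [mem_matching_iff h0 hj.le h1 (by simp only [nw, latticeLevel_add, latticeLevel_north]; omega),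
    enter, if_pos hj]
  by_cases hD : D j = true <;> simp [hD, nw, se]

theorem isUp_matching_iff (h0 : 0 < G.numTiles) {j : ℕ} (hj : j < G.numTiles) :
    G.IsUp (G.matching D) j ↔ D j = false := by
  have h1 := level_leave (G := G) (D := D) hj.le
  have h2 := G.level_corner hj
  simp only [IsUp, walk_matching_iff h0 hj.le, exists_eq_left]
  rw [mem_matching_iff h0 hj.le h1 (by simp only [se, latticeLevel_add, latticeLevel_east]; omega),
    enter, if_pos hj]
  by_cases hD : D j = true <;> simp [hD, nw, se]

/-- Bits are functions on `ℕ`, but `enter` no longer consults them from the index `numTiles` on. -/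
theorem matching_congr (h : ∀ j < G.numTiles, D j = D' j) : G.matching D = G.matching D' := by
  refine image_congr fun j hj => ?_
  have hj : j ≤ G.numTiles := by simpa [Nat.lt_succ_iff] using hj
  have h1 : G.leave D j = G.leave D' j := by
    cases j with
    | zero => rfl
    | succ j => simp only [leave, h j hj]
  have h2 : G.enter D j = G.enter D' j := by
    simp only [enter]
    split_ifs with h3 <;> simp_all
  rw [link, link, h1, h2]

theorem eq_of_matching_eq (h0 : 0 < G.numTiles) (h : G.matching D = G.matching D') :
    ∀ j < G.numTiles, D j = D' j := fun j hj => by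
  have h1 := isDown_matching_iff (D := D) h0 hj
  rw [h, isDown_matching_iff h0 hj] at h1
  exact (Bool.eq_iff_iff.2 h1).symm

theorem positiveProd_matching [CommMonoid K] (h0 : 0 < G.numTiles) (w : L → K) :
    G.positiveProd w (G.matching D) =
      ∏ j ∈ range G.numTiles, if (D j = true ↔ G.rel j = 1) then w (G.diag j) else 1 := by
  classical
  rw [positiveProd, prod_filter]
  refine prod_congr rfl fun j hj => ?_
  have hj := mem_range.1 hj
  refine if_congr ?_ rfl rfl
  rw [IsPositive, isDown_matching_iff h0 hj, isUp_matching_iff h0 hj]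
  rcases Int.units_eq_one_or (G.rel j) with h | h <;> cases D j <;> simp [h]

/-- The edge glued between the tiles `j` and `j + 1`, as a side of the tile `j`. -/
def glueSide (G : SnakeGraph L) (j : ℕ) : Dir :=
  if G.corner (j + 1) = G.corner j + (1, 0) then .E else .N

/-- Distribute the two opposite sides chosen in every tile over the links. At the joint of the tiles
`j` and `j + 1` there meet the chosen North or East side of the first and the chosen South or West
side of the second. These are the link `j + 1` and the glued edge, in some order, or the glued edge
twice if it is itself the link. The correction factor therefore does not depend on the matching. -/
theorem weightProd_matching [CommMonoid K] (h0 : 0 < G.numTiles) (hD : G.Admissible D)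
    (w : L → K) :
    G.weightProd w (G.matching D) * ∏ j ∈ range (G.numTiles - 1), w (G.label j (G.glueSide j)) =
      ∏ j ∈ range G.numTiles,
        if D j = true then w (G.label j .W) * w (G.label j .E)
        else w (G.label j .S) * w (G.label j .N) := by
  have inj : Set.InjOn (G.link D) (range (G.numTiles + 1)) := by
    intro i hi j hj hij
    have hi : i ≤ G.numTiles := by simpa [Nat.lt_succ_iff] using hi
    have hj : j ≤ G.numTiles := by simpa [Nat.lt_succ_iff] using hj
    exact (leave_mem_link h0 hi hj).1 (hij ▸ (leave_mem_link h0 hi hi).2 rfl)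
  rw [weightProd, matching, prod_image inj]
  obtain ⟨n, hn⟩ : ∃ n, G.numTiles = n + 1 := ⟨G.numTiles - 1, by omega⟩
  -- The contribution of one joint; the first and the last link are treated separately, since no
  -- edge is glued there.
  have mid : ∀ j < n, G.edgeWeight w (G.link D (j + 1)) * w (G.label j (G.glueSide j)) =
      (if D j = true then w (G.label j .E) else w (G.label j .N)) *
      (if D (j + 1) = true then w (G.label (j + 1) .W) else w (G.label (j + 1) .S)) := by
    intro j hj
    have hj' : j + 1 < G.numTiles := by omega
    obtain ⟨h1, h2⟩ := hD j hj'
    by_cases h : G.corner (j + 1) = G.corner j + (1, 0)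
    · have h3 := h1 h
      have hl : G.label j .E = G.label (j + 1) .W :=
        G.label_eq _ _ _ _ (by omega) hj' (by simp [tileSide, h, add_assoc])
      by_cases h4 : D j = true <;> by_cases h5 : D (j + 1) = true
      · have : G.link D (j + 1) = G.edge j .E := by
          simp [link, leave, enter, hj', h4, h5, edge, tileSide, nw, se, h, add_assoc]
        rw [this, G.edgeWeight_edge w (by omega)]
        simp [glueSide, h, h4, h5, hl]
      · have : G.link D (j + 1) = G.edge (j + 1) .S := by
          simp [link, leave, enter, hj', h4, h5, edge, tileSide, se, h]
        rw [this, G.edgeWeight_edge w (by omega)]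
        simp [glueSide, h, h4, h5, mul_comm]
      · have : G.link D (j + 1) = G.edge j .N := by
          simp [link, leave, enter, hj', h4, h5, edge, tileSide, nw, h, add_assoc]
        rw [this, G.edgeWeight_edge w (by omega)]
        simp [glueSide, h, h4, h5, hl]
      · simp [h4, h5] at h3
    · have h' := (G.step j hj').resolve_left h
      have h3 := h2 h'
      have hl : G.label j .N = G.label (j + 1) .S :=
        G.label_eq _ _ _ _ (by omega) hj' (by simp [tileSide, h', add_assoc])
      by_cases h4 : D j = true <;> by_cases h5 : D (j + 1) = true
      · simp [h4, h5] at h3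
      · have : G.link D (j + 1) = G.edge j .E := by
          simp [link, leave, enter, hj', h4, h5, edge, tileSide, se, h', add_assoc]
        rw [this, G.edgeWeight_edge w (by omega)]
        simp [glueSide, h, h4, h5, hl]
      · have : G.link D (j + 1) = G.edge (j + 1) .W := by
          simp [link, leave, enter, hj', h4, h5, edge, tileSide, nw, h']
        rw [this, G.edgeWeight_edge w (by omega)]
        simp [glueSide, h, h4, h5, mul_comm]
      · have : G.link D (j + 1) = G.edge j .N := by
          simp [link, leave, enter, hj', h4, h5, edge, tileSide, nw, se, h', add_assoc]
        rw [this, G.edgeWeight_edge w (by omega)]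
        simp [glueSide, h, h4, h5, hl]
  have first : G.edgeWeight w (G.link D 0) =
      if D 0 = true then w (G.label 0 .W) else w (G.label 0 .S) := by
    split_ifs with h
    · rw [← G.edgeWeight_edge w h0]
      simp [link, leave, enter, h0, h, edge_eq]
    · rw [← G.edgeWeight_edge w h0]
      simp [link, leave, enter, h0, h, edge_eq]
  have final : G.edgeWeight w (G.link D (n + 1)) =
      if D n = true then w (G.label n .E) else w (G.label n .N) := by
    have hn' : n < G.numTiles := by omega
    split_ifs with h
    · rw [← G.edgeWeight_edge w hn']
      simp [link, leave, enter, hn, h, edge_eq]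
    · rw [← G.edgeWeight_edge w hn']
      simp [link, leave, enter, hn, h, edge_eq]
  have split : ∀ j, (if D j = true then w (G.label j .W) * w (G.label j .E)
        else w (G.label j .S) * w (G.label j .N)) =
      (if D j = true then w (G.label j .E) else w (G.label j .N)) *
      (if D j = true then w (G.label j .W) else w (G.label j .S)) := by
    intro j
    split_ifs <;> rw [mul_comm]
  simp only [split]
  have mids := prod_congr (rfl : range n = range n) fun j hj => mid j (mem_range.1 hj)
  rw [prod_mul_distrib, prod_mul_distrib] at mids
  rw [hn, Nat.add_sub_cancel, prod_range_succ, prod_range_succ', first, final, prod_mul_distrib,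
    prod_range_succ, prod_range_succ' (fun j => if D j = true then w (G.label j .W)
      else w (G.label j .S))]
  rw [mul_right_comm _ _ (∏ j ∈ range n, w (G.label j (G.glueSide j))),
    mul_right_comm _ _ (∏ j ∈ range n, w (G.label j (G.glueSide j))), mids]
  ac_rfl

/-! ### Which sides of a tile belong to a matching -/

theorem leave_eq_sw_iff {j : ℕ} (hj : j + 1 < G.numTiles) :
    G.leave D (j + 1) = G.sw (j + 1) ↔
      (D j = true ↔ G.corner (j + 1) = G.corner j + (1, 0)) := by
  have h0 : G.corner j + (1, 0) ≠ G.corner j + (0, 1) := by simp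
  rw [leave, sw, se, nw]
  rcases G.step j hj with h | h <;> rw [h] <;> cases D j <;> simp

theorem enter_eq_ne_iff {j : ℕ} (hj : j + 1 < G.numTiles) :
    G.enter D (j + 1) = G.ne j ↔
      (D (j + 1) = true ↔ G.corner (j + 1) = G.corner j + (1, 0)) := by
  simp only [enter, ne, se, nw, if_pos hj]
  rcases G.step j hj with h | h <;> rw [h] <;> cases D (j + 1) <;> simp [add_assoc]

/-- A West or South side starts at the South-West vertex of its tile. It can only be the link `j`,
so the walk must leave from that vertex and the bit decides between the two sides. -/
theorem back_mem_matching_iff {j : ℕ} (hj : j < G.numTiles) :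
    (G.edge j .W ∈ G.matching D ↔ D j = true ∧ G.leave D j = G.sw j) ∧
    (G.edge j .S ∈ G.matching D ↔ D j = false ∧ G.leave D j = G.sw j) := by
  have h := G.level_corner hj
  simp only [edge_eq]
  constructor
  · rw [mem_matching_iff (by omega) hj.le (by simpa [sw] using h)
      (by simp [nw, sw, latticeLevel_add]), enter, if_pos hj, and_comm, eq_comm (a := G.sw j)]
    refine and_congr_left fun _ => ?_
    cases D j <;> simp [nw, se]
  · rw [mem_matching_iff (by omega) hj.le (by simpa [sw] using h)
      (by simp [se, sw, latticeLevel_add]), enter, if_pos hj, and_comm, eq_comm (a := G.sw j)]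
    refine and_congr_left fun _ => ?_
    cases D j <;> simp [nw, se]

theorem front_mem_matching_iff {j : ℕ} (hj : j < G.numTiles) :
    (G.edge j .E ∈ G.matching D ↔ D j = true ∧ G.enter D (j + 1) = G.ne j) ∧
    (G.edge j .N ∈ G.matching D ↔ D j = false ∧ G.enter D (j + 1) = G.ne j) := by
  have h := G.level_corner hj
  have h0 : 0 < G.numTiles := by omega
  simp only [edge_eq]
  constructor
  · rw [mem_matching_iff (j := j + 1) h0 hj (by simp [se, latticeLevel_add, h, add_assoc])
      (by simp [ne, se, latticeLevel_add, add_assoc]), eq_comm (a := G.ne j), leave]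
    refine and_congr_left fun _ => ?_
    cases D j <;> simp [nw, se]
  · rw [mem_matching_iff (j := j + 1) h0 hj (by simp [nw, latticeLevel_add, h, add_assoc])
      (by simp [ne, nw, latticeLevel_add, add_assoc]), eq_comm (a := G.ne j), leave]
    refine and_congr_left fun _ => ?_
    cases D j <;> simp [nw, se]

/-! ### Restriction to consecutive tiles -/

section Sub

variable {a n : ℕ} {h : a + n ≤ G.numTiles}

@[simp] theorem sub_numTiles : (G.sub a n h).numTiles = n := rfl

theorem mem_restrict {P : Finset (Sym2 LatticePt)} {H : SnakeGraph L} {e : Sym2 LatticePt} :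
    e ∈ restrict P H ↔ e ∈ P ∧ e ∈ H.graph.edges := by
  classical exact mem_filter

theorem Admissible.sub (hD : G.Admissible D) :
    (G.sub a n h).Admissible fun j => D (a + j) := fun j hj => by
  have hj : j + 1 < n := hj
  exact hD (a + j) (by omega)

/-- Inside the subgraph the links depend only on the bits of its tiles. Its own walk starts at its
South-West and ends at its North-East vertex, and the two hypotheses say that the large walk passes
there. Levels show that no link outside the range from `a` to `a + n` is an edge of the subgraph. -/
theorem restrict_matching_eq (hn : 0 < n) (hD : G.Admissible D)
    (h1 : G.leave D a = G.sw a) (h2 : G.enter D (a + n) = G.ne (a + n - 1)) :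
    restrict (G.matching D) (G.sub a n h) = (G.sub a n h).matching fun j => D (a + j) := by
  have hl : ∀ j ≤ n, (G.sub a n h).link (fun j => D (a + j)) j = G.link D (a + j) := by
    intro j hj
    have e1 : (G.sub a n h).leave (fun j => D (a + j)) j = G.leave D (a + j) := by
      cases j with
      | zero => exact h1.symm
      | succ j => rfl
    have e2 : (G.sub a n h).enter (fun j => D (a + j)) j = G.enter D (a + j) := by
      by_cases hj' : j < n
      · rw [enter, sub_numTiles, if_pos hj', enter, if_pos (show a + j < G.numTiles by omega)]
        rfl
      · obtain rfl : j = n := by omega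
        rw [h2, enter, sub_numTiles, if_neg hj']
        change G.ne (a + (j - 1)) = _
        rw [show a + (j - 1) = a + j - 1 by omega]
    rw [link, link, e1, e2]
  ext e
  rw [mem_restrict]
  constructor
  · rintro ⟨he, he'⟩
    obtain ⟨j, hj, rfl⟩ := mem_image.1 he
    have hj : j ≤ G.numTiles := by simpa [Nat.lt_succ_iff] using hj
    have l1 := level_leave (G := G) (D := D) hj
    obtain ⟨v, w, hvw, hv, hw, hstep⟩ := exists_of_mem_edges he'
    have hs : latticeLevel w = latticeLevel v + 1 := by
      rcases hstep with rfl | rfl <;> simp [latticeLevel_add]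
    have l2 := level_enter (G := G) (D := D) (by omega) hj
    have l3 := ((sym2_eq_iff_of_level (by omega) hs).1 hvw).1
    obtain ⟨i, hi, hv⟩ := (mem_verts_iff (G := G.sub a n h) hn fun j => D (a + j)).1 hv
    obtain ⟨i', hi', hw⟩ := (mem_verts_iff (G := G.sub a n h) hn fun j => D (a + j)).1 hw
    have l4 := level_leave (G := G.sub a n h) (D := fun j => D (a + j)) hi
    have l5 := level_enter (G := G.sub a n h) (D := fun j => D (a + j)) hn hi
    have l6 := level_leave (G := G.sub a n h) (D := fun j => D (a + j)) hi'
    have l7 := level_enter (G := G.sub a n h) (D := fun j => D (a + j)) hn hi'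
    have l8 : latticeLevel ((G.sub a n h).corner 0) = latticeLevel (G.corner 0) + a :=
      G.level_corner (by omega)
    have hi : i ≤ n := hi
    have hi' : i' ≤ n := hi'
    have : a ≤ j ∧ j ≤ a + n := by
      rw [l3] at l1
      rcases hv with rfl | rfl <;> rcases hw with rfl | rfl <;> omega
    rw [show j = a + (j - a) by omega, ← hl (j - a) (by omega)]
    exact link_mem (G := G.sub a n h) (show j - a ≤ n by omega)
  · intro he
    obtain ⟨j, hj, rfl⟩ := mem_image.1 he
    have hj : j ≤ n := by simpa [Nat.lt_succ_iff, SnakeGraph.sub] using hj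
    refine ⟨?_, link_mem_edges (G := G.sub a n h) hn hD.sub hj⟩
    rw [hl j hj]
    exact link_mem (by omega)

/-- The extreme vertices of the subgraph must be covered by edges of the subgraph. By their levels,
these can only be the links `a` and `a + n`. -/
theorem isPerfectMatching_restrict_iff (hn : 0 < n) (hD : G.Admissible D) :
    (G.sub a n h).graph.IsPerfectMatching (restrict (G.matching D) (G.sub a n h)) ↔
      G.leave D a = G.sw a ∧ G.enter D (a + n) = G.ne (a + n - 1) := by
  constructor
  · intro hP
    -- The edges of the subgraph occupy the levels from `a` to `a + n`; in particular none of them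
    -- ends at the South-West vertex of its first tile from below.
    have lev : ∀ {v w}, s(v, w) ∈ (G.sub a n h).graph.edges →
        latticeLevel w = latticeLevel v + 1 →
        latticeLevel (G.corner 0) + a ≤ latticeLevel v ∧
          latticeLevel v ≤ latticeLevel (G.corner 0) + a + n := by
      intro v w he hvw
      obtain ⟨v', w', e, hv, hw, hstep⟩ := exists_of_mem_edges he
      have hs : latticeLevel w' = latticeLevel v' + 1 := by
        rcases hstep with rfl | rfl <;> simp [latticeLevel_add]
      obtain ⟨rfl, rfl⟩ := (sym2_eq_iff_of_level hvw hs).1 e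
      obtain ⟨i, hi, hv⟩ := (mem_verts_iff (G := G.sub a n h) hn fun j => D (a + j)).1 hv
      obtain ⟨i', hi', hw⟩ := (mem_verts_iff (G := G.sub a n h) hn fun j => D (a + j)).1 hw
      have l4 := level_leave (G := G.sub a n h) (D := fun j => D (a + j)) hi
      have l5 := level_enter (G := G.sub a n h) (D := fun j => D (a + j)) hn hi
      have l6 := level_leave (G := G.sub a n h) (D := fun j => D (a + j)) hi'
      have l7 := level_enter (G := G.sub a n h) (D := fun j => D (a + j)) hn hi'
      have l8 : latticeLevel ((G.sub a n h).corner 0) = latticeLevel (G.corner 0) + a :=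
        G.level_corner (by omega)
      have hi : i ≤ n := hi
      have hi' : i' ≤ n := hi'
      rcases hv with rfl | rfl <;> rcases hw with rfl | rfl <;> omega
    have cover : ∀ {v}, v ∈ (G.sub a n h).graph.verts → ∃ j ≤ G.numTiles,
        G.link D j ∈ (G.sub a n h).graph.edges ∧ v ∈ G.link D j := by
      intro v hv
      obtain ⟨e, ⟨he, hve⟩, -⟩ := hP.2 v hv
      obtain ⟨he, he'⟩ := mem_restrict.1 he
      obtain ⟨j, hj, rfl⟩ := mem_image.1 he
      exact ⟨j, by simpa [Nat.lt_succ_iff] using hj, he', hve⟩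
    constructor
    · obtain ⟨j, hj, he, hv⟩ := cover (v := G.sw a) ⟨0, hn, Or.inl rfl⟩
      have l1 := level_leave (G := G) (D := D) hj
      have l2 := level_enter (G := G) (D := D) (by omega) hj
      have l3 := lev he (by omega)
      have l4 := G.level_corner (j := a) (by omega)
      rcases Sym2.mem_iff.1 hv with h1 | h1
      · obtain rfl : j = a := by rw [sw] at h1; rw [← h1] at l1; omega
        exact h1.symm
      · rw [sw] at h1; rw [← h1] at l2; omega
    · obtain ⟨j, hj, he, hv⟩ := cover (v := G.ne (a + n - 1)) ⟨n - 1, by change n - 1 < n; omega, by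
        rw [show a + n - 1 = a + (n - 1) by omega]; exact Or.inr (Or.inr (Or.inr rfl))⟩
      have l1 := level_leave (G := G) (D := D) hj
      have l2 := level_enter (G := G) (D := D) (by omega) hj
      have l3 := lev he (by omega)
      have l4 : latticeLevel (G.ne (a + n - 1)) = latticeLevel (G.corner 0) + a + n + 1 := by
        rw [ne, latticeLevel_add, G.level_corner (j := a + n - 1) (by omega), latticeLevel_diag]
        omega
      rcases Sym2.mem_iff.1 hv with h1 | h1
      · rw [h1] at l4; omega
      · obtain rfl : j = a + n := by rw [h1] at l4; omega
        exact h1.symm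
  · rintro ⟨h1, h2⟩
    rw [restrict_matching_eq hn hD h1 h2]
    exact isPerfectMatching_matching (G := G.sub a n h) hn hD.sub

end Sub

end SnakeGraph

/-! ### Signs of diagonals, independently of the embedding -/

namespace Slot

/-- The condition on the sign of a diagonal (`true` for positive) under which the walk uses the
corner of the tile next to the given side. -/
def Cond : Slot → Bool → Prop
  | backLeft, x => x = true
  | backRight, x => x = false
  | frontLeft, x => x = false
  | frontRight, x => x = true

/-- Reversing the curve exchanges opposite sides of the quadrilateral, and opposite sides are used
for the same sign. -/
theorem cond_opp (σ : Slot) (x : Bool) : σ.opp.Cond x ↔ σ.Cond x := by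
  cases σ <;> simp [opp, Cond]

@[simp] theorem opp_opp (σ : Slot) : σ.opp.opp = σ := by
  cases σ <;> rfl

end Slot

namespace IdealTriangulation

variable {Tri : Type*} {T : IdealTriangulation Tri}

/-- The signs `x`, `y` of two consecutive diagonals are compatible, if the triangle between them is
entered by the side `e` and left by the side `f`. -/
def Compat (e f : TriSide Tri) (x y : Bool) : Prop :=
  if f.2 = e.2 + 1 then x = true → y = true else y = true → x = true

/-- The third side of a triangle, which is entered by the side `e` and left by the side `f`. -/
def thirdSide (e f : TriSide Tri) : TriSide Tri :=
  if f.2 = e.2 + 1 then (e.1, e.2 + 2) else (e.1, e.2 + 1)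

/-- If the side `σ` of a tile is glued to the next tile, then it is not left unmatched by the sign
`y` of the next tile. -/
def FrontOK (e f : TriSide Tri) (y : Bool) : Slot → Prop
  | .frontLeft => f.2 = e.2 + 1 → y = true
  | .frontRight => f.2 ≠ e.2 + 1 → y = false
  | _ => True

/-- If the side `σ` of a tile is glued to the preceding tile, then it is not left unmatched by the
sign `x` of the preceding tile. -/
def BackOK (e f : TriSide Tri) (x : Bool) : Slot → Prop
  | .backLeft => f.2 = e.2 + 1 → x = false
  | .backRight => f.2 ≠ e.2 + 1 → x = true
  | _ => True

theorem zmod_three_cases {e f : TriSide Tri} (h : f.1 = e.1 ∧ f ≠ e) :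
    f = (e.1, e.2 + 1) ∨ f = (e.1, e.2 + 2) := by
  have h1 : f.2 ≠ e.2 := fun h' => h.2 (Prod.ext h.1 h')
  have h2 : ∀ x y : ZMod 3, x ≠ y → x = y + 1 ∨ x = y + 2 := by decide
  rcases h2 _ _ h1 with h3 | h3
  · exact Or.inl (Prod.ext h.1 h3)
  · exact Or.inr (Prod.ext h.1 h3)

theorem zmod_three_swap {e f : TriSide Tri} (h : f.1 = e.1 ∧ f ≠ e) :
    e.2 = f.2 + 1 ↔ ¬ f.2 = e.2 + 1 := by
  have h1 : f.2 ≠ e.2 := fun h' => h.2 (Prod.ext h.1 h')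
  exact (by decide : ∀ x y : ZMod 3, x ≠ y → (y = x + 1 ↔ ¬ x = y + 1)) _ _ h1

/-- Reversal exchanges the two signs and also the direction in which the curve turns inside the
triangle. The two changes cancel. -/
theorem compat_swap {e f : TriSide Tri} (h : f.1 = e.1 ∧ f ≠ e) (x y : Bool) :
    Compat f e y x ↔ Compat e f x y := by
  simp only [Compat, zmod_three_swap h]
  split_ifs <;> tauto

theorem thirdSide_swap {e f : TriSide Tri} (h : f.1 = e.1 ∧ f ≠ e) :
    thirdSide f e = thirdSide e f := by
  have h11 : (1 + 1 : ZMod 3) = 2 := by decide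
  simp only [thirdSide, zmod_three_swap h]
  rcases zmod_three_cases h with rfl | rfl
  · simp [add_assoc, h11]
  · have h21 : (2 : ZMod 3) ≠ 1 := by decide
    have h22 : (2 + 2 : ZMod 3) = 1 := by decide
    simp [add_assoc, h21, h22]

theorem frontOK_swap {e f : TriSide Tri} (h : f.1 = e.1 ∧ f ≠ e) (y : Bool) (σ : Slot) :
    FrontOK e f y σ ↔ BackOK f e y σ.opp := by
  have := zmod_three_swap h
  cases σ <;> simp [FrontOK, BackOK, Slot.opp, this]

theorem backOK_swap {e f : TriSide Tri} (h : f.1 = e.1 ∧ f ≠ e) (x : Bool) (σ : Slot) :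
    BackOK e f x σ ↔ FrontOK f e x σ.opp := by
  have := zmod_three_swap h
  cases σ <;> simp [FrontOK, BackOK, Slot.opp, this]

/-! ### Perfect matchings of the snake graph of a curve as sign sequences -/

namespace Curve

/-- The signs `b` (`true` for positive) are those of the diagonals of a perfect matching. -/
def Valid (γ : T.Curve) (b : ℕ → Bool) : Prop :=
  ∀ j, j + 1 < γ.len → Compat (T.glue (γ.cross j)) (γ.cross (j + 1)) (b j) (b (j + 1))

/-- The side `σ` of the tile `j` belongs to the perfect matching with the signs `b`. -/
def MemBits (γ : T.Curve) (b : ℕ → Bool) (j : ℕ) (σ : Slot) : Prop :=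
  σ.Cond (b j) ∧
    (j + 1 < γ.len → FrontOK (T.glue (γ.cross j)) (γ.cross (j + 1)) (b (j + 1)) σ) ∧
    ∀ i, i + 1 = j → BackOK (T.glue (γ.cross i)) (γ.cross j) (b i) σ

/-- The directions of the diagonals (`true` for downwards) with the signs `b`. -/
def downBits (ε : ℤˣ) (b : ℕ → Bool) (j : ℕ) : Bool := b j == decide (relOr ε j = 1)

theorem downBits_eq_true {ε : ℤˣ} {b : ℕ → Bool} {j : ℕ} :
    downBits ε b j = true ↔ (b j = true ↔ relOr ε j = 1) := by
  rw [downBits, beq_iff_eq, Bool.eq_iff_iff, decide_eq_true_iff]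

theorem relOr_succ (ε : ℤˣ) (j : ℕ) : relOr ε (j + 1) = -relOr ε j := by
  simp [relOr, pow_succ]

theorem relOr_succ_eq_one (ε : ℤˣ) (j : ℕ) : relOr ε (j + 1) = 1 ↔ ¬ relOr ε j = 1 := by
  rw [relOr_succ]
  rcases Int.units_eq_one_or (relOr ε j) with h | h <;> rw [h] <;> decide

/-- The perfect matching of the snake graph with the given signs of the diagonals. -/
noncomputable def matchingOf (γ : T.Curve) (ε : ℤˣ) (b : ℕ → Bool) : Finset (Sym2 LatticePt) :=
  (γ.snakeGraph ε).matching (downBits ε b)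

theorem east_iff (γ : T.Curve) (ε : ℤˣ) (j : ℕ) :
    γ.tilePos ε (j + 1) = γ.tilePos ε j + (1, 0) ↔
      ((γ.cross (j + 1)).2 = (T.glue (γ.cross j)).2 + 1 ↔ ¬ relOr ε j = 1) := by
  simp only [tilePos, glueSlot]
  by_cases h1 : (γ.cross (j + 1)).2 = (T.glue (γ.cross j)).2 + 1 <;>
    by_cases h2 : relOr ε j = 1 <;> simp [Slot.dir, h1, h2]

theorem north_iff (γ : T.Curve) (ε : ℤˣ) (j : ℕ) :
    γ.tilePos ε (j + 1) = γ.tilePos ε j + (0, 1) ↔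
      ((γ.cross (j + 1)).2 = (T.glue (γ.cross j)).2 + 1 ↔ relOr ε j = 1) := by
  simp only [tilePos, glueSlot]
  by_cases h1 : (γ.cross (j + 1)).2 = (T.glue (γ.cross j)).2 + 1 <;>
    by_cases h2 : relOr ε j = 1 <;> simp [Slot.dir, h1, h2]

/-- The relative orientation alternates, so exactly one of two consecutive signs is negated when
directions are replaced by signs. This turns "at least one down" for a step East and "not both down"
for a step North into implications. The direction of the implication depends only on which way the
curve turns in the triangle. -/
theorem admissible_iff (γ : T.Curve) (ε : ℤˣ) (b : ℕ → Bool) :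
    (γ.snakeGraph ε).Admissible (downBits ε b) ↔ γ.Valid b := by
  refine forall_congr' fun j => imp_congr_right fun hj => ?_
  change (γ.tilePos ε (j + 1) = _ → _) ∧ (γ.tilePos ε (j + 1) = γ.tilePos ε j + _ → _) ↔ _
  change (γ.tilePos ε (j + 1) = γ.tilePos ε j + _ → _) ∧ _ ↔ _
  rw [east_iff, north_iff, downBits_eq_true, downBits_eq_true, relOr_succ_eq_one, Compat]
  by_cases h1 : (γ.cross (j + 1)).2 = (T.glue (γ.cross j)).2 + 1 <;>
    by_cases h2 : relOr ε j = 1 <;> cases b j <;> cases b (j + 1) <;> simp [h1, h2]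

theorem isPerfectMatching_matchingOf {γ : T.Curve} (ε : ℤˣ) {b : ℕ → Bool} (hb : γ.Valid b) :
    (γ.snakeGraph ε).graph.IsPerfectMatching (γ.matchingOf ε b) :=
  SnakeGraph.isPerfectMatching_matching γ.len_pos ((admissible_iff γ ε b).2 hb)

theorem exists_eq_matchingOf {γ : T.Curve} {ε : ℤˣ} {P : Finset (Sym2 LatticePt)}
    (hP : (γ.snakeGraph ε).graph.IsPerfectMatching P) :
    ∃ b, γ.Valid b ∧ P = γ.matchingOf ε b := by
  obtain ⟨D, hD, rfl⟩ := SnakeGraph.exists_eq_matching γ.len_pos hP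
  -- The same map converts signs to directions and directions to signs.
  have h : downBits ε (downBits ε D) = D := by
    funext j
    simp only [downBits]
    cases D j <;> cases decide (relOr ε j = 1) <;> rfl
  rw [← h] at hD
  exact ⟨_, (admissible_iff γ ε _).1 hD, by rw [matchingOf, h]⟩

theorem matchingOf_congr {γ : T.Curve} {ε : ℤˣ} {b b' : ℕ → Bool}
    (h : ∀ j < γ.len, b j = b' j) : γ.matchingOf ε b = γ.matchingOf ε b' :=
  SnakeGraph.matching_congr fun j hj => by rw [downBits, downBits, h j hj]

theorem eq_of_matchingOf_eq {γ : T.Curve} {ε : ℤˣ} {b b' : ℕ → Bool}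
    (h : γ.matchingOf ε b = γ.matchingOf ε b') : ∀ j < γ.len, b j = b' j := fun j hj => by
  have := SnakeGraph.eq_of_matching_eq (G := γ.snakeGraph ε) γ.len_pos h j hj
  simp only [downBits] at this
  revert this
  cases b j <;> cases b' j <;> cases decide (relOr ε j = 1) <;> decide

theorem leave_eq_sw_iff {γ : T.Curve} {ε : ℤˣ} {b : ℕ → Bool} {j : ℕ} (hj : j + 1 < γ.len) :
    (γ.snakeGraph ε).leave (downBits ε b) (j + 1) = (γ.snakeGraph ε).sw (j + 1) ↔
      (b j = true ↔ ¬ (γ.cross (j + 1)).2 = (T.glue (γ.cross j)).2 + 1) := by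
  rw [SnakeGraph.leave_eq_sw_iff (G := γ.snakeGraph ε) hj, downBits_eq_true]
  change (_ ↔ γ.tilePos ε (j + 1) = γ.tilePos ε j + _) ↔ _
  rw [east_iff]
  tauto

theorem enter_eq_ne_iff {γ : T.Curve} {ε : ℤˣ} {b : ℕ → Bool} {j : ℕ} (hj : j + 1 < γ.len) :
    (γ.snakeGraph ε).enter (downBits ε b) (j + 1) = (γ.snakeGraph ε).ne j ↔
      (b (j + 1) = true ↔ (γ.cross (j + 1)).2 = (T.glue (γ.cross j)).2 + 1) := by
  rw [SnakeGraph.enter_eq_ne_iff (G := γ.snakeGraph ε) hj, downBits_eq_true, relOr_succ_eq_one]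
  change (_ ↔ γ.tilePos ε (j + 1) = γ.tilePos ε j + _) ↔ _
  rw [east_iff]
  tauto

/-- A side is in the matching when the sign selects it and the walk passes through the South-West or
North-East vertex of the tile at which it lies. The latter is an equivalence for the neighbouring
sign. Given the sign `b j`, validity forces this equivalence when the side is not glued to the
neighbour; otherwise it reduces to `FrontOK` or `BackOK`. -/
theorem edge_mem_matchingOf_iff {γ : T.Curve} {ε : ℤˣ} {b : ℕ → Bool} (hb : γ.Valid b) {j : ℕ}
    (hj : j < γ.len) (σ : Slot) :
    (γ.snakeGraph ε).edge j (σ.dir (relOr ε j)) ∈ γ.matchingOf ε b ↔ γ.MemBits b j σ := by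
  have hl : (γ.snakeGraph ε).leave (downBits ε b) j = (γ.snakeGraph ε).sw j ↔
      ∀ i, i + 1 = j → (b i = true ↔ ¬ (γ.cross j).2 = (T.glue (γ.cross i)).2 + 1) := by
    cases j with
    | zero => simp [SnakeGraph.leave]
    | succ j =>
      rw [leave_eq_sw_iff hj]
      constructor
      · rintro h i hi
        obtain rfl : i = j := by omega
        exact h
      · exact fun h => h j rfl
  have he : (γ.snakeGraph ε).enter (downBits ε b) (j + 1) = (γ.snakeGraph ε).ne j ↔
      (j + 1 < γ.len →
        (b (j + 1) = true ↔ (γ.cross (j + 1)).2 = (T.glue (γ.cross j)).2 + 1)) := by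
    by_cases h : j + 1 < γ.len
    · rw [enter_eq_ne_iff h]
      simp [h]
    · have h' : ¬ j + 1 < (γ.snakeGraph ε).numTiles := h
      simp [h, SnakeGraph.enter, h']
  have hN := (SnakeGraph.front_mem_matching_iff (G := γ.snakeGraph ε) (D := downBits ε b) hj).2
  have hE := (SnakeGraph.front_mem_matching_iff (G := γ.snakeGraph ε) (D := downBits ε b) hj).1
  have hS := (SnakeGraph.back_mem_matching_iff (G := γ.snakeGraph ε) (D := downBits ε b) hj).2
  have hW := (SnakeGraph.back_mem_matching_iff (G := γ.snakeGraph ε) (D := downBits ε b) hj).1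
  rw [he, downBits_eq_true] at hE
  rw [he, ← Bool.not_eq_true, downBits_eq_true] at hN
  rw [hl, downBits_eq_true] at hW
  rw [hl, ← Bool.not_eq_true, downBits_eq_true] at hS
  have back : ∀ (σ : Slot) (x : Bool), (σ = .backLeft ∧ x = true ∨ σ = .backRight ∧ x = false) →
      ((b j = x ∧ ∀ i, i + 1 = j → (b i = true ↔ ¬ (γ.cross j).2 = (T.glue (γ.cross i)).2 + 1)) ↔
        γ.MemBits b j σ) := by
    intro σ x hσ
    have h1 : (j + 1 < γ.len → FrontOK (T.glue (γ.cross j)) (γ.cross (j + 1)) (b (j + 1)) σ) := by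
      rcases hσ with ⟨rfl, -⟩ | ⟨rfl, -⟩ <;> exact fun _ => trivial
    have h2 : σ.Cond (b j) ↔ b j = x := by
      rcases hσ with ⟨rfl, rfl⟩ | ⟨rfl, rfl⟩ <;> rfl
    rw [MemBits, h2]
    refine and_congr_right fun hx => ?_
    rw [and_iff_right h1]
    refine forall_congr' fun i => imp_congr_right fun hi => ?_
    subst hi
    have h3 := hb i hj
    rw [Compat, hx] at h3
    rcases hσ with ⟨rfl, rfl⟩ | ⟨rfl, rfl⟩ <;> split_ifs at h3 with h4 <;>
      cases hbi : b i <;> simp_all [BackOK]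
  have front : ∀ (σ : Slot) (x : Bool),
      (σ = .frontRight ∧ x = true ∨ σ = .frontLeft ∧ x = false) →
      ((b j = x ∧ (j + 1 < γ.len →
        (b (j + 1) = true ↔ (γ.cross (j + 1)).2 = (T.glue (γ.cross j)).2 + 1))) ↔
        γ.MemBits b j σ) := by
    intro σ x hσ
    have h1 : ∀ i, i + 1 = j → BackOK (T.glue (γ.cross i)) (γ.cross j) (b i) σ := by
      rcases hσ with ⟨rfl, -⟩ | ⟨rfl, -⟩ <;> exact fun _ _ => trivial
    have h2 : σ.Cond (b j) ↔ b j = x := by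
      rcases hσ with ⟨rfl, rfl⟩ | ⟨rfl, rfl⟩ <;> rfl
    rw [MemBits, h2]
    refine and_congr_right fun hx => ?_
    rw [and_iff_left h1]
    refine imp_congr_right fun hi => ?_
    have h3 := hb j hi
    rw [Compat, hx] at h3
    rcases hσ with ⟨rfl, rfl⟩ | ⟨rfl, rfl⟩ <;> split_ifs at h3 with h4 <;>
      cases hbi : b (j + 1) <;> simp_all [FrontOK]
  rw [matchingOf]
  cases σ
  · rw [← back _ true (by simp)]
    by_cases h : relOr ε j = 1
    · rw [Slot.dir, if_pos h, hW]; simp [h]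
    · rw [Slot.dir, if_neg h, hS]; simp [h]
  · rw [← back _ false (by simp)]
    by_cases h : relOr ε j = 1
    · rw [Slot.dir, if_pos h, hS]; simp [h]
    · rw [Slot.dir, if_neg h, hW]; simp [h]
  · rw [← front _ false (by simp)]
    by_cases h : relOr ε j = 1
    · rw [Slot.dir, if_pos h, hN]; simp [h]
    · rw [Slot.dir, if_neg h, hE]; simp [h]
  · rw [← front _ true (by simp)]
    by_cases h : relOr ε j = 1
    · rw [Slot.dir, if_pos h, hE]; simp [h]
    · rw [Slot.dir, if_neg h, hN]; simp [h]

/-! ### Monomials -/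

/-- The product of the weights of the two sides of the quadrilateral around the crossing `h` at the
corners used by a walk with the sign `x`. -/
noncomputable def xFactor (T : IdealTriangulation Tri) (h : TriSide Tri) (x : Bool) :
    T.FunctionField :=
  if x = true then T.xWeight (h.1, h.2 + 1) * T.xWeight ((T.glue h).1, (T.glue h).2 + 1)
  else T.xWeight (h.1, h.2 + 2) * T.xWeight ((T.glue h).1, (T.glue h).2 + 2)

/-- The contribution of a crossing with the sign `x` to the coefficient monomial. -/
noncomputable def yFactor (T : IdealTriangulation Tri) (h : TriSide Tri) (x : Bool) :
    T.FunctionField :=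
  if x = true then T.yWeight h else 1

/-- `H` consists of consecutive tiles of the snake graph of `γ`, beginning with the tile `a`. -/
structure IsSegment (H : SnakeGraph (TriSide Tri)) (γ : T.Curve) (ε : ℤˣ) (a : ℕ) : Prop where
  le : a + H.numTiles ≤ γ.len
  corner : ∀ j, H.corner j = γ.tilePos ε (a + j)
  rel : ∀ j, H.rel j = relOr ε (a + j)
  diag : ∀ j, H.diag j = γ.cross (a + j)
  label : ∀ j s, H.label j s = γ.quadSide (a + j) (Slot.ofDir (relOr ε (a + j)) s)

theorem isSegment_snakeGraph (γ : T.Curve) (ε : ℤˣ) : IsSegment (γ.snakeGraph ε) γ ε 0 := by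
  constructor <;> simp [snakeGraph]

theorem isSegment_sub (γ : T.Curve) (ε : ℤˣ) {a n : ℕ}
    (h : a + n ≤ (γ.snakeGraph ε).numTiles) :
    IsSegment ((γ.snakeGraph ε).sub a n h) γ ε a :=
  ⟨h, fun _ => rfl, fun _ => rfl, fun _ => rfl, fun _ _ => rfl⟩

namespace IsSegment

variable {H : SnakeGraph (TriSide Tri)} {γ : T.Curve} {ε : ℤˣ} {a : ℕ} {b : ℕ → Bool}

theorem yMonomial_eq (hH : IsSegment H γ ε a) (h0 : 0 < H.numTiles) :
    yMonomial H (H.matching fun j => downBits ε b (a + j)) =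
      ∏ j ∈ range H.numTiles, yFactor T (γ.cross (a + j)) (b (a + j)) := by
  rw [yMonomial, SnakeGraph.positiveProd_matching h0]
  refine prod_congr rfl fun j _ => ?_
  simp only [hH.rel, hH.diag, downBits_eq_true, yFactor]
  by_cases h : relOr ε (a + j) = 1 <;> simp [h]

/-- In `weightProd_matching` the edge between consecutive tiles lies on the third side of the
triangle between the crossings. The two sides chosen in a tile depend on its sign only, since
changing the relative orientation exchanges their positions as well as the directions. -/
theorem xMonomial_eq (hH : IsSegment H γ ε a) (h0 : 0 < H.numTiles) (hb : γ.Valid b) :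
    xMonomial H (H.matching fun j => downBits ε b (a + j)) *
        ∏ j ∈ range (H.numTiles - 1),
          T.xWeight (thirdSide (T.glue (γ.cross (a + j))) (γ.cross (a + j + 1))) =
      ∏ j ∈ range H.numTiles, xFactor T (γ.cross (a + j)) (b (a + j)) := by
  have hle := hH.le
  have hD : H.Admissible fun j => downBits ε b (a + j) := by
    intro j hj
    have := (admissible_iff γ ε b).2 hb (a + j) (by change _ < γ.len; omega)
    rwa [hH.corner, hH.corner]
  have hW := SnakeGraph.weightProd_matching h0 hD T.xWeight
  rw [xMonomial]
  refine Eq.trans (congrArg _ (prod_congr rfl fun j _ => ?_))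
    (hW.trans (prod_congr rfl fun j _ => ?_))
  · rw [SnakeGraph.glueSide, hH.corner, hH.corner, hH.label, thirdSide]
    have := east_iff γ ε (a + j)
    rw [add_assoc] at this ⊢
    simp only [this]
    by_cases h1 : (γ.cross (a + (j + 1))).2 = (T.glue (γ.cross (a + j))).2 + 1 <;>
      by_cases h2 : relOr ε (a + j) = 1 <;> simp [h1, h2, Slot.ofDir, quadSide]
  · simp only [hH.label, xFactor, downBits_eq_true]
    by_cases h2 : relOr ε (a + j) = 1 <;> cases b (a + j) <;>
      simp [h2, Slot.ofDir, quadSide]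

end IsSegment

end Curve

end IdealTriangulation

namespace IdealTriangulation

variable {Tri : Type*} {T : IdealTriangulation Tri}

namespace Curve

/-! ### Signs on concatenated and reversed curves -/

theorem append_cross_left {α β : T.Curve} {h} {j : ℕ} (hj : j < α.len) :
    (α.append β h).cross j = α.cross j := if_pos hj

theorem append_cross_right {α β : T.Curve} {h} (j : ℕ) :
    (α.append β h).cross (α.len + j) = β.cross j := by
  simp [append]

theorem valid_congr {γ : T.Curve} {b b' : ℕ → Bool} (h : ∀ j < γ.len, b j = b' j) :
    γ.Valid b ↔ γ.Valid b' :=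
  forall_congr' fun j => imp_congr_right fun hj => by rw [h j (by omega), h (j + 1) hj]

theorem memBits_congr {γ : T.Curve} {b b' : ℕ → Bool} (h : ∀ j < γ.len, b j = b' j) {j : ℕ}
    (hj : j < γ.len) (σ : Slot) : γ.MemBits b j σ ↔ γ.MemBits b' j σ := by
  refine and_congr (by rw [h j hj]) (and_congr (imp_congr_right fun hj' => by rw [h _ hj'])
    (forall_congr' fun i => imp_congr_right fun hi => by rw [h i (by omega)]))

/-- Compatibility relates neighbouring crossings only, so a concatenation adds one condition at the
joint. -/
theorem valid_append {α β : T.Curve} {h} {c b b' : ℕ → Bool} (hb : ∀ j < α.len, c j = b j)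
    (hb' : ∀ j < β.len, c (α.len + j) = b' j) :
    (α.append β h).Valid c ↔
      α.Valid b ∧ Compat α.finish β.start (c (α.len - 1)) (c α.len) ∧ β.Valid b' := by
  have h1 := α.len_pos
  have h2 := β.len_pos
  have hlen : (α.append β h).len = α.len + β.len := rfl
  constructor
  · intro hc
    refine ⟨fun j hj => ?_, ?_, fun j hj => ?_⟩
    · have := hc j (by omega)
      rwa [append_cross_left hj, append_cross_left (by omega), hb _ hj, hb _ (by omega)] at this
    · have := hc (α.len - 1) (by omega)
      rwa [show α.len - 1 + 1 = α.len + 0 by omega, append_cross_right,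
        append_cross_left (by omega)] at this
    · have := hc (α.len + j) (by omega)
      rwa [add_assoc, append_cross_right, append_cross_right, hb' _ hj, hb' _ (by omega)] at this
  · rintro ⟨h3, h4, h5⟩ j hj
    rcases lt_trichotomy (j + 1) α.len with hj' | hj' | hj'
    · rw [append_cross_left hj', append_cross_left (by omega), hb _ hj', hb _ (by omega)]
      exact h3 j hj'
    · obtain rfl : j = α.len - 1 := by omega
      rw [show α.len - 1 + 1 = α.len + 0 by omega, append_cross_right,
        append_cross_left (by omega)]
      exact h4
    · obtain ⟨i, rfl⟩ : ∃ i, j = α.len + i := ⟨j - α.len, by omega⟩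
      rw [add_assoc, append_cross_right, append_cross_right, hb' _ (by omega), hb' _ (by omega)]
      exact h5 i (by omega)

theorem memBits_append_left {α β : T.Curve} {h} {c b : ℕ → Bool} (hb : ∀ j < α.len, c j = b j)
    {j : ℕ} (hj : j < α.len) (σ : Slot) :
    (α.append β h).MemBits c j σ ↔
      α.MemBits b j σ ∧ (j + 1 = α.len → FrontOK α.finish β.start (c α.len) σ) := by
  have h2 := β.len_pos
  have hlen : (α.append β h).len = α.len + β.len := rfl
  simp only [MemBits]
  have hback : (∀ i, i + 1 = j → BackOK (T.glue ((α.append β h).cross i))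
      ((α.append β h).cross j) (c i) σ) ↔
      ∀ i, i + 1 = j → BackOK (T.glue (α.cross i)) (α.cross j) (b i) σ :=
    forall_congr' fun i => imp_congr_right fun hi => by
      rw [append_cross_left (by omega), append_cross_left hj, hb _ (by omega)]
  rw [hback, hb j hj]
  rcases Nat.lt_or_ge (j + 1) α.len with hj' | hj'
  · have h3 : j + 1 < (α.append β h).len := by omega
    have h4 : j + 1 ≠ α.len := by omega
    simp only [hj', h3, h4, true_imp_iff, false_imp_iff, and_true]
    rw [append_cross_left hj, append_cross_left hj', hb _ hj']
  · have h3 : j + 1 < (α.append β h).len := by omega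
    have h4 : j + 1 = α.len := by omega
    have h5 : ¬ j + 1 < α.len := by omega
    have h6 : ((j + 1 < (α.append β h).len → FrontOK (T.glue ((α.append β h).cross j))
        ((α.append β h).cross (j + 1)) (c (j + 1)) σ)) ↔
        FrontOK α.finish β.start (c α.len) σ := by
      rw [imp_iff_right h3, append_cross_left hj, h4, ← Nat.add_zero α.len, append_cross_right,
        finish, ← h4, Nat.add_sub_cancel]
      rfl
    rw [h6]
    tauto

theorem memBits_append_right {α β : T.Curve} {h} {c b : ℕ → Bool}
    (hb : ∀ j < β.len, c (α.len + j) = b j) {j : ℕ} (hj : j < β.len) (σ : Slot) :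
    (α.append β h).MemBits c (α.len + j) σ ↔
      β.MemBits b j σ ∧ (j = 0 → BackOK α.finish β.start (c (α.len - 1)) σ) := by
  have h1 := α.len_pos
  have hlen : (α.append β h).len = α.len + β.len := rfl
  simp only [MemBits]
  have hfront : (α.len + j + 1 < (α.append β h).len →
      FrontOK (T.glue ((α.append β h).cross (α.len + j))) ((α.append β h).cross (α.len + j + 1))
        (c (α.len + j + 1)) σ) ↔
      (j + 1 < β.len → FrontOK (T.glue (β.cross j)) (β.cross (j + 1)) (b (j + 1)) σ) := by
    refine imp_congr_ctx (by omega) fun hj' => ?_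
    rw [add_assoc, append_cross_right, append_cross_right, hb _ hj']
  rw [hfront, hb j hj]
  have hback : (∀ i, i + 1 = α.len + j → BackOK (T.glue ((α.append β h).cross i))
      ((α.append β h).cross (α.len + j)) (c i) σ) ↔
      (∀ i, i + 1 = j → BackOK (T.glue (β.cross i)) (β.cross j) (b i) σ) ∧
        (j = 0 → BackOK α.finish β.start (c (α.len - 1)) σ) := by
    rw [append_cross_right]
    constructor
    · refine fun H => ⟨fun i hi => ?_, ?_⟩
      · have := H (α.len + i) (by omega)
        rwa [append_cross_right, hb _ (by omega)] at this
      · rintro rfl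
        have := H (α.len - 1) (by omega)
        rwa [append_cross_left (by omega)] at this
    · rintro ⟨H1, H2⟩ i hi
      cases j with
      | zero =>
        obtain rfl : i = α.len - 1 := by omega
        rw [append_cross_left (by omega)]
        exact H2 rfl
      | succ j =>
        obtain rfl : i = α.len + j := by omega
        rw [append_cross_right, hb _ (by omega)]
        exact H1 j rfl
  rw [hback]
  tauto

theorem reverse_cross (γ : T.Curve) (j : ℕ) :
    γ.reverse.cross j = T.glue (γ.cross (γ.len - 1 - j)) := rfl

theorem valid_reverse {γ : T.Curve} {b b' : ℕ → Bool}
    (h : ∀ j < γ.len, b' j = b (γ.len - 1 - j)) : γ.reverse.Valid b' ↔ γ.Valid b := by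
  have hlen : γ.reverse.len = γ.len := rfl
  have key : ∀ j, j + 1 < γ.len → (Compat (T.glue (γ.reverse.cross j)) (γ.reverse.cross (j + 1))
      (b' j) (b' (j + 1)) ↔ Compat (T.glue (γ.cross (γ.len - 1 - (j + 1))))
        (γ.cross (γ.len - 1 - (j + 1) + 1)) (b (γ.len - 1 - (j + 1)))
        (b (γ.len - 1 - (j + 1) + 1))) := by
    intro j hj
    rw [reverse_cross, reverse_cross, T.glue_glue, h j (by omega), h _ hj,
      compat_swap, show γ.len - 1 - (j + 1) + 1 = γ.len - 1 - j by omega]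
    have := γ.chain (γ.len - 1 - (j + 1)) (by omega)
    rwa [show γ.len - 1 - (j + 1) + 1 = γ.len - 1 - j by omega] at this
  constructor
  · intro H j hj
    have h1 := (key (γ.len - 1 - (j + 1)) (by omega)).1 (H _ (by omega))
    rwa [show γ.len - 1 - (γ.len - 1 - (j + 1) + 1) = j by omega] at h1
  · exact fun H j hj => (key j hj).2 (H _ (by omega))

theorem memBits_reverse {γ : T.Curve} {b b' : ℕ → Bool}
    (h : ∀ j < γ.len, b' j = b (γ.len - 1 - j)) {j : ℕ} (hj : j < γ.len) (σ : Slot) :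
    γ.reverse.MemBits b' j σ ↔ γ.MemBits b (γ.len - 1 - j) σ.opp := by
  have hlen : γ.reverse.len = γ.len := rfl
  simp only [MemBits, h j hj, Slot.cond_opp]
  refine and_congr_right fun _ => ?_
  rw [and_comm]
  refine and_congr ?_ ?_
  · constructor
    · intro H hj'
      have := H (j - 1) (by omega)
      rw [reverse_cross, reverse_cross, T.glue_glue, h _ (by omega),
        show γ.len - 1 - (j - 1) = γ.len - 1 - j + 1 by omega, backOK_swap] at this
      · exact this
      · have := γ.chain (γ.len - 1 - j) (by omega)
        exact ⟨this.1.symm, this.2.symm⟩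
    · intro H i hi
      subst hi
      have := H (by omega)
      rw [reverse_cross, reverse_cross, T.glue_glue, h _ (by omega), backOK_swap]
      · rwa [show γ.len - 1 - (i + 1) + 1 = γ.len - 1 - i by omega] at this
      · have := γ.chain (γ.len - 1 - (i + 1)) (by omega)
        rw [show γ.len - 1 - (i + 1) + 1 = γ.len - 1 - i by omega] at this
        exact ⟨this.1.symm, this.2.symm⟩
  · constructor
    · intro H i hi
      have := H (by omega)
      have hc := γ.chain i (by omega)
      rw [hi] at hc
      rw [reverse_cross, reverse_cross, T.glue_glue, h _ (by omega),
        show γ.len - 1 - (j + 1) = i by omega, frontOK_swap ⟨hc.1.symm, hc.2.symm⟩] at this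
      exact this
    · intro H hj'
      have := H (γ.len - 1 - (j + 1)) (by omega)
      have hc := γ.chain (γ.len - 1 - (j + 1)) (by omega)
      rw [show γ.len - 1 - (j + 1) + 1 = γ.len - 1 - j by omega] at hc
      rw [reverse_cross, reverse_cross, T.glue_glue, h _ (by omega),
        frontOK_swap ⟨hc.1.symm, hc.2.symm⟩]
      exact this

/-- The signs are determined by the sides in front of which no tile of the curve lies. -/
theorem eq_of_memBits_iff {γ : T.Curve} {b b' : ℕ → Bool}
    (h : ∀ m < γ.len, ∀ σ : Slot, ¬ σ.IsFront → (γ.MemBits b m σ ↔ γ.MemBits b' m σ)) :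
    ∀ m < γ.len, b m = b' m := by
  intro m hm
  -- Of the two back sides, the one which is not glued to the preceding tile belongs to the matching
  -- according to the sign alone. It is `backRight` in the first case and `backLeft` in the second,
  -- which includes the first tile.
  by_cases hs : ∃ i, i + 1 = m ∧ (γ.cross m).2 = (T.glue (γ.cross i)).2 + 1
  · obtain ⟨i, rfl, hi⟩ := hs
    have := h (i + 1) hm .backRight (by simp [Slot.IsFront])
    simp only [MemBits, FrontOK, BackOK, Slot.Cond, Nat.add_right_cancel_iff, forall_eq, hi,
      ne_eq, not_true_eq_false, false_imp_iff, implies_true, and_true] at this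
    revert this
    cases b (i + 1) <;> cases b' (i + 1) <;> simp
  · have e : ∀ x, γ.MemBits x m .backLeft ↔ x m = true := fun x =>
      ⟨fun h => h.1, fun h => ⟨h, fun _ => trivial, fun i hi h' => absurd ⟨i, hi, h'⟩ hs⟩⟩
    have := h m hm .backLeft (by simp [Slot.IsFront])
    rw [e, e] at this
    exact Bool.eq_iff_iff.2 this

/-! ### Products over the crossings -/

section Products

variable {M : Type*} [CommMonoid M]

/-- The product of the contributions of the crossings with signs `b`. -/
def bitProd (γ : T.Curve) (g : TriSide Tri → Bool → M) (b : ℕ → Bool) : M :=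
  ∏ j ∈ range γ.len, g (γ.cross j) (b j)

theorem bitProd_append {α β : T.Curve} {h} (g : TriSide Tri → Bool → M) {c b b' : ℕ → Bool}
    (hb : ∀ j < α.len, c j = b j) (hb' : ∀ j < β.len, c (α.len + j) = b' j) :
    (α.append β h).bitProd g c = α.bitProd g b * β.bitProd g b' := by
  rw [bitProd, show (α.append β h).len = α.len + β.len from rfl, prod_range_add]
  refine congrArg₂ _ (prod_congr rfl fun j hj => ?_) (prod_congr rfl fun j hj => ?_)
  · have hj := mem_range.1 hj
    rw [append_cross_left hj, hb j hj]
  · rw [append_cross_right, hb' j (mem_range.1 hj)]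

/-- The reversed curve crosses the same arcs from their other sides, hence the invariance of `g`
under `glue`. -/
theorem bitProd_reverse {γ : T.Curve} {g : TriSide Tri → Bool → M}
    (hg : ∀ e x, g (T.glue e) x = g e x) {b b' : ℕ → Bool}
    (h : ∀ j < γ.len, b' j = b (γ.len - 1 - j)) : γ.reverse.bitProd g b' = γ.bitProd g b := by
  rw [bitProd, bitProd, ← prod_range_reflect]
  refine prod_congr rfl fun j hj => ?_
  have hj : j < γ.len := mem_range.1 hj
  rw [reverse_cross, hg, h _ (by change γ.len - 1 - j < _; omega)]
  change g (γ.cross (γ.len - 1 - (γ.len - 1 - j))) (b (γ.len - 1 - (γ.len - 1 - j))) = _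
  rw [show γ.len - 1 - (γ.len - 1 - j) = j by omega]

/-- The product of the weights of the third sides of the triangles between the crossings. -/
def thirdProd (γ : T.Curve) (w : TriSide Tri → M) : M :=
  ∏ j ∈ range (γ.len - 1), w (thirdSide (T.glue (γ.cross j)) (γ.cross (j + 1)))

theorem thirdProd_append {α β : T.Curve} {h} (w : TriSide Tri → M) :
    (α.append β h).thirdProd w =
      α.thirdProd w * w (thirdSide α.finish β.start) * β.thirdProd w := by
  have h1 := α.len_pos
  have h2 := β.len_pos
  rw [thirdProd, show (α.append β h).len - 1 = (α.len - 1 + 1) + (β.len - 1) by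
    change α.len + β.len - 1 = _; omega, prod_range_add, prod_range_succ]
  refine congrArg₂ _ (congrArg₂ _ (prod_congr rfl fun j hj => ?_) ?_)
    (prod_congr rfl fun j hj => ?_)
  · have hj := mem_range.1 hj
    rw [append_cross_left (by omega), append_cross_left (by omega)]
  · rw [append_cross_left (by omega), show α.len - 1 + 1 = α.len + 0 by omega, append_cross_right]
    rfl
  · rw [show α.len - 1 + 1 + j = α.len + j by omega, add_assoc, append_cross_right,
      append_cross_right]

theorem thirdProd_reverse (γ : T.Curve) (w : TriSide Tri → M) :
    γ.reverse.thirdProd w = γ.thirdProd w := by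
  rw [thirdProd, thirdProd, ← prod_range_reflect]
  refine prod_congr rfl fun j hj => ?_
  have hj : j < γ.len - 1 := mem_range.1 hj
  have hlen : γ.reverse.len = γ.len := rfl
  have hc := γ.chain j (by omega)
  rw [reverse_cross, reverse_cross, T.glue_glue, hlen,
    show γ.len - 1 - (γ.len - 1 - 1 - j) = j + 1 by omega,
    show γ.len - 1 - (γ.len - 1 - 1 - j + 1) = j by omega, thirdSide_swap hc]

end Products

/-! ### Contributions of a crossing to the monomials -/

theorem xFactor_glue (e : TriSide Tri) (x : Bool) : xFactor T (T.glue e) x = xFactor T e x := by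
  simp only [xFactor, T.glue_glue]
  split_ifs <;> rw [mul_comm]

theorem yVar_glue (e : TriSide Tri) : T.yVar (T.glue e) = T.yVar e := by
  have : T.edgeOf (T.glue e) = T.edgeOf e := Quot.sound (T.glue_glue e)
  rw [yVar, yVar, this]

/-- Only a radius needs an argument. Its two sides lie in one triangle with a single remaining side,
the enclosing loop; passing from one side of the radius to the other exchanges the cases `+ 1` and
`+ 2` but not this remaining side. -/
theorem yWeight_glue (e : TriSide Tri) : T.yWeight (T.glue e) = T.yWeight e := by
  have h12 : (1 + 2 : ZMod 3) = 0 := by decide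
  have h22 : (2 + 2 : ZMod 3) = 1 := by decide
  have h11 : (1 + 1 : ZMod 3) = 2 := by decide
  have h21 : (2 + 1 : ZMod 3) = 0 := by decide
  have n12 : (1 : ZMod 3) ≠ 2 := by decide
  have n1 : (1 : ZMod 3) ≠ 0 := by decide
  have n2 : (2 : ZMod 3) ≠ 0 := by decide
  obtain ⟨t, i⟩ := e
  rw [yWeight, yWeight, yVar_glue, T.glue_glue]
  congr 1
  by_cases h1 : T.glue (t, i) = (t, i + 1)
  · rw [h1]
    simp [add_assoc, h11, h12, n2]
  · by_cases h2 : T.glue (t, i) = (t, i + 2)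
    · rw [h2]
      simp [add_assoc, h21, h22, n12.symm]
    -- If neither case applies to the side itself, then neither applies to its partner: shifts by `+
    -- 1` and `+ 2` are inverse to each other modulo 3.
    · have e1 : (t, i) ≠ ((T.glue (t, i)).1, (T.glue (t, i)).2 + 1) := by
        intro h
        obtain ⟨ha, hb⟩ := Prod.ext_iff.1 h
        refine h2 (Prod.ext ha.symm ?_)
        simp only at hb ⊢
        nth_rewrite 2 [hb]
        rw [add_assoc, h12, add_zero]
      have e2 : (t, i) ≠ ((T.glue (t, i)).1, (T.glue (t, i)).2 + 2) := by
        intro h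
        obtain ⟨ha, hb⟩ := Prod.ext_iff.1 h
        refine h1 (Prod.ext ha.symm ?_)
        simp only at hb ⊢
        nth_rewrite 2 [hb]
        rw [add_assoc, h21, add_zero]
      rw [if_neg e1, if_neg e2, if_neg h1, if_neg h2]

theorem yFactor_glue (e : TriSide Tri) (x : Bool) : yFactor T (T.glue e) x = yFactor T e x := by
  simp only [yFactor, yWeight_glue]

theorem xVar_ne_zero (e : TriSide Tri) : T.xVar e ≠ 0 := by
  rw [xVar, Ne, FaithfulSMul.algebraMap_eq_zero_iff]
  exact MvPolynomial.X_ne_zero _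

theorem yVar_ne_zero (e : TriSide Tri) : T.yVar e ≠ 0 := by
  rw [yVar, Ne, FaithfulSMul.algebraMap_eq_zero_iff]
  exact MvPolynomial.X_ne_zero _

theorem xWeight_ne_zero (e : TriSide Tri) : T.xWeight e ≠ 0 := by
  have h : ∀ e, T.radiusVar e ≠ 0 := by
    intro e
    rw [radiusVar]
    split_ifs
    · exact xVar_ne_zero _
    · exact one_ne_zero
  rw [xWeight]
  split_ifs
  · exact one_ne_zero
  · exact mul_ne_zero (mul_ne_zero (xVar_ne_zero _) (h _)) (h _)

theorem xFactor_ne_zero (e : TriSide Tri) (x : Bool) : xFactor T e x ≠ 0 := by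
  rw [xFactor]
  split_ifs <;> exact mul_ne_zero (xWeight_ne_zero _) (xWeight_ne_zero _)

theorem yFactor_ne_zero (e : TriSide Tri) (x : Bool) : yFactor T e x ≠ 0 := by
  rw [yFactor, yWeight]
  split_ifs
  all_goals simp [yVar_ne_zero]

theorem xMonomial_matchingOf {γ : T.Curve} (ε : ℤˣ) {b : ℕ → Bool} (hb : γ.Valid b) :
    xMonomial (γ.snakeGraph ε) (γ.matchingOf ε b) * γ.thirdProd T.xWeight =
      γ.bitProd (xFactor T) b := by
  have := (isSegment_snakeGraph γ ε).xMonomial_eq γ.len_pos hb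
  simp only [zero_add] at this
  exact this

theorem yMonomial_matchingOf (γ : T.Curve) (ε : ℤˣ) (b : ℕ → Bool) :
    yMonomial (γ.snakeGraph ε) (γ.matchingOf ε b) = γ.bitProd (yFactor T) b := by
  have := (isSegment_snakeGraph γ ε).yMonomial_eq (b := b) γ.len_pos
  simp only [zero_add] at this
  exact this

end Curve

end IdealTriangulation

namespace IdealTriangulation

variable {Tri : Type*} {T : IdealTriangulation Tri}

/-! ### Turns about a puncture -/

/-- The signs of the diagonals crossed in one counter-clockwise turn decrease. -/
def TurnValid (l : ℕ) (u : ℕ → Bool) : Prop := ∀ j, j + 1 < l → u (j + 1) = true → u j = true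

/-- The signs on a turn about the end of a curve are compatible with the sign `x` of the diagonal
before or after the turn. -/
def TurnOK (l : ℕ) (u : ℕ → Bool) (x : Bool) : Prop :=
  TurnValid l u ∧ (x = true → u 0 = true) ∧ (u (l - 1) = true → x = true)

/-- The signs `u`, indexed counter-clockwise, in the order in which a turn meets them. -/
def turnBits (s : Sense) (l : ℕ) (u : ℕ → Bool) (j : ℕ) : Bool :=
  match s with
  | .ccw => u j
  | .cw => u (l - 1 - j)

/-- The condition of compatibility at the beginning of a turn. -/
def TurnStartOK (s : Sense) (l : ℕ) (u : ℕ → Bool) (x : Bool) : Prop :=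
  match s with
  | .ccw => x = true → u 0 = true
  | .cw => u (l - 1) = true → x = true

/-- The condition of compatibility at the end of a turn. -/
def TurnFinishOK (s : Sense) (l : ℕ) (u : ℕ → Bool) (x : Bool) : Prop :=
  match s with
  | .ccw => u (l - 1) = true → x = true
  | .cw => x = true → u 0 = true

theorem TurnValid.head_of_last {l : ℕ} {u : ℕ → Bool} (h : TurnValid l u) {j : ℕ} (hj : j < l)
    (hu : u j = true) : u 0 = true := by
  induction j with
  | zero => exact hu
  | succ j ih => exact ih (by omega) (h j hj hu)

theorem turnBits_congr {s : Sense} {l : ℕ} {u u' : ℕ → Bool} (h : ∀ j < l, u j = u' j) {j : ℕ}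
    (hj : j < l) : turnBits s l u j = turnBits s l u' j := by
  cases s
  · exact h j hj
  · exact h _ (by omega)

theorem turnBits_turnBits {s : Sense} {l : ℕ} {u : ℕ → Bool} {j : ℕ} (hj : j < l) :
    turnBits s l (turnBits s l u) j = u j := by
  cases s
  · rfl
  · change u (l - 1 - (l - 1 - j)) = u j
    rw [show l - 1 - (l - 1 - j) = j by omega]

theorem eq_of_turnBits_eq {s : Sense} {l : ℕ} {u u' : ℕ → Bool}
    (h : ∀ j < l, turnBits s l u j = turnBits s l u' j) : ∀ j < l, u j = u' j := fun j hj => by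
  rw [← turnBits_turnBits (s := s) (u := u) hj, ← turnBits_turnBits (s := s) (u := u') hj]
  exact turnBits_congr h hj

theorem turn_len (c : TriSide Tri) (h : T.IsPuncture c) (s : Sense) :
    (turn c h s).len = T.degree c := by
  cases s <;> rfl

/-- A counter-clockwise turn leaves every triangle through the second side after the one by which it
entered, so always the same branch of `Compat` applies, the one that makes signs decrease. -/
theorem turnCCW_valid (c : TriSide Tri) (h : T.IsPuncture c) (u : ℕ → Bool) :
    (turnCCW c h).Valid u ↔ TurnValid (T.degree c) u := by
  refine forall_congr' fun j => imp_congr_right fun _ => ?_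
  have h1 : ((turnCCW c h).cross (j + 1)).2 =
      (T.glue ((turnCCW c h).cross j)).2 + 2 := by
    change (T.rotate^[j + 1] c).2 + 1 = _
    rw [Function.iterate_succ_apply', rotate, add_assoc]
    rfl
  have h2 : ∀ x : ZMod 3, ¬ x + 2 = x + 1 := by decide
  rw [Compat, h1, if_neg (h2 _)]

theorem turn_valid (c : TriSide Tri) (h : T.IsPuncture c) (s : Sense) (u : ℕ → Bool) :
    (turn c h s).Valid (turnBits s (T.degree c) u) ↔ TurnValid (T.degree c) u := by
  rw [← turnCCW_valid c h]
  cases s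
  · rfl
  · exact Curve.valid_reverse fun j _ => rfl

theorem turn_start_eq (c : TriSide Tri) (h : T.IsPuncture c) (s : Sense) :
    (turn c h s).start = match s with
      | .ccw => (c.1, c.2 + 1)
      | .cw => (c.1, c.2 + 2) := by
  cases s
  · rfl
  · exact turnCCW_finish c h

theorem turn_finish_eq (c : TriSide Tri) (h : T.IsPuncture c) (s : Sense) :
    (turn c h s).finish = match s with
      | .ccw => (c.1, c.2 + 2)
      | .cw => (c.1, c.2 + 1) := by
  cases s
  · exact turnCCW_finish c h
  · exact reverse_finish _

theorem turn_start_iff (c : TriSide Tri) (h : T.IsPuncture c) (s : Sense) :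
    (turn c h s).start.2 = c.2 + 1 ↔ s = .ccw := by
  have h2 : ∀ x : ZMod 3, ¬ x + 2 = x + 1 := by decide
  rw [turn_start_eq]
  cases s <;> simp [h2]

theorem turn_finish_iff (c : TriSide Tri) (h : T.IsPuncture c) (s : Sense) :
    c.2 = (turn c h s).finish.2 + 1 ↔ s = .ccw := by
  have h2 : ∀ x : ZMod 3, ¬ x = x + 1 + 1 := by decide
  have h3 : ∀ x : ZMod 3, x = x + 2 + 1 := by decide
  rw [turn_finish_eq]
  cases s
  · simp [← h3]
  · simp [h2]

theorem compat_turn_start (c : TriSide Tri) (h : T.IsPuncture c) (s : Sense) (u : ℕ → Bool)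
    (x : Bool) : Compat c (turn c h s).start x (turnBits s (T.degree c) u 0) ↔
      TurnStartOK s (T.degree c) u x := by
  cases s
  · rw [Compat, if_pos ((turn_start_iff c h .ccw).2 rfl)]
    rfl
  · rw [Compat, if_neg fun h' => by cases (turn_start_iff c h .cw).1 h']
    rfl

theorem compat_turn_finish (c : TriSide Tri) (h : T.IsPuncture c) (s : Sense) (u : ℕ → Bool)
    (x : Bool) : Compat (turn c h s).finish c (turnBits s (T.degree c) u (T.degree c - 1)) x ↔
      TurnFinishOK s (T.degree c) u x := by
  cases s
  · rw [Compat, if_pos ((turn_finish_iff c h .ccw).2 rfl)]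
    rfl
  · rw [Compat, if_neg fun h' => by cases (turn_finish_iff c h .cw).1 h']
    simp [TurnFinishOK, turnBits]

/-- The sense of the turn only decides which bound is met at its beginning and which at its end.
This is why the signs on turns are indexed counter-clockwise throughout: the bijection then does not
depend on the chosen senses. -/
theorem turnOK_iff (s : Sense) {l : ℕ} {u : ℕ → Bool} {x : Bool} :
    TurnOK l u x ↔ TurnValid l u ∧ TurnStartOK s l u x ∧ TurnFinishOK s l u x := by
  cases s <;> simp only [TurnOK, TurnStartOK, TurnFinishOK]
  tauto

namespace Curve

/-! ### Symmetric perfect matchings -/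

section Loop

variable {γ : T.Curve} {h : T.IsPuncture γ.finish} {s : Sense} {ε : ℤˣ} {c a u : ℕ → Bool}

theorem enclose_len (γ : T.Curve) (h : T.IsPuncture γ.finish) (s : Sense) :
    (γ.enclose h s).len = γ.len + T.degree γ.finish + γ.len := by
  change γ.len + (turn γ.finish h s).len + γ.len = _
  rw [turn_len]

theorem enclose_cross_first {j : ℕ} (hj : j < γ.len) : (γ.enclose h s).cross j = γ.cross j := by
  rw [enclose, append_cross_left (by change j < γ.len + _; omega), append_cross_left hj]

theorem enclose_cross_second (j : ℕ) :
    (γ.enclose h s).cross (γ.len + T.degree γ.finish + j) = γ.reverse.cross j := by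
  have := append_cross_right (α := γ.append (turn γ.finish h s) (turn_start _ h s))
    (β := γ.reverse) (h := by
      rw [append_finish, reverse_start]
      exact ⟨(turn_finish _ h s).1.symm, (turn_finish _ h s).2.symm⟩) j
  rwa [show (γ.append (turn γ.finish h s) (turn_start _ h s)).len = γ.len + T.degree γ.finish from
    congrArg _ (turn_len _ _ _)] at this

/-- The signs on the loop around the end of `γ` with the signs `a` on both copies of `γ` and `u` on
the turn. -/
noncomputable def loopBits (γ : T.Curve) (s : Sense) (a u : ℕ → Bool) (j : ℕ) : Bool :=
  if j < γ.len then a j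
  else if j < γ.len + T.degree γ.finish then turnBits s (T.degree γ.finish) u (j - γ.len)
  else a (γ.len + T.degree γ.finish + γ.len - 1 - j)

theorem loopBits_first {j : ℕ} (hj : j < γ.len) : γ.loopBits s a u j = a j := if_pos hj

theorem loopBits_turn {j : ℕ} (hj : j < T.degree γ.finish) :
    γ.loopBits s a u (γ.len + j) = turnBits s (T.degree γ.finish) u j := by
  rw [loopBits, if_neg (by omega), if_pos (by omega), Nat.add_sub_cancel_left]

theorem loopBits_second (j : ℕ) :
    γ.loopBits s a u (γ.len + T.degree γ.finish + j) = a (γ.len - 1 - j) := by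
  rw [loopBits, if_neg (by omega), if_neg (by omega)]
  congr 1
  omega

theorem enclose_valid (c : ℕ → Bool) : (γ.enclose h s).Valid c ↔
    (γ.Valid c ∧ Compat γ.finish (turn γ.finish h s).start (c (γ.len - 1)) (c γ.len) ∧
      (turn γ.finish h s).Valid fun j => c (γ.len + j)) ∧
    Compat (turn γ.finish h s).finish γ.finish (c (γ.len + T.degree γ.finish - 1))
      (c (γ.len + T.degree γ.finish)) ∧
    γ.reverse.Valid fun j => c (γ.len + T.degree γ.finish + j) := by
  have hl : (γ.append (turn γ.finish h s) (turn_start _ h s)).len = γ.len + T.degree γ.finish :=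
    congrArg _ (turn_len _ _ _)
  rw [enclose, valid_append (b := c) (b' := fun j => c (γ.len + T.degree γ.finish + j))
    (fun _ _ => rfl) (fun j _ => by rw [hl]), valid_append (b := c) (b' := fun j => c (γ.len + j))
    (fun _ _ => rfl) (fun _ _ => rfl), append_finish, reverse_start, hl]

/-- Both joints of the turn are adjacent to a copy of the last crossing of `γ`, and both copies have
the sign `a (γ.len - 1)`. The two joint conditions are the two bounds in `TurnOK`. -/
theorem enclose_valid_loopBits : (γ.enclose h s).Valid (γ.loopBits s a u) ↔
    γ.Valid a ∧ TurnOK (T.degree γ.finish) u (a (γ.len - 1)) := by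
  have h0 := γ.len_pos
  have hd := degree_pos h
  have e1 : γ.loopBits s a u γ.len = turnBits s (T.degree γ.finish) u 0 := loopBits_turn hd
  have e2 : γ.loopBits s a u (γ.len + T.degree γ.finish) = a (γ.len - 1) := loopBits_second 0
  have e3 : γ.loopBits s a u (γ.len + T.degree γ.finish - 1) =
      turnBits s (T.degree γ.finish) u (T.degree γ.finish - 1) := by
    rw [Nat.add_sub_assoc hd, loopBits_turn (by omega)]
  rw [enclose_valid, valid_congr (b' := a) fun j hj => loopBits_first hj,
    valid_congr (γ := turn γ.finish h s) (b' := turnBits s (T.degree γ.finish) u)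
      fun j hj => loopBits_turn (by rwa [turn_len] at hj),
    valid_reverse (b := a) fun j _ => loopBits_second j, e1, e2, e3,
    loopBits_first (show γ.len - 1 < γ.len by omega), compat_turn_start, compat_turn_finish,
    turn_valid, turnOK_iff s]
  tauto

theorem copyEdge_first_mem_iff (hc : (γ.enclose h s).Valid c) {m : ℕ} (hm : m < γ.len) (σ : Slot) :
    γ.copyEdge h s ε .first m σ ∈ (γ.enclose h s).matchingOf ε c ↔
      γ.MemBits c m σ ∧ (m + 1 = γ.len → FrontOK γ.finish (turn γ.finish h s).start (c γ.len) σ) := by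
  have hd := degree_pos h
  have hlen := turn_len γ.finish h s
  refine (edge_mem_matchingOf_iff hc (by rw [enclose_len]; exact Nat.lt_add_left _ hm) σ).trans ?_
  change (γ.enclose h s).MemBits c m σ ↔ _
  rw [enclose, memBits_append_left (b := c) (fun _ _ => rfl) (by change m < γ.len + _; omega),
    memBits_append_left (b := c) (fun _ _ => rfl) hm]
  have : m + 1 ≠ (γ.append (turn γ.finish h s) (turn_start _ h s)).len := by
    change m + 1 ≠ γ.len + _
    omega
  simp only [this, false_imp_iff, and_true]

theorem copyEdge_second_mem_iff (hc : (γ.enclose h s).Valid c) {m : ℕ} (hm : m < γ.len)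
    (σ : Slot) :
    γ.copyEdge h s ε .second m σ ∈ (γ.enclose h s).matchingOf ε c ↔
      γ.MemBits (fun m => c ((γ.enclose h s).len - 1 - m)) m σ ∧
        (m + 1 = γ.len → BackOK (turn γ.finish h s).finish γ.finish
          (c (γ.len + T.degree γ.finish - 1)) σ.opp) := by
  have hd := degree_pos h
  have hl : (γ.append (turn γ.finish h s) (turn_start _ h s)).len = γ.len + T.degree γ.finish :=
    congrArg _ (turn_len _ _ _)
  have hlen := enclose_len γ h s
  have htile : (γ.enclose h s).len - 1 - m = (γ.append (turn γ.finish h s) (turn_start _ h s)).len +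
      (γ.len - 1 - m) := by omega
  refine (edge_mem_matchingOf_iff hc
    (show (γ.enclose h s).len - 1 - m < _ by omega) σ.opp).trans ?_
  rw [htile, enclose, memBits_append_right (b := fun j => c (γ.len + T.degree γ.finish + j))
    (fun j _ => by rw [hl]) (by change _ < γ.len; omega), append_finish, reverse_start, hl,
    memBits_reverse (b := fun m => c ((γ.enclose h s).len - 1 - m)) (fun j hj => ?_) (by omega),
    Slot.opp_opp, show γ.len - 1 - (γ.len - 1 - m) = m by omega]
  · refine and_congr Iff.rfl (imp_congr_left ?_)
    omega
  · refine congrArg c ?_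
    omega

/-- The sides exempted from the comparison are front sides, while the back sides alone determine all
signs (`eq_of_memBits_iff`); so symmetry forces equal signs on the copies. Conversely, the turn can
influence only the front sides at the last crossing, which are exempted. -/
theorem isSymmetric_iff {P : Finset (Sym2 LatticePt)} : γ.IsSymmetric h s ε P ↔
    ∃ a u, γ.Valid a ∧ TurnOK (T.degree γ.finish) u (a (γ.len - 1)) ∧
      P = (γ.enclose h s).matchingOf ε (γ.loopBits s a u) := by
  have h0 := γ.len_pos
  have hlen := enclose_len γ h s
  constructor
  · rintro ⟨hP, hsym⟩
    obtain ⟨c, hc, rfl⟩ := exists_eq_matchingOf (γ := γ.enclose h s) hP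
    have heq : ∀ m < γ.len, c m = c ((γ.enclose h s).len - 1 - m) := by
      refine eq_of_memBits_iff (γ := γ) (b' := fun m => c ((γ.enclose h s).len - 1 - m))
        fun m hm σ hσ => ?_
      have := hsym m hm σ (fun h => hσ h.2)
      rw [copyEdge_first_mem_iff hc hm, copyEdge_second_mem_iff hc hm] at this
      cases σ <;> simp_all [FrontOK, BackOK, Slot.opp, Slot.IsFront]
    -- The signs on the turn are brought into counter-clockwise order by `turnBits`, which is an
    -- involution.
    have hcl : ∀ j < (γ.enclose h s).len, c j = γ.loopBits s c
        (turnBits s (T.degree γ.finish) fun j => c (γ.len + j)) j := by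
      intro j hj
      rcases Nat.lt_or_ge j γ.len with h1 | h1
      · rw [loopBits_first h1]
      · rcases Nat.lt_or_ge j (γ.len + T.degree γ.finish) with h2 | h2
        · obtain ⟨i, rfl⟩ : ∃ i, j = γ.len + i := ⟨j - γ.len, by omega⟩
          rw [loopBits_turn (by omega), turnBits_turnBits (by omega)]
        · obtain ⟨i, rfl⟩ : ∃ i, j = γ.len + T.degree γ.finish + i :=
            ⟨j - (γ.len + T.degree γ.finish), by omega⟩
          rw [loopBits_second, heq (γ.len - 1 - i) (by omega)]
          congr 1
          omega
    have hv := (valid_congr hcl).1 hc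
    rw [enclose_valid_loopBits] at hv
    exact ⟨_, _, hv.1, hv.2, matchingOf_congr hcl⟩
  · rintro ⟨a, u, ha, hu, rfl⟩
    have hc : (γ.enclose h s).Valid (γ.loopBits s a u) := enclose_valid_loopBits.2 ⟨ha, hu⟩
    refine ⟨isPerfectMatching_matchingOf ε hc, fun m hm σ hσ => ?_⟩
    rw [copyEdge_first_mem_iff hc hm, copyEdge_second_mem_iff hc hm,
      memBits_congr (b' := a) (fun j hj => loopBits_first hj) hm,
      memBits_congr (b := fun m => γ.loopBits s a u ((γ.enclose h s).len - 1 - m)) (b' := a)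
        (fun j hj => ?_) hm]
    · refine and_congr Iff.rfl (imp_congr_right fun hm' => ?_)
      have : ¬ σ.IsFront := fun h => hσ ⟨by omega, h⟩
      cases σ <;> simp_all [FrontOK, BackOK, Slot.opp, Slot.IsFront]
    · rw [hlen, show γ.len + T.degree γ.finish + γ.len - 1 - j = γ.len + T.degree γ.finish +
        (γ.len - 1 - j) by omega, loopBits_second, show γ.len - 1 - (γ.len - 1 - j) = j by omega]

/-- The sign next to the copy `i` of `γ` in a loop imposes no condition on this copy. -/
def CopyFree (s : Sense) (l : ℕ) (u : ℕ → Bool) : Copy → Prop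
  | .first => match s with
    | .ccw => u 0 = true
    | .cw => u (l - 1) = false
  | .second => match s with
    | .ccw => u (l - 1) = false
    | .cw => u 0 = true

/-- A positive last sign forces a positive first sign on the turn. So one of the two copies is
always free, whichever sense is chosen. -/
theorem exists_copyFree (s : Sense) {l : ℕ} (hl : 0 < l) {u : ℕ → Bool} (hu : TurnValid l u) :
    ∃ i, CopyFree s l u i := by
  have : u 0 = true ∨ u (l - 1) = false := by
    by_cases h : u (l - 1) = true
    · exact Or.inl (hu.head_of_last (by omega) h)
    · exact Or.inr (by simpa using h)
  cases s <;> rcases this with h | h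
  · exact ⟨.first, h⟩
  · exact ⟨.second, h⟩
  · exact ⟨.second, h⟩
  · exact ⟨.first, h⟩

/-- Only the two front sides at the last crossing could feel the turn. One of them is not glued to
it, and freeness is the condition for the other. -/
theorem copyEdge_mem_iff (ha : γ.Valid a) (hu : TurnOK (T.degree γ.finish) u (a (γ.len - 1)))
    {i : Copy} (hi : CopyFree s (T.degree γ.finish) u i) {m : ℕ} (hm : m < γ.len) (σ : Slot) :
    γ.copyEdge h s ε i m σ ∈ (γ.enclose h s).matchingOf ε (γ.loopBits s a u) ↔
      γ.MemBits a m σ := by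
  have hc : (γ.enclose h s).Valid (γ.loopBits s a u) := enclose_valid_loopBits.2 ⟨ha, hu⟩
  have hd := degree_pos h
  have hlen := enclose_len γ h s
  cases i
  · rw [copyEdge_first_mem_iff hc hm, memBits_congr (b' := a) (fun j hj => loopBits_first hj) hm,
      and_iff_left]
    intro _
    have e1 : γ.loopBits s a u γ.len = turnBits s (T.degree γ.finish) u 0 := loopBits_turn hd
    rw [e1]
    cases σ <;> simp only [FrontOK, turn_start_iff, ne_eq]
    · rintro rfl; exact hi
    · cases s
      · simp
      · exact fun _ => hi
  · rw [copyEdge_second_mem_iff hc hm,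
      memBits_congr (b := fun m => γ.loopBits s a u ((γ.enclose h s).len - 1 - m)) (b' := a)
        (fun j hj => ?_) hm, and_iff_left]
    · intro _
      have e3 : γ.loopBits s a u (γ.len + T.degree γ.finish - 1) =
          turnBits s (T.degree γ.finish) u (T.degree γ.finish - 1) := by
        rw [Nat.add_sub_assoc hd, loopBits_turn (by omega)]
      rw [e3]
      cases σ <;> simp only [BackOK, Slot.opp, turn_finish_iff, ne_eq]
      · cases s
        · simp
        · have hi' : u 0 = true := hi
          simp [turnBits, hi']
      · rintro rfl; exact hi
    · rw [hlen, show γ.len + T.degree γ.finish + γ.len - 1 - j = γ.len + T.degree γ.finish +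
        (γ.len - 1 - j) by omega, loopBits_second, show γ.len - 1 - (γ.len - 1 - j) = j by omega]

/-! ### Restriction of a symmetric matching to a copy of the curve -/

/-- The number of the first tile of a copy of `γ` in the snake graph of a loop. -/
noncomputable def copyStart (γ : T.Curve) : Copy → ℕ
  | .first => 0
  | .second => γ.len + T.degree γ.finish

theorem copyStart_le (γ : T.Curve) (h : T.IsPuncture γ.finish) (s : Sense) (ε : ℤˣ) (i : Copy) :
    γ.copyStart i + γ.len ≤ ((γ.enclose h s).snakeGraph ε).numTiles := by
  change _ ≤ (γ.enclose h s).len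
  rw [enclose_len]
  cases i <;> simp [copyStart]

theorem copyGraph_eq (γ : T.Curve) (h : T.IsPuncture γ.finish) (s : Sense) (ε : ℤˣ) (i : Copy) :
    γ.copyGraph h s ε i = ((γ.enclose h s).snakeGraph ε).sub (γ.copyStart i) γ.len
      (copyStart_le γ h s ε i) := by
  cases i <;> rfl

/-- The first copy begins with the first tile of the loop and the second copy ends with the last
one, so at these ends the vertex condition is automatic. What remains is the condition at the joint
with the turn. -/
theorem copyFree_iff (i : Copy) :
    CopyFree s (T.degree γ.finish) u i ↔
      ((γ.enclose h s).snakeGraph ε).leave (downBits ε (γ.loopBits s a u)) (γ.copyStart i) =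
          ((γ.enclose h s).snakeGraph ε).sw (γ.copyStart i) ∧
        ((γ.enclose h s).snakeGraph ε).enter (downBits ε (γ.loopBits s a u))
          (γ.copyStart i + γ.len) =
          ((γ.enclose h s).snakeGraph ε).ne (γ.copyStart i + γ.len - 1) := by
  have hd := degree_pos h
  have h0 := γ.len_pos
  have hlen := enclose_len γ h s
  cases i
  · refine Iff.trans ?_ (and_iff_right rfl).symm
    have h1 := enter_eq_ne_iff (γ := γ.enclose h s) (ε := ε) (b := γ.loopBits s a u)
      (j := γ.len - 1) (by omega)
    have e1 : γ.loopBits s a u γ.len = turnBits s (T.degree γ.finish) u 0 := loopBits_turn hd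
    have e2 : (γ.enclose h s).cross γ.len = (turn γ.finish h s).start := by
      rw [enclose, append_cross_left (by change γ.len < γ.len + _; rw [turn_len]; omega),
        ← Nat.add_zero γ.len, append_cross_right]
      rfl
    rw [show γ.len - 1 + 1 = γ.len by omega, e1, e2, enclose_cross_first (by omega)] at h1
    simp only [copyStart, zero_add]
    refine Iff.trans ?_ h1.symm
    have h3 : (turn γ.finish h s).start.2 = (T.glue (γ.cross (γ.len - 1))).2 + 1 ↔ s = .ccw :=
      turn_start_iff γ.finish h s
    rw [h3]
    cases s <;> simp [CopyFree, turnBits]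
  · rw [and_iff_left (by
      rw [SnakeGraph.enter, if_neg]
      change ¬ _ < (γ.enclose h s).len
      rw [hlen]
      simp only [copyStart]
      omega)]
    have h1 := leave_eq_sw_iff (γ := γ.enclose h s) (ε := ε) (b := γ.loopBits s a u)
      (j := γ.len + T.degree γ.finish - 1) (by omega)
    have e3 : γ.loopBits s a u (γ.len + T.degree γ.finish - 1) =
        turnBits s (T.degree γ.finish) u (T.degree γ.finish - 1) := by
      rw [Nat.add_sub_assoc hd, loopBits_turn (by omega)]
    have e4 : T.glue ((γ.enclose h s).cross (γ.len + T.degree γ.finish - 1)) =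
        (turn γ.finish h s).finish := by
      rw [enclose, append_cross_left (by
        change _ < γ.len + (turn γ.finish h s).len
        rw [turn_len]; omega), Nat.add_sub_assoc hd, append_cross_right]
      rw [← turn_len γ.finish h s]
      rfl
    have e5 : (γ.enclose h s).cross (γ.len + T.degree γ.finish) = γ.finish :=
      (enclose_cross_second 0).trans (reverse_start γ)
    rw [show γ.len + T.degree γ.finish - 1 + 1 = γ.len + T.degree γ.finish by omega, e3, e4,
      e5, turn_finish_iff] at h1
    refine Iff.trans ?_ h1.symm
    cases s <;> simp [CopyFree, turnBits]

theorem restrict_perfect_iff (ha : γ.Valid a)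
    (hu : TurnOK (T.degree γ.finish) u (a (γ.len - 1))) (i : Copy) :
    (γ.copyGraph h s ε i).graph.IsPerfectMatching
      (SnakeGraph.restrict ((γ.enclose h s).matchingOf ε (γ.loopBits s a u))
        (γ.copyGraph h s ε i)) ↔ CopyFree s (T.degree γ.finish) u i := by
  have hc : (γ.enclose h s).Valid (γ.loopBits s a u) := enclose_valid_loopBits.2 ⟨ha, hu⟩
  rw [copyGraph_eq, matchingOf, SnakeGraph.isPerfectMatching_restrict_iff γ.len_pos
    ((admissible_iff _ ε _).2 hc), ← copyFree_iff]

theorem copy_monomials (ha : γ.Valid a)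
    (hu : TurnOK (T.degree γ.finish) u (a (γ.len - 1))) {i : Copy}
    (hi : CopyFree s (T.degree γ.finish) u i) :
    xMonomial (γ.copyGraph h s ε i)
        (SnakeGraph.restrict ((γ.enclose h s).matchingOf ε (γ.loopBits s a u))
          (γ.copyGraph h s ε i)) * γ.thirdProd T.xWeight = γ.bitProd (xFactor T) a ∧
      yMonomial (γ.copyGraph h s ε i)
        (SnakeGraph.restrict ((γ.enclose h s).matchingOf ε (γ.loopBits s a u))
          (γ.copyGraph h s ε i)) = γ.bitProd (yFactor T) a := by
  have h0 := γ.len_pos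
  have hc : (γ.enclose h s).Valid (γ.loopBits s a u) := enclose_valid_loopBits.2 ⟨ha, hu⟩
  have hf := (copyFree_iff (h := h) (ε := ε) (a := a) i).1 hi
  have hseg := isSegment_sub (γ.enclose h s) ε (copyStart_le γ h s ε i)
  have hx := hseg.xMonomial_eq h0 hc
  have hy := hseg.yMonomial_eq (b := γ.loopBits s a u) h0
  rw [copyGraph_eq, matchingOf, SnakeGraph.restrict_matching_eq γ.len_pos
    ((admissible_iff _ ε _).2 hc) hf.1 hf.2]
  rw [SnakeGraph.sub_numTiles] at hx hy
  -- The second copy runs along the reversed curve with reversed signs, which does not change the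
  -- product.
  have hprod : ∀ (g : TriSide Tri → Bool → T.FunctionField), (∀ e x, g (T.glue e) x = g e x) →
      ∏ j ∈ range γ.len, g ((γ.enclose h s).cross (γ.copyStart i + j))
        (γ.loopBits s a u (γ.copyStart i + j)) = γ.bitProd g a := by
    intro g hg
    cases i
    · refine prod_congr rfl fun j hj => ?_
      have hj := mem_range.1 hj
      simp only [copyStart, zero_add]
      rw [enclose_cross_first hj, loopBits_first hj]
    · rw [← bitProd_reverse hg (b' := fun j => a (γ.len - 1 - j)) fun j _ => rfl]
      refine prod_congr rfl fun j hj => ?_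
      simp only [copyStart]
      rw [enclose_cross_second, loopBits_second]
  have hthird : ∏ j ∈ range (γ.len - 1), T.xWeight (thirdSide
      (T.glue ((γ.enclose h s).cross (γ.copyStart i + j)))
      ((γ.enclose h s).cross (γ.copyStart i + j + 1))) = γ.thirdProd T.xWeight := by
    cases i
    · refine prod_congr rfl fun j hj => ?_
      have hj := mem_range.1 hj
      simp only [copyStart, zero_add]
      rw [enclose_cross_first (by omega), enclose_cross_first (by omega)]
    · rw [← thirdProd_reverse]
      refine prod_congr rfl fun j hj => ?_
      simp only [copyStart]
      rw [add_assoc _ j 1, enclose_cross_second, enclose_cross_second]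
  rw [hthird, hprod _ xFactor_glue] at hx
  rw [hprod _ yFactor_glue] at hy
  exact ⟨hx, hy⟩

/-! ### Monomials of a symmetric matching -/

theorem bitProd_turn (g : TriSide Tri → Bool → T.FunctionField)
    (hg : ∀ e x, g (T.glue e) x = g e x) (c : TriSide Tri) (h : T.IsPuncture c) (s : Sense)
    (u : ℕ → Bool) :
    (turn c h s).bitProd g (turnBits s (T.degree c) u) = (turnCCW c h).bitProd g u := by
  cases s
  · rfl
  · exact bitProd_reverse hg fun j _ => rfl

theorem thirdProd_turn (w : TriSide Tri → T.FunctionField) (c : TriSide Tri) (h : T.IsPuncture c)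
    (s : Sense) : (turn c h s).thirdProd w = (turnCCW c h).thirdProd w := by
  cases s
  · rfl
  · exact thirdProd_reverse _ _

/-- A turn leaves the triangle of `c` through one of the two sides that meet at `c` and returns
through the other. Since the curve enters and leaves this triangle through the side `c`, the third
side at either joint is the one used at the other joint. -/
theorem thirdSide_turn (w : TriSide Tri → T.FunctionField) (c : TriSide Tri) (h : T.IsPuncture c)
    (s : Sense) :
    w (thirdSide c (turn c h s).start) * w (thirdSide (turn c h s).finish c) =
      w (c.1, c.2 + 1) * w (c.1, c.2 + 2) := by
  have h22 : (2 + 2 : ZMod 3) = 1 := by decide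
  have h11 : (1 + 1 : ZMod 3) = 2 := by decide
  cases s
  · rw [thirdSide, thirdSide, if_pos ((turn_start_iff c h .ccw).2 rfl),
      if_pos ((turn_finish_iff c h .ccw).2 rfl), turn_finish_eq, mul_comm]
    simp only [add_assoc, h22]
  · rw [thirdSide, thirdSide, if_neg (fun h' => by cases (turn_start_iff c h .cw).1 h'),
      if_neg (fun h' => by cases (turn_finish_iff c h .cw).1 h'), turn_finish_eq]
    simp only [add_assoc, h11]

theorem enclose_bitProd (g : TriSide Tri → Bool → T.FunctionField)
    (hg : ∀ e x, g (T.glue e) x = g e x) : (γ.enclose h s).bitProd g (γ.loopBits s a u) =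
      γ.bitProd g a ^ 2 * (turnCCW γ.finish h).bitProd g u := by
  have hl : (γ.append (turn γ.finish h s) (turn_start _ h s)).len = γ.len + T.degree γ.finish :=
    congrArg _ (turn_len _ _ _)
  rw [enclose, bitProd_append g (b := γ.loopBits s a u) (b' := fun j => a (γ.len - 1 - j))
    (fun _ _ => rfl) (fun j _ => by rw [hl, loopBits_second]),
    bitProd_append g (b := a) (b' := turnBits s (T.degree γ.finish) u)
    (fun j hj => loopBits_first hj) (fun j hj => loopBits_turn (by rwa [turn_len] at hj)),
    bitProd_turn g hg, bitProd_reverse hg fun j _ => rfl]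
  ring

theorem enclose_thirdProd (w : TriSide Tri → T.FunctionField) : (γ.enclose h s).thirdProd w =
      γ.thirdProd w ^ 2 * (turnCCW γ.finish h).thirdProd w *
        (w (γ.finish.1, γ.finish.2 + 1) * w (γ.finish.1, γ.finish.2 + 2)) := by
  rw [enclose, thirdProd_append, thirdProd_append, append_finish, reverse_start, thirdProd_reverse,
    thirdProd_turn, ← thirdSide_turn w γ.finish h s]
  ring

end Loop

end Curve

end IdealTriangulation

/-! ### Gluing a graph along two pairs of edges -/

/-- For `i = false, true`, the edges `s(x i, y i)` and `s(x' i, y' i)` of a graph are to be glued to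
each other. Only the vertices `x' false` and `x' true` may coincide. -/
structure IsCutting {V : Type*} (H : IncGraph V (Sym2 V)) (x y x' y' : Bool → V) : Prop where
  inc : ∀ e v, H.Inc e v ↔ v ∈ e
  mem_verts : ∀ e ∈ H.edges, ∀ v ∈ e, v ∈ H.verts
  mem_edges : ∀ i, s(x i, y i) ∈ H.edges
  mem_edges' : ∀ i, s(x' i, y' i) ∈ H.edges
  x_ne_y : ∀ i j, x i ≠ y j
  x_ne_x' : ∀ i j, x i ≠ x' j
  x_ne_y' : ∀ i j, x i ≠ y' j
  y_ne_x' : ∀ i j, y i ≠ x' j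
  y_ne_y' : ∀ i j, y i ≠ y' j
  x'_ne_y' : ∀ i j, x' i ≠ y' j
  x_inj : ∀ i j, x i = x j → i = j
  y_inj : ∀ i j, y i = y j → i = j
  y'_inj : ∀ i j, y' i = y' j → i = j
  far : ∀ e ∈ H.edges, ∀ i j, x i ∈ e → x' j ∉ e
  far' : ∀ e ∈ H.edges, ∀ i j, i ≠ j → x i ∈ e → x j ∉ e

namespace IsCutting

variable {V : Type*} {H : IncGraph V (Sym2 V)} {x y x' y' : Bool → V}
  {g : V → V} {P Q Q' : Finset (Sym2 V)}

/-- The map `g` identifies `x i` with `x' i` and `y i` with `y' i`. -/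
structure IsGluing (x y x' y' : Bool → V) (g : V → V) : Prop where
  map_x : ∀ i, g (x i) = x' i
  map_y : ∀ i, g (y i) = y' i
  map_other : ∀ v, (∀ i, v ≠ x i) → (∀ i, v ≠ y i) → g v = v

/-- A perfect matching of the glued graph, described in the graph itself. -/
def IsGluedMatching (H : IncGraph V (Sym2 V)) (x y : Bool → V) (g : V → V)
    (P : Finset (Sym2 V)) : Prop :=
  (∀ e ∈ P, e ∈ H.edges ∧ ∀ i, e ≠ s(x i, y i)) ∧
    ∀ v ∈ H.verts, ∃! e, e ∈ P ∧ ∃ w ∈ e, g w = g v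

open Classical in
/-- The edge of each glued pair to be removed from a perfect matching. -/
noncomputable def removed (x y x' y' : Bool → V) (Q : Finset (Sym2 V)) (i : Bool) : Sym2 V :=
  if s(x i, y i) ∈ Q then s(x i, y i) else s(x' i, y' i)

open Classical in
/-- The result of removing one edge of each glued pair from a perfect matching. -/
noncomputable def core (x y x' y' : Bool → V) (Q : Finset (Sym2 V)) : Finset (Sym2 V) :=
  (Q.erase (removed x y x' y' Q false)).erase (removed x y x' y' Q true)

theorem mem_core {e : Sym2 V} :
    e ∈ core x y x' y' Q ↔ e ∈ Q ∧ ∀ i, e ≠ removed x y x' y' Q i := by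
  simp only [core, mem_erase, Bool.forall_bool]
  tauto

/-- A perfect matching which meets both pairs of edges to be glued. -/
def Meets (x y x' y' : Bool → V) (Q : Finset (Sym2 V)) : Prop :=
  ∀ i, s(x i, y i) ∈ Q ∨ s(x' i, y' i) ∈ Q

theorem removed_mem (hQ : Meets x y x' y' Q) (i : Bool) : removed x y x' y' Q i ∈ Q := by
  rw [removed]
  split_ifs with h
  · exact h
  · exact (hQ i).resolve_left h

theorem removed_cases (Q : Finset (Sym2 V)) (i : Bool) :
    (s(x i, y i) ∈ Q ∧ removed x y x' y' Q i = s(x i, y i)) ∨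
      (s(x i, y i) ∉ Q ∧ removed x y x' y' Q i = s(x' i, y' i)) := by
  rw [removed]
  split_ifs with h <;> simp [h]

theorem removed_of_x_not_mem {i : Bool} (h : x i ∉ removed x y x' y' Q i) :
    removed x y x' y' Q i = s(x' i, y' i) := by
  rcases removed_cases (x := x) (y := y) (x' := x') (y' := y') Q i with ⟨-, h1⟩ | ⟨-, h1⟩
  · rw [h1] at h
    simp at h
  · exact h1

theorem removed_of_y_not_mem {i : Bool} (h : y i ∉ removed x y x' y' Q i) :
    removed x y x' y' Q i = s(x' i, y' i) := by
  rcases removed_cases (x := x) (y := y) (x' := x') (y' := y') Q i with ⟨-, h1⟩ | ⟨-, h1⟩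
  · rw [h1] at h
    simp at h
  · exact h1

variable (hH : IsCutting H x y x' y')
include hH

theorem eq_of_mem (hQ : H.IsPerfectMatching Q) {v : V} {e f : Sym2 V} (he : e ∈ Q) (hf : f ∈ Q)
    (hve : v ∈ e) (hvf : v ∈ f) : e = f :=
  (hQ.2 v (hH.mem_verts e (hQ.1 e he) v hve)).unique ⟨he, (hH.inc _ _).2 hve⟩
    ⟨hf, (hH.inc _ _).2 hvf⟩

theorem exists_mem (hQ : H.IsPerfectMatching Q) {v : V} (hv : v ∈ H.verts) :
    ∃ e ∈ Q, v ∈ e := by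
  obtain ⟨e, ⟨he, hve⟩, -⟩ := hQ.2 v hv
  exact ⟨e, he, (hH.inc _ _).1 hve⟩

theorem x_mem_verts (i : Bool) : x i ∈ H.verts :=
  hH.mem_verts _ (hH.mem_edges i) _ (Sym2.mem_mk_left _ _)

theorem y_mem_verts (i : Bool) : y i ∈ H.verts :=
  hH.mem_verts _ (hH.mem_edges i) _ (Sym2.mem_mk_right _ _)

theorem x'_mem_verts (i : Bool) : x' i ∈ H.verts :=
  hH.mem_verts _ (hH.mem_edges' i) _ (Sym2.mem_mk_left _ _)

theorem y'_mem_verts (i : Bool) : y' i ∈ H.verts :=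
  hH.mem_verts _ (hH.mem_edges' i) _ (Sym2.mem_mk_right _ _)

theorem map_x' (hg : IsGluing x y x' y' g) (i : Bool) : g (x' i) = x' i :=
  hg.map_other _ (fun j => (hH.x_ne_x' j i).symm) (fun j => (hH.y_ne_x' j i).symm)

theorem map_y' (hg : IsGluing x y x' y' g) (i : Bool) : g (y' i) = y' i :=
  hg.map_other _ (fun j => (hH.x_ne_y' j i).symm) (fun j => (hH.y_ne_y' j i).symm)

theorem eq_or_eq_of_map_eq_y' (hg : IsGluing x y x' y' g) {i : Bool} {w : V} (h : g w = y' i) :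
    w = y i ∨ w = y' i := by
  by_cases h1 : ∃ j, w = x j
  · obtain ⟨j, rfl⟩ := h1
    rw [hg.map_x] at h
    exact absurd h (hH.x'_ne_y' j i)
  · by_cases h2 : ∃ j, w = y j
    · obtain ⟨j, rfl⟩ := h2
      rw [hg.map_y] at h
      rw [hH.y'_inj _ _ h]
      exact Or.inl rfl
    · push Not at h1 h2
      rw [hg.map_other w h1 h2] at h
      exact Or.inr h

/-- The vertices that are not covered by a removed edge are mapped injectively. -/
theorem injOn_uncovered (hg : IsGluing x y x' y' g) (hQ : H.IsPerfectMatching Q)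
    (hm : Meets x y x' y' Q) {v w : V} (hv : ∀ i, v ∉ removed x y x' y' Q i)
    (hw : ∀ i, w ∉ removed x y x' y' Q i) (h : g v = g w) : v = w := by
  have key1 : ∀ {i w}, x i ∉ removed x y x' y' Q i → (∀ i, w ∉ removed x y x' y' Q i) →
      g w = x' i → w = x i := by
    intro i w hi hw hgw
    have hri := removed_of_x_not_mem hi
    by_cases h1 : ∃ j, w = x j
    · obtain ⟨j, rfl⟩ := h1
      have hrj := removed_of_x_not_mem (hw j)
      have hri' := removed_mem hm i
      have hrj' := removed_mem hm j
      rw [hri] at hri'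
      rw [hrj] at hrj'
      rw [hg.map_x] at hgw
      -- The vertices `x' i` and `x' j` may coincide. Then the two removed inner edges share a
      -- vertex of a perfect matching, so they are equal, and their ends `y'` distinguish the
      -- indices.
      have := hH.eq_of_mem hQ hri' hrj' (v := x' i) (by simp) (by simp [hgw])
      have h2 : y' i ∈ s(x' j, y' j) := this ▸ Sym2.mem_mk_right _ _
      rcases Sym2.mem_iff.1 h2 with h3 | h3
      · exact absurd h3.symm (hH.x'_ne_y' _ _)
      · rw [hH.y'_inj _ _ h3]
    · by_cases h2 : ∃ j, w = y j
      · obtain ⟨j, rfl⟩ := h2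
        rw [hg.map_y] at hgw
        exact absurd hgw.symm (hH.x'_ne_y' _ _)
      · push Not at h1 h2
        rw [hg.map_other w h1 h2] at hgw
        exact absurd (by rw [hri, hgw]; simp) (hw i)
  have key2 : ∀ {i w}, y i ∉ removed x y x' y' Q i → (∀ i, w ∉ removed x y x' y' Q i) →
      g w = y' i → w = y i := by
    intro i w hi hw hgw
    have hri := removed_of_y_not_mem hi
    rcases hH.eq_or_eq_of_map_eq_y' hg hgw with h1 | h1
    · exact h1
    · exact absurd (by rw [hri, h1]; simp) (hw i)
  by_cases h1 : ∃ i, v = x i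
  · obtain ⟨i, rfl⟩ := h1
    exact (key1 (hv i) hw (h.symm.trans (hg.map_x i))).symm
  by_cases h2 : ∃ i, v = y i
  · obtain ⟨i, rfl⟩ := h2
    exact (key2 (hv i) hw (h.symm.trans (hg.map_y i))).symm
  by_cases h3 : ∃ i, w = x i
  · obtain ⟨i, rfl⟩ := h3
    exact key1 (hw i) hv (h.trans (hg.map_x i))
  by_cases h4 : ∃ i, w = y i
  · obtain ⟨i, rfl⟩ := h4
    exact key2 (hw i) hv (h.trans (hg.map_y i))
  push Not at h1 h2 h3 h4
  rwa [hg.map_other v h1 h2, hg.map_other w h3 h4] at h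

/-- Every vertex of the glued graph comes from a vertex not covered by a removed edge. -/
theorem exists_uncovered (hg : IsGluing x y x' y' g) {v₀ : V} (hv₀ : v₀ ∈ H.verts) :
    ∃ v ∈ H.verts, (∀ i, v ∉ removed x y x' y' Q i) ∧ g v = g v₀ := by
  have hx : ∀ i, removed x y x' y' Q i = s(x' i, y' i) →
      ∀ k, x i ∉ removed x y x' y' Q k := by
    intro i hi k hk
    rcases removed_cases (x := x) (y := y) (x' := x') (y' := y') Q k with ⟨-, h1⟩ | ⟨-, h1⟩
    · rw [h1] at hk
      rcases Sym2.mem_iff.1 hk with h | h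
      · obtain rfl := hH.x_inj _ _ h
        rw [hi] at h1
        have : x i ∈ s(x' i, y' i) := h1 ▸ Sym2.mem_mk_left _ _
        rcases Sym2.mem_iff.1 this with h | h
        · exact hH.x_ne_x' _ _ h
        · exact hH.x_ne_y' _ _ h
      · exact hH.x_ne_y _ _ h
    · rw [h1] at hk
      rcases Sym2.mem_iff.1 hk with h | h
      · exact hH.x_ne_x' _ _ h
      · exact hH.x_ne_y' _ _ h
  have hy : ∀ i, removed x y x' y' Q i = s(x' i, y' i) →
      ∀ k, y i ∉ removed x y x' y' Q k := by
    intro i hi k hk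
    rcases removed_cases (x := x) (y := y) (x' := x') (y' := y') Q k with ⟨-, h1⟩ | ⟨-, h1⟩
    · rw [h1] at hk
      rcases Sym2.mem_iff.1 hk with h | h
      · exact hH.x_ne_y _ _ h.symm
      · obtain rfl := hH.y_inj _ _ h
        rw [hi] at h1
        have : y i ∈ s(x' i, y' i) := h1 ▸ Sym2.mem_mk_right _ _
        rcases Sym2.mem_iff.1 this with h | h
        · exact hH.y_ne_x' _ _ h
        · exact hH.y_ne_y' _ _ h
    · rw [h1] at hk
      rcases Sym2.mem_iff.1 hk with h | h
      · exact hH.y_ne_x' _ _ h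
      · exact hH.y_ne_y' _ _ h
  by_cases hcov : ∀ i, v₀ ∉ removed x y x' y' Q i
  · exact ⟨v₀, hv₀, hcov, rfl⟩
  push Not at hcov
  obtain ⟨i, hi⟩ := hcov
  rcases removed_cases (x := x) (y := y) (x' := x') (y' := y') Q i with ⟨-, h1⟩ | ⟨-, h1⟩
  · rw [h1] at hi
    rcases Sym2.mem_iff.1 hi with rfl | rfl
    -- If `x i` is covered by a removed edge, its partner `x' i` serves, unless a removed inner edge
    -- `j` with `x' j = x' i` covers it. In that case `x j` is uncovered and has the same image.
    · by_cases hcov : ∀ k, x' i ∉ removed x y x' y' Q k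
      · exact ⟨x' i, hH.x'_mem_verts i, hcov, by rw [hg.map_x, hH.map_x' hg]⟩
      · push Not at hcov
        obtain ⟨j, hj⟩ := hcov
        rcases removed_cases (x := x) (y := y) (x' := x') (y' := y') Q j with ⟨-, h2⟩ | ⟨-, h2⟩
        · rw [h2] at hj
          rcases Sym2.mem_iff.1 hj with h | h
          · exact absurd h.symm (hH.x_ne_x' _ _)
          · exact absurd h.symm (hH.y_ne_x' _ _)
        · refine ⟨x j, hH.x_mem_verts j, hx j h2, ?_⟩
          rw [h2] at hj
          rcases Sym2.mem_iff.1 hj with h | h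
          · rw [hg.map_x, hg.map_x, h]
          · exact absurd h (hH.x'_ne_y' _ _)
    · refine ⟨y' i, hH.y'_mem_verts i, fun k hk => ?_, by rw [hg.map_y, hH.map_y' hg]⟩
      rcases removed_cases (x := x) (y := y) (x' := x') (y' := y') Q k with ⟨-, h2⟩ | ⟨-, h2⟩
      · rw [h2] at hk
        rcases Sym2.mem_iff.1 hk with h | h
        · exact hH.x_ne_y' _ _ h.symm
        · exact hH.y_ne_y' _ _ h.symm
      · rw [h2] at hk
        rcases Sym2.mem_iff.1 hk with h | h
        · exact hH.x'_ne_y' _ _ h.symm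
        · obtain rfl := hH.y'_inj _ _ h
          rw [h1] at h2
          have : y i ∈ s(x' i, y' i) := h2 ▸ Sym2.mem_mk_right _ _
          rcases Sym2.mem_iff.1 this with h | h
          · exact hH.y_ne_x' _ _ h
          · exact hH.y_ne_y' _ _ h
  · rw [h1] at hi
    rcases Sym2.mem_iff.1 hi with rfl | rfl
    · exact ⟨x i, hH.x_mem_verts i, hx i h1, by rw [hg.map_x, hH.map_x' hg]⟩
    · exact ⟨y i, hH.y_mem_verts i, hy i h1, by rw [hg.map_y, hH.map_y' hg]⟩

/-- By `injOn_uncovered` and `exists_uncovered`, the vertices of the glued graph correspond to the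
vertices that the removed edges leave uncovered. The remaining edges of `Q` match these perfectly.
-/
theorem isGluedMatching_core (hg : IsGluing x y x' y' g) (hQ : H.IsPerfectMatching Q)
    (hm : Meets x y x' y' Q) : IsGluedMatching H x y g (core x y x' y' Q) := by
  refine ⟨fun e he => ?_, fun v₀ hv₀ => ?_⟩
  · obtain ⟨he, he'⟩ := mem_core.1 he
    refine ⟨hQ.1 e he, fun i hi => he' i ?_⟩
    rcases removed_cases (x := x) (y := y) (x' := x') (y' := y') Q i with ⟨-, h2⟩ | ⟨h2, -⟩
    · rw [h2, hi]
    · exact absurd (hi ▸ he) h2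
  · have unc : ∀ {e v}, e ∈ core x y x' y' Q → v ∈ e → ∀ i, v ∉ removed x y x' y' Q i := by
      intro e v he hv i hi
      obtain ⟨he, he'⟩ := mem_core.1 he
      exact he' i (hH.eq_of_mem hQ he (removed_mem hm i) hv hi)
    obtain ⟨v, hv, hcov, hgv⟩ := hH.exists_uncovered (Q := Q) hg hv₀
    obtain ⟨e, he, hve⟩ := hH.exists_mem hQ hv
    have hec : e ∈ core x y x' y' Q := mem_core.2 ⟨he, fun i hi => hcov i (hi ▸ hve)⟩
    refine ⟨e, ⟨hec, v, hve, hgv⟩, ?_⟩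
    rintro f ⟨hf, w, hwf, hgw⟩
    have := hH.injOn_uncovered hg hQ hm (unc hf hwf) (unc hec hve) (hgw.trans hgv.symm)
    subst this
    exact hH.eq_of_mem hQ (mem_core.1 hf).1 he hwf hve

/-- Counting the edges over each glued vertex shows which cut edges of `Q` are missing from `P`. The
delicate case is the one in which `x' false` and `x' true` coincide, so that three vertices become
one. -/
theorem meets_and_eq_core (hg : IsGluing x y x' y' g) (hQ : H.IsPerfectMatching Q)
    (hP : IsGluedMatching H x y g P) (hPQ : P ⊆ Q)
    (hcut : ∀ e ∈ Q, e ∉ P → ∃ i, e = s(x i, y i) ∨ e = s(x' i, y' i)) :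
    Meets x y x' y' Q ∧ P = core x y x' y' Q := by
  have uniq : ∀ {e f v w}, e ∈ P → f ∈ P → v ∈ e → w ∈ f → g v = g w → e = f := by
    intro e f v w he hf hv hw h
    exact (hP.2 v (hH.mem_verts e (hP.1 e he).1 v hv)).unique ⟨he, v, hv, rfl⟩ ⟨hf, w, hw, h.symm⟩
  have not_mem : ∀ i, s(x i, y i) ∉ P := fun i h => (hP.1 _ h).2 i rfl
  have x_edge : ∀ i, s(x i, y i) ∉ Q → ∃ e ∈ P, x i ∈ e := by
    intro i hi
    obtain ⟨e, he, hxe⟩ := hH.exists_mem hQ (hH.x_mem_verts i)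
    refine ⟨e, ?_, hxe⟩
    by_contra heP
    obtain ⟨j, rfl | rfl⟩ := hcut e he heP
    · rcases Sym2.mem_iff.1 hxe with h | h
      · obtain rfl := hH.x_inj _ _ h
        exact hi he
      · exact hH.x_ne_y _ _ h
    · rcases Sym2.mem_iff.1 hxe with h | h
      · exact hH.x_ne_x' _ _ h
      · exact hH.x_ne_y' _ _ h
  -- The glued vertex of `y i` must be covered by `P`. Over `y i` this would need the outer edge,
  -- which is not an edge of the glued graph, so the inner edge is kept.
  have mem' : ∀ i, s(x i, y i) ∈ Q → s(x' i, y' i) ∈ Q → s(x' i, y' i) ∈ P := by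
    intro i hi hi'
    obtain ⟨e, ⟨he, w, hw, hgw⟩, -⟩ := hP.2 _ (hH.y_mem_verts i)
    rw [hg.map_y] at hgw
    rcases hH.eq_or_eq_of_map_eq_y' hg hgw with rfl | rfl
    · have := hH.eq_of_mem hQ (hPQ he) hi hw (by simp)
      exact absurd (this ▸ he) (not_mem i)
    · have := hH.eq_of_mem hQ (hPQ he) hi' hw (by simp)
      exact this ▸ he
  -- Otherwise the inner edge and the edge of `P` at `x i` would both cover the same glued vertex.
  have not_mem' : ∀ i, s(x i, y i) ∉ Q → s(x' i, y' i) ∉ P := by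
    intro i hi hi'
    obtain ⟨e, he, hxe⟩ := x_edge i hi
    have := uniq he hi' hxe (Sym2.mem_mk_left _ _) (by rw [hg.map_x, hH.map_x' hg])
    subst this
    exact hH.far _ (hP.1 _ he).1 i i hxe (by simp)
  have meets : Meets x y x' y' Q := by
    intro i
    by_contra hcon
    push Not at hcon
    obtain ⟨e, he, hxe⟩ := x_edge i hcon.1
    obtain ⟨f, hf, hxf⟩ := hH.exists_mem hQ (hH.x'_mem_verts i)
    have hfP : f ∉ P := by
      intro hfP
      have := uniq he hfP hxe hxf (by rw [hg.map_x, hH.map_x' hg])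
      subst this
      exact hH.far _ (hP.1 _ he).1 i i hxe hxf
    obtain ⟨j, rfl | rfl⟩ := hcut f hf hfP
    · rcases Sym2.mem_iff.1 hxf with h | h
      · exact hH.x_ne_x' _ _ h.symm
      · exact hH.y_ne_x' _ _ h.symm
    · rcases Sym2.mem_iff.1 hxf with h | h
      -- The edge at `x' i` can only be the other inner edge, so `x' i = x' j`. Either that inner
      -- edge is kept in `P`, or `P` has edges at both `x i` and `x j` over this one glued vertex;
      -- the latter is impossible by `far'`.
      · have hij : i ≠ j := by
          rintro rfl
          exact hcon.2 hf
        by_cases hj : s(x j, y j) ∈ Q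
        · exact hfP (mem' j hj hf)
        · obtain ⟨k, hk, hxk⟩ := x_edge j hj
          have := uniq he hk hxe hxk (by rw [hg.map_x, hg.map_x, h])
          subst this
          exact hH.far' _ (hP.1 _ he).1 i j hij hxe hxk
      · exact hH.x'_ne_y' _ _ h
  refine ⟨meets, ?_⟩
  ext e
  rw [mem_core]
  constructor
  · refine fun he => ⟨hPQ he, fun i hi => ?_⟩
    rcases removed_cases (x := x) (y := y) (x' := x') (y' := y') Q i with ⟨-, h2⟩ | ⟨h1, h2⟩
    · rw [hi, h2] at he
      exact not_mem i he
    · rw [hi, h2] at he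
      exact not_mem' i h1 he
  · rintro ⟨he, he'⟩
    by_contra heP
    obtain ⟨j, rfl | rfl⟩ := hcut e he heP
    · refine he' j ?_
      rw [removed, if_pos he]
    · by_cases hj : s(x j, y j) ∈ Q
      · exact heP (mem' j hj he)
      · refine he' j ?_
        rw [removed, if_neg hj]

/-- The core remembers which edges were removed. If the outer edge `i` were in `Q` but not in `Q'`,
the edge of `Q'` at `x i` would survive in the common core, hence lie in `Q`, where `x i` is already
covered by the outer edge. -/
theorem core_injective (hQ : H.IsPerfectMatching Q) (hQ' : H.IsPerfectMatching Q')
    (hm : Meets x y x' y' Q) (hm' : Meets x y x' y' Q')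
    (h : core x y x' y' Q = core x y x' y' Q') : Q = Q' := by
  have key : ∀ {Q Q'}, H.IsPerfectMatching Q → H.IsPerfectMatching Q' →
      core x y x' y' Q = core x y x' y' Q' → ∀ i, s(x i, y i) ∈ Q → s(x i, y i) ∈ Q' := by
    intro Q Q' hQ hQ' h i hi
    by_contra hi'
    obtain ⟨e, he, hxe⟩ := hH.exists_mem hQ' (hH.x_mem_verts i)
    have hec : e ∈ core x y x' y' Q' := by
      refine mem_core.2 ⟨he, fun k hk => ?_⟩
      rcases removed_cases (x := x) (y := y) (x' := x') (y' := y') Q' k with ⟨h1, h2⟩ | ⟨-, h2⟩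
      · rw [hk, h2] at hxe
        rcases Sym2.mem_iff.1 hxe with h | h
        · obtain rfl := hH.x_inj _ _ h
          exact hi' h1
        · exact hH.x_ne_y _ _ h
      · rw [hk, h2] at hxe
        rcases Sym2.mem_iff.1 hxe with h | h
        · exact hH.x_ne_x' _ _ h
        · exact hH.x_ne_y' _ _ h
    rw [← h] at hec
    have := hH.eq_of_mem hQ (mem_core.1 hec).1 hi hxe (by simp)
    exact hi' (this ▸ he)
  have hrem : ∀ i, removed x y x' y' Q i = removed x y x' y' Q' i := by
    intro i
    have : s(x i, y i) ∈ Q ↔ s(x i, y i) ∈ Q' := ⟨key hQ hQ' h i, key hQ' hQ h.symm i⟩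
    by_cases hi : s(x i, y i) ∈ Q
    · rw [removed, removed, if_pos hi, if_pos (this.1 hi)]
    · rw [removed, removed, if_neg hi, if_neg fun h' => hi (this.2 h')]
  have key2 : ∀ {Q Q'}, Meets x y x' y' Q' → core x y x' y' Q = core x y x' y' Q' →
      (∀ i, removed x y x' y' Q i = removed x y x' y' Q' i) → Q ⊆ Q' := by
    intro Q Q' hm' h hrem e he
    by_cases hr : ∃ i, e = removed x y x' y' Q i
    · obtain ⟨i, rfl⟩ := hr
      rw [hrem]
      exact removed_mem hm' i
    · push Not at hr
      have := mem_core.2 ⟨he, hr⟩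
      rw [h] at this
      exact (mem_core.1 this).1
  exact Subset.antisymm (key2 hm' h hrem) (key2 hm h.symm fun i => (hrem i).symm)

theorem removed_ne (Q : Finset (Sym2 V)) :
    removed x y x' y' Q true ≠ removed x y x' y' Q false := by
  intro h
  rcases removed_cases (x := x) (y := y) (x' := x') (y' := y') Q true with ⟨-, h1⟩ | ⟨-, h1⟩ <;>
  rcases removed_cases (x := x) (y := y) (x' := x') (y' := y') Q false with ⟨-, h2⟩ | ⟨-, h2⟩ <;>
  rw [h1, h2, Sym2.eq_iff] at h
  · rcases h with h | h
    · simpa using hH.x_inj _ _ h.1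
    · exact hH.x_ne_y _ _ h.1
  · rcases h with h | h
    · exact hH.x_ne_x' _ _ h.1
    · exact hH.x_ne_y' _ _ h.1
  · rcases h with h | h
    · exact hH.x_ne_x' _ _ h.1.symm
    · exact hH.y_ne_x' _ _ h.1.symm
  · rcases h with h | h
    · simpa using hH.y'_inj _ _ h.2
    · exact hH.x'_ne_y' _ _ h.1

/-- Whichever edge of a glued pair is removed, its weight is that of the outer edge. -/
theorem prod_core {K : Type*} [CommMonoid K] (hm : Meets x y x' y' Q) (w : Sym2 V → K)
    (hw : ∀ i, w s(x' i, y' i) = w s(x i, y i)) :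
    (∏ e ∈ core x y x' y' Q, w e) * (w s(x false, y false) * w s(x true, y true)) =
      ∏ e ∈ Q, w e := by
  classical
  have hr : ∀ i, w (removed x y x' y' Q i) = w s(x i, y i) := by
    intro i
    rcases removed_cases (x := x) (y := y) (x' := x') (y' := y') Q i with ⟨-, h1⟩ | ⟨-, h1⟩
    · rw [h1]
    · rw [h1, hw]
  rw [← mul_prod_erase Q w (removed_mem hm false), ← mul_prod_erase (Q.erase _) w
    (mem_erase.2 ⟨hH.removed_ne Q, removed_mem hm true⟩), hr, hr, ← mul_assoc]
  have hcore : core x y x' y' Q =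
      (Q.erase (removed x y x' y' Q false)).erase (removed x y x' y' Q true) := by
    ext e
    rw [mem_core, mem_erase, mem_erase, Bool.forall_bool]
    tauto
  rw [hcore]
  ac_rfl

end IsCutting

/-! ### Good matchings of a loop graph -/

namespace LoopGraph

variable {L : Type*} {B : LoopGraph L}

/-- The vertices `x` of the glued edges at the two ends. -/
def endX (B : LoopGraph L) (i : Bool) : LatticePt := cond i B.x₂ B.x₁
/-- The vertices `y` of the glued edges at the two ends. -/
def endY (B : LoopGraph L) (i : Bool) : LatticePt := cond i B.y₂ B.y₁
/-- The vertices `x'` of the glued edges in the interior; the vertices `y'` are `innerY`. -/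
def innerX (B : LoopGraph L) (i : Bool) : LatticePt := cond i B.x₂' B.x₁'

def innerY (B : LoopGraph L) (i : Bool) : LatticePt := cond i B.y₂' B.y₁'

theorem c₁_eq (B : LoopGraph L) : B.c₁ = s(B.x₁, B.y₁) := by
  rw [c₁, x₁, y₁, SnakeGraph.edge_eq]
  rcases B.cut₁_mem with h | h <;> rw [h] <;> rfl

theorem c₂_eq (B : LoopGraph L) : B.c₂ = s(B.x₂, B.y₂) := by
  rw [c₂, x₂, y₂, SnakeGraph.edge_eq]
  rcases B.cut₂_mem with h | h <;> rw [h] <;> exact Sym2.eq_swap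

theorem freeSide₁_cases (G : SnakeGraph L) (k : ℕ) :
    G.freeSide₁ k = .S ∨ G.freeSide₁ k = .W := by
  rw [SnakeGraph.freeSide₁]; split_ifs <;> simp

theorem freeSide₂_cases (G : SnakeGraph L) (k : ℕ) :
    G.freeSide₂ k = .N ∨ G.freeSide₂ k = .E := by
  rw [SnakeGraph.freeSide₂]; split_ifs <;> simp

theorem c₁'_eq (B : LoopGraph L) : B.c₁' = s(B.x₁', B.y₁') := by
  rw [c₁', x₁', y₁', SnakeGraph.edge_eq]
  rcases freeSide₁_cases B.snake B.k₁ with h | h <;> rw [h] <;> exact Sym2.eq_swap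

theorem c₂'_eq (B : LoopGraph L) : B.c₂' = s(B.x₂', B.y₂') := by
  rw [c₂', x₂', y₂', SnakeGraph.edge_eq]
  rcases freeSide₂_cases B.snake B.k₂ with h | h <;> rw [h] <;> rfl

theorem mem_verts_of_mem_edges {G : SnakeGraph L} {e : Sym2 LatticePt}
    (he : e ∈ G.graph.edges) {v : LatticePt} (hv : v ∈ e) : v ∈ G.graph.verts := by
  obtain ⟨a, b, rfl, ha, hb, -⟩ := SnakeGraph.exists_of_mem_edges he
  rcases Sym2.mem_iff.1 hv with rfl | rfl <;> assumption

theorem level_of_mem_edges {G : SnakeGraph L} {e : Sym2 LatticePt}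
    (he : e ∈ G.graph.edges) {v w : LatticePt} (hv : v ∈ e) (hw : w ∈ e) :
    latticeLevel w ≤ latticeLevel v + 1 := by
  obtain ⟨a, b, rfl, -, -, h⟩ := SnakeGraph.exists_of_mem_edges he
  have : latticeLevel b = latticeLevel a + 1 := by
    rcases h with rfl | rfl <;> simp [latticeLevel_add]
  rcases Sym2.mem_iff.1 hv with rfl | rfl <;> rcases Sym2.mem_iff.1 hw with rfl | rfl <;> omega

theorem levels (h2 : B.k₂ + 3 ≤ B.snake.numTiles) :
    ∃ b : ℤ, latticeLevel B.x₁ = b ∧ latticeLevel B.y₁ = b + 1 ∧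
      latticeLevel B.y₁' = b + B.k₁ ∧ latticeLevel B.x₁' = b + B.k₁ + 1 ∧
      latticeLevel B.x₂' = b + B.k₂ + 1 ∧ latticeLevel B.y₂' = b + B.k₂ + 2 ∧
      latticeLevel B.y₂ = b + B.snake.numTiles ∧
      latticeLevel B.x₂ = b + B.snake.numTiles + 1 := by
  have hk := B.k₁_le
  have l1 := B.snake.level_corner (j := B.k₁) (by omega)
  have l2 := B.snake.level_corner (j := B.k₂) (by omega)
  have l3 := B.snake.level_corner (j := B.last) (by rw [last]; omega)
  have l4 : (B.last : ℤ) = B.snake.numTiles - 1 := by rw [last]; omega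
  refine ⟨latticeLevel (B.snake.corner 0), ?_⟩
  simp only [x₁, y₁, x₁', y₁', x₂, y₂, x₂', y₂', SnakeGraph.sw, SnakeGraph.se, SnakeGraph.nw,
    SnakeGraph.ne, apply_ite latticeLevel, latticeLevel_add, latticeLevel_east,
    latticeLevel_north, latticeLevel_diag, ite_self, l1, l2, l3, l4]
  refine ⟨trivial, trivial, trivial, trivial, trivial, trivial, ?_, ?_⟩ <;> ring

/-- Everything follows from the levels. The bound `2 ≤ k₁` puts the level `k₁` of `y₁'` above that
of `y₁`, and `k₂ + 3 ≤ numTiles` puts the level of `y₂` above the level `k₂ + 2` of `y₂'`. If `k₁ =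
k₂`, then `x₁'` and `x₂'` are on the same level, so nothing separates them. -/
theorem isCutting (h1 : 2 ≤ B.k₁) (h2 : B.k₂ + 3 ≤ B.snake.numTiles) :
    IsCutting B.snake.graph B.endX B.endY B.innerX B.innerY := by
  obtain ⟨b, e1, e2, e3, e4, e5, e6, e7, e8⟩ := levels h2
  have hk := B.k₁_le
  have lx : ∀ i, latticeLevel (B.endX i) = cond i (b + B.snake.numTiles + 1) b := by
    rintro (_ | _) <;> assumption
  have ly : ∀ i, latticeLevel (B.endY i) = cond i (b + B.snake.numTiles) (b + 1) := by
    rintro (_ | _) <;> assumption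
  have lx' : ∀ i, latticeLevel (B.innerX i) = cond i (b + B.k₂ + 1) (b + B.k₁ + 1) := by
    rintro (_ | _) <;> assumption
  have ly' : ∀ i, latticeLevel (B.innerY i) = cond i (b + B.k₂ + 2) (b + B.k₁) := by
    rintro (_ | _) <;> assumption
  have ne : ∀ {v w : LatticePt}, latticeLevel v ≠ latticeLevel w → v ≠ w := by
    rintro v w h rfl
    exact h rfl
  constructor
  · exact fun e v => Iff.rfl
  · exact fun e he v hv => mem_verts_of_mem_edges he hv
  · rintro (_ | _)
    · exact ⟨0, by omega, B.cut₁, B.c₁_eq.symm⟩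
    · exact ⟨B.last, by rw [last]; omega, B.cut₂, B.c₂_eq.symm⟩
  · rintro (_ | _)
    · exact ⟨B.k₁, by omega, _, B.c₁'_eq.symm⟩
    · exact ⟨B.k₂, by omega, _, B.c₂'_eq.symm⟩
  · intro i j
    apply ne
    rw [lx, ly]
    cases i <;> cases j <;> simp only [cond_true, cond_false] <;> omega
  · intro i j
    apply ne
    rw [lx, lx']
    cases i <;> cases j <;> simp only [cond_true, cond_false] <;> omega
  · intro i j
    apply ne
    rw [lx, ly']
    cases i <;> cases j <;> simp only [cond_true, cond_false] <;> omega
  · intro i j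
    apply ne
    rw [ly, lx']
    cases i <;> cases j <;> simp only [cond_true, cond_false] <;> omega
  · intro i j
    apply ne
    rw [ly, ly']
    cases i <;> cases j <;> simp only [cond_true, cond_false] <;> omega
  · intro i j
    apply ne
    rw [lx', ly']
    cases i <;> cases j <;> simp only [cond_true, cond_false] <;> omega
  · intro i j h
    have := congrArg latticeLevel h
    rw [lx, lx] at this
    cases i <;> cases j <;> simp only [cond_true, cond_false] at this ⊢ <;> omega
  · intro i j h
    have := congrArg latticeLevel h
    rw [ly, ly] at this
    cases i <;> cases j <;> simp only [cond_true, cond_false] at this ⊢ <;> omega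
  · intro i j h
    have := congrArg latticeLevel h
    rw [ly', ly'] at this
    cases i <;> cases j <;> simp only [cond_true, cond_false] at this ⊢ <;> omega
  · intro e he i j hi hj
    have l1 := level_of_mem_edges he hi hj
    have l2 := level_of_mem_edges he hj hi
    rw [lx, lx'] at l1 l2
    cases i <;> cases j <;> simp only [cond_true, cond_false] at l1 l2 <;> omega
  · intro e he i j hij hi hj
    have l1 := level_of_mem_edges he hi hj
    have l2 := level_of_mem_edges he hj hi
    rw [lx, lx] at l1 l2
    cases i <;> cases j <;> simp only [cond_true, cond_false, ne_eq, not_true_eq_false] at *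
      <;> omega

theorem glueEdge_eq (hl₁ : B.HasLoop₁) (hl₂ : B.HasLoop₂) (e : Sym2 LatticePt) [Decidable (e = B.c₁)]
    [Decidable (e = B.c₂)] :
    B.glueEdge e = if e = B.c₁ then B.c₁' else if e = B.c₂ then B.c₂' else e := by
  simp only [glueEdge, hl₁, hl₂, true_and]

theorem isGluing (hl₁ : B.HasLoop₁) (hl₂ : B.HasLoop₂)
    (hH : IsCutting B.snake.graph B.endX B.endY B.innerX B.innerY) :
    IsCutting.IsGluing B.endX B.endY B.innerX B.innerY B.glueVert := by
  have hxy : ∀ i j, B.endX i ≠ B.endY j := hH.x_ne_y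
  have hxx : B.x₂ ≠ B.x₁ := fun h => by simpa using hH.x_inj true false h
  have hyy : B.y₂ ≠ B.y₁ := fun h => by simpa using hH.y_inj true false h
  have h1 : B.y₁ ≠ B.x₁ := (hxy false false).symm
  have h2 : B.x₂ ≠ B.y₁ := hxy true false
  have h3 : B.y₂ ≠ B.x₁ := (hxy false true).symm
  have h4 : B.y₂ ≠ B.x₂ := (hxy true true).symm
  constructor
  · rintro (_ | _) <;> simp [endX, innerX, glueVert, hl₁, hl₂, hxx, h2]
  · rintro (_ | _) <;> simp [endY, innerY, glueVert, hl₁, hl₂, h1, h3, h4, hyy]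
  · intro v hx hy
    have a1 : v ≠ B.x₁ := hx false
    have a2 : v ≠ B.x₂ := hx true
    have a3 : v ≠ B.y₁ := hy false
    have a4 : v ≠ B.y₂ := hy true
    simp [glueVert, a1, a2, a3, a4]

/-- As `c₁'` and `c₂'` represent the glued edges, the edges of the loop graph are those of the snake
graph other than `c₁` and `c₂`. Incidence only has to be read modulo `glueVert`. -/
theorem isPerfectMatching_iff (hl₁ : B.HasLoop₁) (hl₂ : B.HasLoop₂)
    (hH : IsCutting B.snake.graph B.endX B.endY B.innerX B.innerY) {P : Finset (Sym2 LatticePt)} :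
    B.graph.IsPerfectMatching P ↔
      IsCutting.IsGluedMatching B.snake.graph B.endX B.endY B.glueVert P := by
  classical
  have hg := isGluing hl₁ hl₂ hH
  have hc : ∀ i, s(B.endX i, B.endY i) = cond i B.c₂ B.c₁ := by
    rintro (_ | _)
    · exact B.c₁_eq.symm
    · exact B.c₂_eq.symm
  have hc' : ∀ i, s(B.innerX i, B.innerY i) = cond i B.c₂' B.c₁' := by
    rintro (_ | _)
    · exact B.c₁'_eq.symm
    · exact B.c₂'_eq.symm
  have hne : ∀ i j, cond i B.c₂' B.c₁' ≠ cond j B.c₂ B.c₁ := by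
    intro i j h
    rw [← hc, ← hc', Sym2.eq_iff] at h
    rcases h with h | h
    · exact hH.x_ne_x' _ _ h.1.symm
    · exact hH.y_ne_x' _ _ h.1.symm
  have hedge : ∀ e, e ∈ B.graph.edges ↔
      e ∈ B.snake.graph.edges ∧ ∀ i, e ≠ s(B.endX i, B.endY i) := by
    intro e
    simp only [hc]
    constructor
    · rintro ⟨f, hf, rfl⟩
      rw [glueEdge_eq hl₁ hl₂]
      split_ifs with h1 h2
      · exact ⟨B.c₁'_eq ▸ hH.mem_edges' false, fun i => hne false i⟩
      · exact ⟨B.c₂'_eq ▸ hH.mem_edges' true, fun i => hne true i⟩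
      · refine ⟨hf, ?_⟩
        rintro (_ | _) <;> assumption
    · rintro ⟨he, hne⟩
      have h1 : e ≠ B.c₁ := hne false
      have h2 : e ≠ B.c₂ := hne true
      exact ⟨e, he, by rw [glueEdge_eq hl₁ hl₂, if_neg h1, if_neg h2]⟩
  have hinc : ∀ e v', e ∈ B.graph.edges → (B.graph.Inc e v' ↔ ∃ w ∈ e, B.glueVert w = v') := by
    intro e v' he
    obtain ⟨he, hne'⟩ := (hedge e).1 he
    simp only [hc] at hne'
    have h1 : e ≠ B.c₁ := hne' false
    have h2 : e ≠ B.c₂ := hne' true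
    constructor
    · rintro ⟨f, hf, v, -, hv, rfl, rfl⟩
      rw [glueEdge_eq hl₁ hl₂]
      -- Incidences inherited from an outer edge add nothing: the ends of the inner edge have the
      -- same images.
      have swap : ∀ i, v ∈ s(B.endX i, B.endY i) →
          ∃ w ∈ s(B.innerX i, B.innerY i), B.glueVert w = B.glueVert v := by
        intro i hv
        rcases Sym2.mem_iff.1 hv with rfl | rfl
        · exact ⟨_, Sym2.mem_mk_left _ _, by rw [hg.map_x, hH.map_x' hg]⟩
        · exact ⟨_, Sym2.mem_mk_right _ _, by rw [hg.map_y, hH.map_y' hg]⟩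
      change v ∈ f at hv
      split_ifs with h3 h4
      · have := swap false (by rw [hc]; exact h3 ▸ hv)
        rwa [hc'] at this
      · have := swap true (by rw [hc]; exact h4 ▸ hv)
        rwa [hc'] at this
      · exact ⟨v, hv, rfl⟩
    · rintro ⟨w, hw, rfl⟩
      exact ⟨e, he, w, hH.mem_verts e he w hw, hw,
        by rw [glueEdge_eq hl₁ hl₂, if_neg h1, if_neg h2], rfl⟩
  constructor
  · rintro ⟨hP, hv⟩
    refine ⟨fun e he => (hedge e).1 (hP e he), fun v hvv => ?_⟩
    refine (existsUnique_congr fun e => and_congr_right fun he => ?_).1 (hv _ ⟨v, hvv, rfl⟩)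
    exact hinc e _ (hP e he)
  · rintro ⟨hP, hv⟩
    refine ⟨fun e he => (hedge e).2 (hP e he), ?_⟩
    rintro _ ⟨v, hvv, rfl⟩
    refine (existsUnique_congr fun e => and_congr_right fun he => ?_).2 (hv v hvv)
    exact hinc e _ ((hedge e).2 (hP e he))

/-- The perfect matchings of the snake graph which meet both pairs of glued edges. -/
def Meets (B : LoopGraph L) (Q : Finset (Sym2 LatticePt)) : Prop :=
  (B.c₁ ∈ Q ∨ B.c₁' ∈ Q) ∧ (B.c₂ ∈ Q ∨ B.c₂' ∈ Q)

/-- The set of edges of the loop graph given by a perfect matching of the snake graph. -/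
noncomputable def core (B : LoopGraph L) (Q : Finset (Sym2 LatticePt)) : Finset (Sym2 LatticePt) :=
  IsCutting.core B.endX B.endY B.innerX B.innerY Q

theorem meets_iff {Q : Finset (Sym2 LatticePt)} :
    B.Meets Q ↔ IsCutting.Meets B.endX B.endY B.innerX B.innerY Q := by
  rw [IsCutting.Meets, Bool.forall_bool, Meets, c₁_eq, c₁'_eq, c₂_eq, c₂'_eq]
  rfl

theorem isCutEdge_iff (hl₁ : B.HasLoop₁) (hl₂ : B.HasLoop₂) {e : Sym2 LatticePt} :
    B.IsCutEdge e ↔ ∃ i, e = s(B.endX i, B.endY i) ∨ e = s(B.innerX i, B.innerY i) := by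
  rw [IsCutEdge, Bool.exists_bool, c₁_eq, c₁'_eq, c₂_eq, c₂'_eq]
  simp only [hl₁, hl₂, true_and]
  rfl

section Good

variable (h1 : 2 ≤ B.k₁) (h2 : B.k₂ + 3 ≤ B.snake.numTiles)
include h1 h2

theorem hasLoops : B.HasLoop₁ ∧ B.HasLoop₂ := by
  constructor
  · rw [HasLoop₁]; omega
  · rw [HasLoop₂, last]; omega

theorem extends_core {Q : Finset (Sym2 LatticePt)} (hQ : B.snake.graph.IsPerfectMatching Q)
    (hm : B.Meets Q) : B.graph.IsPerfectMatching (B.core Q) ∧ B.Extends (B.core Q) Q := by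
  obtain ⟨hl₁, hl₂⟩ := hasLoops h1 h2
  have hH := isCutting h1 h2
  have hm := meets_iff.1 hm
  refine ⟨(isPerfectMatching_iff hl₁ hl₂ hH).2
    (hH.isGluedMatching_core (isGluing hl₁ hl₂ hH) hQ hm), hQ,
    fun e he => (IsCutting.mem_core.1 he).1, fun e he he' => ?_⟩
  rw [isCutEdge_iff hl₁ hl₂]
  by_contra hcon
  push Not at hcon
  refine he' (IsCutting.mem_core.2 ⟨he, fun i hi => ?_⟩)
  rcases IsCutting.removed_cases (x := B.endX) (y := B.endY) (x' := B.innerX) (y' := B.innerY) Q i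
    with ⟨-, h⟩ | ⟨-, h⟩
  · exact (hcon i).1 (hi.trans h)
  · exact (hcon i).2 (hi.trans h)

theorem meets_and_eq_core {P Q : Finset (Sym2 LatticePt)} (hP : B.graph.IsPerfectMatching P)
    (hPQ : B.Extends P Q) : B.Meets Q ∧ P = B.core Q := by
  obtain ⟨hl₁, hl₂⟩ := hasLoops h1 h2
  have hH := isCutting h1 h2
  rw [meets_iff]
  exact hH.meets_and_eq_core (isGluing hl₁ hl₂ hH) hPQ.1
    ((isPerfectMatching_iff hl₁ hl₂ hH).1 hP) hPQ.2.1
    fun e he he' => (isCutEdge_iff hl₁ hl₂).1 (hPQ.2.2 e he he')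

theorem core_injective {Q Q' : Finset (Sym2 LatticePt)}
    (hQ : B.snake.graph.IsPerfectMatching Q) (hQ' : B.snake.graph.IsPerfectMatching Q')
    (hm : B.Meets Q) (hm' : B.Meets Q') (h : B.core Q = B.core Q') : Q = Q' :=
  (isCutting h1 h2).core_injective hQ hQ' (meets_iff.1 hm) (meets_iff.1 hm') h

theorem weightProd_core {K : Type*} [CommMonoid K] {Q : Finset (Sym2 LatticePt)}
    (hm : B.Meets Q) (w : L → K)
    (hw₁ : B.snake.label B.k₁ (B.snake.freeSide₁ B.k₁) = B.snake.label 0 B.cut₁)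
    (hw₂ : B.snake.label B.k₂ (B.snake.freeSide₂ B.k₂) = B.snake.label B.last B.cut₂) :
    B.snake.weightProd w (B.core Q) *
        (w (B.snake.label 0 B.cut₁) * w (B.snake.label B.last B.cut₂)) =
      B.snake.weightProd w Q := by
  have hk := B.k₁_le
  have e1 : B.snake.edgeWeight w B.c₁ = w (B.snake.label 0 B.cut₁) :=
    B.snake.edgeWeight_edge w (by omega) _
  have e2 : B.snake.edgeWeight w B.c₂ = w (B.snake.label B.last B.cut₂) :=
    B.snake.edgeWeight_edge w (by rw [last]; omega) _
  have e3 : B.snake.edgeWeight w B.c₁' = w (B.snake.label 0 B.cut₁) :=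
    (B.snake.edgeWeight_edge w (by omega) _).trans (congrArg w hw₁)
  have e4 : B.snake.edgeWeight w B.c₂' = w (B.snake.label B.last B.cut₂) :=
    (B.snake.edgeWeight_edge w (by omega) _).trans (congrArg w hw₂)
  rw [← e1, ← e2, c₁_eq, c₂_eq]
  refine (isCutting h1 h2).prod_core (meets_iff.1 hm) (B.snake.edgeWeight w) ?_
  rintro (_ | _)
  · exact (B.c₁'_eq ▸ e3).trans (B.c₁_eq ▸ e1).symm
  · exact (B.c₂'_eq ▸ e4).trans (B.c₂_eq ▸ e2).symm

end Good

end LoopGraph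

/-- Used for sign triples that parametrize both sets of matchings. Signs with indices beyond the
tiles are irrelevant, so neither parametrization is injective; it suffices that both have the same
fibres. -/
theorem exists_equiv_of_surjective {D A B : Type*} {f : D → A} {g : D → B}
    (hf : Function.Surjective f) (hg : Function.Surjective g)
    (h : ∀ d d', f d = f d' ↔ g d = g d') : ∃ Φ : A ≃ B, ∀ d, Φ (f d) = g d := by
  have key : ∀ d, g (hf (f d)).choose = g d := fun d => (h _ _).1 (hf (f d)).choose_spec
  refine ⟨Equiv.ofBijective (fun x => g (hf x).choose) ⟨fun x y hxy => ?_, fun z => ?_⟩, key⟩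
  · have := (h _ _).2 hxy
    rwa [(hf x).choose_spec, (hf y).choose_spec] at this
  · obtain ⟨d, rfl⟩ := hg z
    exact ⟨f d, key d⟩

namespace IdealTriangulation

variable {Tri : Type*} {T : IdealTriangulation Tri}

/-- If the degree were one, the corner would be fixed by `rotate`, which says that the two sides
meeting there are glued to each other. -/
theorem two_le_degree {c : TriSide Tri} (h : T.IsPuncture c) (hc : ¬ T.IsFoldedCorner c) :
    2 ≤ T.degree c := by
  by_contra hd
  have h1 : T.degree c = 1 := by
    have := degree_pos h
    omega
  have h2 : T.rotate c = c := Function.minimalPeriod_eq_one_iff_isFixedPt.1 h1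
  refine hc (Prod.ext (show (T.rotate c).1 = c.1 from congrArg Prod.fst h2) ?_)
  have h3 : (T.glue (c.1, c.2 + 1)).2 + 1 = c.2 := congrArg Prod.snd h2
  exact (by decide : ∀ x y : ZMod 3, x + 1 = y → x = y + 2) _ _ h3

namespace Curve

theorem loopBits_congr {γ : T.Curve} {s : Sense} {a u a' u' : ℕ → Bool}
    (ha : ∀ j < γ.len, a j = a' j) (hu : ∀ j < T.degree γ.finish, u j = u' j) (j : ℕ)
    (hj : j < γ.len + T.degree γ.finish + γ.len) :
    γ.loopBits s a u j = γ.loopBits s a' u' j := by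
  simp only [loopBits]
  split_ifs with h1 h2
  · exact ha j h1
  · exact turnBits_congr hu (by omega)
  · exact ha _ (by omega)

theorem eq_of_loopBits_eq {γ : T.Curve} {s : Sense} {a u a' u' : ℕ → Bool}
    (h : ∀ j < γ.len + T.degree γ.finish + γ.len, γ.loopBits s a u j = γ.loopBits s a' u' j) :
    (∀ j < γ.len, a j = a' j) ∧ ∀ j < T.degree γ.finish, u j = u' j := by
  constructor
  · intro j hj
    have := h j (by omega)
    rwa [loopBits_first hj, loopBits_first hj] at this
  · refine eq_of_turnBits_eq (s := s) fun j hj => ?_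
    have := h (γ.len + j) (by omega)
    rwa [loopBits_turn hj, loopBits_turn hj] at this

/-! ### Tile sides by position -/

theorem ofDir_dir (ε : ℤˣ) (σ : Slot) : Slot.ofDir ε (σ.dir ε) = σ := by
  by_cases h : ε = 1 <;> cases σ <;> simp [Slot.ofDir, Slot.dir, h]

theorem label_dir (γ : T.Curve) (ε : ℤˣ) (j : ℕ) (σ : Slot) :
    (γ.snakeGraph ε).label j (σ.dir (relOr ε j)) = γ.quadSide j σ := by
  change γ.quadSide j (Slot.ofDir (relOr ε j) (σ.dir (relOr ε j))) = _
  rw [ofDir_dir]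

theorem freeSide₁_eq (γ : T.Curve) (ε : ℤˣ) (j : ℕ) :
    (γ.snakeGraph ε).freeSide₁ (j + 1) =
      (if (γ.cross (j + 1)).2 = (T.glue (γ.cross j)).2 + 1 then Slot.backRight
        else Slot.backLeft).dir (relOr ε (j + 1)) := by
  rw [SnakeGraph.freeSide₁]
  have h := east_iff γ ε j
  have hr := relOr_succ_eq_one ε j
  simp only [snakeGraph, Nat.add_sub_cancel, h]
  by_cases h1 : (γ.cross (j + 1)).2 = (T.glue (γ.cross j)).2 + 1 <;>
    by_cases h2 : relOr ε j = 1 <;> simp [h1, h2, Slot.dir, hr]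

theorem freeSide₂_eq (γ : T.Curve) (ε : ℤˣ) (j : ℕ) :
    (γ.snakeGraph ε).freeSide₂ j =
      (if (γ.cross (j + 1)).2 = (T.glue (γ.cross j)).2 + 1 then Slot.frontRight
        else Slot.frontLeft).dir (relOr ε j) := by
  rw [SnakeGraph.freeSide₂]
  have h := east_iff γ ε j
  simp only [snakeGraph, h]
  by_cases h1 : (γ.cross (j + 1)).2 = (T.glue (γ.cross j)).2 + 1 <;>
    by_cases h2 : relOr ε j = 1 <;> simp [h1, h2, Slot.dir]

/-- The cut is chosen by testing the South side only. When exactly one of the two back sides is `x`,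
this choice finds it in either relative orientation. -/
theorem back_side_eq (γ : T.Curve) (ε : ℤˣ) (j : ℕ) (x : TriSide Tri)
    [Decidable ((γ.snakeGraph ε).label j .S = x)]
    (h : (γ.quadSide j .backLeft = x ↔ γ.quadSide j .backRight ≠ x)) :
    (if (γ.snakeGraph ε).label j .S = x then Dir.S else Dir.W) = (
      open Classical in
      if γ.quadSide j .backLeft = x then Slot.backLeft else Slot.backRight).dir (relOr ε j) := by
  by_cases h1 : relOr ε j = 1
  · have hl : (γ.snakeGraph ε).label j .S = γ.quadSide j .backRight := by
      change γ.quadSide j (Slot.ofDir _ .S) = _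
      rw [Slot.ofDir, if_pos h1]
    by_cases h2 : γ.quadSide j .backLeft = x
    · rw [if_neg (by rw [hl]; exact h.1 h2), if_pos h2, Slot.dir, if_pos h1]
    · rw [if_pos (by rw [hl]; by_contra h3; exact h2 (h.2 h3)), if_neg h2, Slot.dir, if_pos h1]
  · have hl : (γ.snakeGraph ε).label j .S = γ.quadSide j .backLeft := by
      change γ.quadSide j (Slot.ofDir _ .S) = _
      rw [Slot.ofDir, if_neg h1]
    by_cases h2 : γ.quadSide j .backLeft = x
    · rw [if_pos (by rw [hl]; exact h2), if_pos h2, Slot.dir, if_neg h1]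
    · rw [if_neg (by rw [hl]; exact h2), if_neg h2, Slot.dir, if_neg h1]

theorem front_side_eq (γ : T.Curve) (ε : ℤˣ) (j : ℕ) (x : TriSide Tri)
    [Decidable ((γ.snakeGraph ε).label j .N = x)]
    (h : (γ.quadSide j .frontLeft = x ↔ γ.quadSide j .frontRight ≠ x)) :
    (if (γ.snakeGraph ε).label j .N = x then Dir.N else Dir.E) = (
      open Classical in
      if γ.quadSide j .frontLeft = x then Slot.frontLeft else Slot.frontRight).dir (relOr ε j) := by
  by_cases h1 : relOr ε j = 1
  · have hl : (γ.snakeGraph ε).label j .N = γ.quadSide j .frontLeft := by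
      change γ.quadSide j (Slot.ofDir _ .N) = _
      rw [Slot.ofDir, if_pos h1]
    by_cases h2 : γ.quadSide j .frontLeft = x
    · rw [if_pos (by rw [hl]; exact h2), if_pos h2, Slot.dir, if_pos h1]
    · rw [if_neg (by rw [hl]; exact h2), if_neg h2, Slot.dir, if_pos h1]
  · have hl : (γ.snakeGraph ε).label j .N = γ.quadSide j .frontRight := by
      change γ.quadSide j (Slot.ofDir _ .N) = _
      rw [Slot.ofDir, if_neg h1]
    by_cases h2 : γ.quadSide j .frontLeft = x
    · rw [if_neg (by rw [hl]; exact h.1 h2), if_pos h2, Slot.dir, if_neg h1]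
    · rw [if_pos (by rw [hl]; by_contra h3; exact h2 (h.2 h3)), if_neg h2, Slot.dir, if_neg h1]

end Curve

namespace DoublyNotched

open Curve

variable {γ : T.DoublyNotched} {s₁ s₂ : Sense} {ε : ℤˣ} {a u w : ℕ → Bool}

/-! ### The hooked curve -/

/-- The hooked curve. -/
noncomputable abbrev hook (γ : T.DoublyNotched) (s₁ s₂ : Sense) : T.Curve :=
  γ.toCurve.hooked γ.puncture_start γ.puncture_finish s₁ s₂

/-- The signs on the hooked curve with the signs `u`, `a`, `w` on its three parts. -/
noncomputable def hookBits (γ : T.DoublyNotched) (s₁ s₂ : Sense) (a u w : ℕ → Bool) (j : ℕ) :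
    Bool :=
  if j < T.degree γ.start then turnBits s₁ (T.degree γ.start) u j
  else if j < T.degree γ.start + γ.len then a (j - T.degree γ.start)
  else turnBits s₂ (T.degree γ.finish) w (j - (T.degree γ.start + γ.len))

theorem hook_len (γ : T.DoublyNotched) (s₁ s₂ : Sense) :
    (γ.hook s₁ s₂).len = T.degree γ.start + γ.len + T.degree γ.finish := by
  cases s₁ <;> cases s₂ <;> rfl

theorem hookBits_start {j : ℕ} (hj : j < T.degree γ.start) :
    γ.hookBits s₁ s₂ a u w j = turnBits s₁ (T.degree γ.start) u j := if_pos hj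

theorem hookBits_middle {j : ℕ} (hj : j < γ.len) :
    γ.hookBits s₁ s₂ a u w (T.degree γ.start + j) = a j := by
  rw [hookBits, if_neg (by omega), if_pos (by omega), Nat.add_sub_cancel_left]

theorem hookBits_finish (j : ℕ) : γ.hookBits s₁ s₂ a u w (T.degree γ.start + γ.len + j) =
    turnBits s₂ (T.degree γ.finish) w j := by
  rw [hookBits, if_neg (by omega), if_neg (by omega), Nat.add_sub_cancel_left]

theorem hook_cross_start {j : ℕ} (hj : j < T.degree γ.start) :
    (γ.hook s₁ s₂).cross j = (turn γ.start γ.puncture_start s₁).cross j := by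
  have h := turn_len γ.start γ.puncture_start s₁
  rw [hook, hooked, append_cross_left (by
    change j < (turn γ.start γ.puncture_start s₁).len + γ.len; omega),
    append_cross_left (by omega)]

theorem hook_cross_middle {j : ℕ} (hj : j < γ.len) :
    (γ.hook s₁ s₂).cross (T.degree γ.start + j) = γ.cross j := by
  have h := turn_len γ.start γ.puncture_start s₁
  rw [hook, hooked, append_cross_left (by
    change _ < (turn γ.start γ.puncture_start s₁).len + γ.len; omega), ← h, append_cross_right]

theorem hook_cross_finish (j : ℕ) :
    (γ.hook s₁ s₂).cross (T.degree γ.start + γ.len + j) =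
      (turn γ.finish γ.puncture_finish s₂).cross j := by
  have h := turn_len γ.start γ.puncture_start s₁
  rw [hook, hooked, ← h]
  exact append_cross_right _

/-- Each turn of the hooked curve touches `γ` at one end only, so only one of the two bounds in
`TurnOK` appears for it. The other has to come from the gluing. -/
theorem hook_valid : (γ.hook s₁ s₂).Valid (γ.hookBits s₁ s₂ a u w) ↔
    (TurnValid (T.degree γ.start) u ∧ TurnFinishOK s₁ (T.degree γ.start) u (a 0) ∧ γ.Valid a) ∧
      TurnStartOK s₂ (T.degree γ.finish) w (a (γ.len - 1)) ∧ TurnValid (T.degree γ.finish) w := by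
  have h := turn_len γ.start γ.puncture_start s₁
  have h' := turn_len γ.finish γ.puncture_finish s₂
  have hd := degree_pos γ.puncture_start
  have h0 := γ.len_pos
  have hl : ((turn γ.start γ.puncture_start s₁).append γ.toCurve
      ⟨(turn_finish _ γ.puncture_start s₁).1.symm,
        (turn_finish _ γ.puncture_start s₁).2.symm⟩).len = T.degree γ.start + γ.len := by
    rw [← h]
    rfl
  have e1 : γ.hookBits s₁ s₂ a u w (T.degree γ.start - 1) =
      turnBits s₁ (T.degree γ.start) u (T.degree γ.start - 1) := hookBits_start (by omega)
  have e2 : γ.hookBits s₁ s₂ a u w (T.degree γ.start) = a 0 := hookBits_middle (j := 0) h0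
  have e3 : γ.hookBits s₁ s₂ a u w (T.degree γ.start + γ.len - 1) = a (γ.len - 1) := by
    rw [Nat.add_sub_assoc h0, hookBits_middle (by omega)]
  have e4 : γ.hookBits s₁ s₂ a u w (T.degree γ.start + γ.len) =
      turnBits s₂ (T.degree γ.finish) w 0 := hookBits_finish 0
  rw [hook, hooked, valid_append (b := γ.hookBits s₁ s₂ a u w)
    (b' := turnBits s₂ (T.degree γ.finish) w) (fun _ _ => rfl)
    (fun j _ => by rw [hl]; exact hookBits_finish j),
    valid_append (b := turnBits s₁ (T.degree γ.start) u) (b' := a)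
    (fun j hj => hookBits_start (by rwa [h] at hj))
    (fun j hj => by rw [h]; exact hookBits_middle hj), append_finish, hl, h, e1, e2, e3, e4,
    compat_turn_start, turn_valid, turn_valid]
  have := compat_turn_finish γ.start γ.puncture_start s₁ u (a 0)
  change (_ ∧ Compat (turn γ.start γ.puncture_start s₁).finish γ.start _ _ ∧ _) ∧ _ ↔ _
  rw [this]

theorem hookBits_congr {a' u' w' : ℕ → Bool} (ha : ∀ j < γ.len, a j = a' j)
    (hu : ∀ j < T.degree γ.start, u j = u' j) (hw : ∀ j < T.degree γ.finish, w j = w' j) (j : ℕ)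
    (hj : j < T.degree γ.start + γ.len + T.degree γ.finish) :
    γ.hookBits s₁ s₂ a u w j = γ.hookBits s₁ s₂ a' u' w' j := by
  simp only [hookBits]
  split_ifs with h1 h2
  · exact turnBits_congr hu h1
  · exact ha _ (by omega)
  · exact turnBits_congr hw (by omega)

theorem eq_of_hookBits_eq {a' u' w' : ℕ → Bool}
    (h : ∀ j < T.degree γ.start + γ.len + T.degree γ.finish,
      γ.hookBits s₁ s₂ a u w j = γ.hookBits s₁ s₂ a' u' w' j) :
    (∀ j < γ.len, a j = a' j) ∧ (∀ j < T.degree γ.start, u j = u' j) ∧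
      ∀ j < T.degree γ.finish, w j = w' j := by
  refine ⟨fun j hj => ?_, eq_of_turnBits_eq (s := s₁) fun j hj => ?_,
    eq_of_turnBits_eq (s := s₂) fun j hj => ?_⟩
  · have := h (T.degree γ.start + j) (by omega)
    rwa [hookBits_middle hj, hookBits_middle hj] at this
  · have := h j (by omega)
    rwa [hookBits_start hj, hookBits_start hj] at this
  · have := h (T.degree γ.start + γ.len + j) (by omega)
    rwa [hookBits_finish, hookBits_finish] at this

theorem exists_eq_hookBits (c : ℕ → Bool) : ∃ a u w,
    ∀ j < T.degree γ.start + γ.len + T.degree γ.finish, c j = γ.hookBits s₁ s₂ a u w j := by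
  refine ⟨fun j => c (T.degree γ.start + j), turnBits s₁ (T.degree γ.start) c,
    turnBits s₂ (T.degree γ.finish) fun j => c (T.degree γ.start + γ.len + j), fun j hj => ?_⟩
  rcases Nat.lt_or_ge j (T.degree γ.start) with h1 | h1
  · rw [hookBits_start h1, turnBits_turnBits h1]
  · rcases Nat.lt_or_ge j (T.degree γ.start + γ.len) with h2 | h2
    · obtain ⟨i, rfl⟩ : ∃ i, j = T.degree γ.start + i := ⟨j - T.degree γ.start, by omega⟩
      rw [hookBits_middle (by omega)]
    · obtain ⟨i, rfl⟩ : ∃ i, j = T.degree γ.start + γ.len + i :=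
        ⟨j - (T.degree γ.start + γ.len), by omega⟩
      rw [hookBits_finish, turnBits_turnBits (by omega)]

theorem hook_bitProd (g : TriSide Tri → Bool → T.FunctionField)
    (hg : ∀ e x, g (T.glue e) x = g e x) :
    (γ.hook s₁ s₂).bitProd g (γ.hookBits s₁ s₂ a u w) =
      (turnCCW γ.start γ.puncture_start).bitProd g u * γ.bitProd g a *
        (turnCCW γ.finish γ.puncture_finish).bitProd g w := by
  have h := turn_len γ.start γ.puncture_start s₁
  have hl : ((turn γ.start γ.puncture_start s₁).append γ.toCurve
      ⟨(turn_finish _ γ.puncture_start s₁).1.symm,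
        (turn_finish _ γ.puncture_start s₁).2.symm⟩).len = T.degree γ.start + γ.len := by
    rw [← h]
    rfl
  rw [hook, hooked, bitProd_append g (b := γ.hookBits s₁ s₂ a u w)
    (b' := turnBits s₂ (T.degree γ.finish) w) (fun _ _ => rfl)
    (fun j _ => by rw [hl]; exact hookBits_finish j),
    bitProd_append g (b := turnBits s₁ (T.degree γ.start) u) (b' := a)
    (fun j hj => hookBits_start (by rwa [h] at hj))
    (fun j hj => by rw [h]; exact hookBits_middle hj), bitProd_turn g hg, bitProd_turn g hg]

theorem hook_thirdProd (f : TriSide Tri → T.FunctionField) :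
    (γ.hook s₁ s₂).thirdProd f = (turnCCW γ.start γ.puncture_start).thirdProd f *
        f (thirdSide (turn γ.start γ.puncture_start s₁).finish γ.start) * γ.thirdProd f *
        f (thirdSide γ.finish (turn γ.finish γ.puncture_finish s₂).start) *
        (turnCCW γ.finish γ.puncture_finish).thirdProd f := by
  rw [hook, hooked, thirdProd_append, thirdProd_append, append_finish, thirdProd_turn,
    thirdProd_turn]

/-! ### The edges glued in the loop graph -/

theorem hook_east₁ : ((γ.hook s₁ s₂).cross (T.degree γ.start - 1 + 1)).2 =
    (T.glue ((γ.hook s₁ s₂).cross (T.degree γ.start - 1))).2 + 1 ↔ s₁ = .ccw := by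
  have hd := degree_pos γ.puncture_start
  have h1 : (γ.hook s₁ s₂).cross (T.degree γ.start) = γ.start := hook_cross_middle γ.len_pos
  have h2 : (turn γ.start γ.puncture_start s₁).finish =
      T.glue ((turn γ.start γ.puncture_start s₁).cross (T.degree γ.start - 1)) := by
    rw [← turn_len γ.start γ.puncture_start s₁]
    rfl
  rw [Nat.sub_add_cancel hd, h1, hook_cross_start (by omega), ← turn_finish_iff γ.start
    γ.puncture_start s₁, h2]

theorem hook_east₂ : ((γ.hook s₁ s₂).cross (T.degree γ.start + γ.len - 1 + 1)).2 =
    (T.glue ((γ.hook s₁ s₂).cross (T.degree γ.start + γ.len - 1))).2 + 1 ↔ s₂ = .ccw := by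
  have h0 := γ.len_pos
  rw [show T.degree γ.start + γ.len - 1 + 1 = T.degree γ.start + γ.len + 0 by omega,
    Nat.add_sub_assoc h0, hook_cross_middle (by omega), hook_cross_finish,
    ← turn_start_iff γ.finish γ.puncture_finish s₂]
  rfl

/-- The edge `c₁` of the loop graph, as a side of the quadrilateral around the first crossing of the
hooked curve. -/
def slot₁ : Sense → Slot
  | .ccw => .backLeft
  | .cw => .backRight

/-- The edge `c₁'` of the loop graph, as a side of the quadrilateral around the first crossing of
`γ`. -/
def slot₁' : Sense → Slot
  | .ccw => .backRight
  | .cw => .backLeft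

/-- The edge `c₂` of the loop graph, as a side of the quadrilateral around the last crossing of the
hooked curve. -/
def slot₂ : Sense → Slot
  | .ccw => .frontLeft
  | .cw => .frontRight

/-- The edge `c₂'` of the loop graph, as a side of the quadrilateral around the last crossing of
`γ`. -/
def slot₂' : Sense → Slot
  | .ccw => .frontRight
  | .cw => .frontLeft

theorem loopGraph_free₁ : (γ.hookedSnake s₁ s₂ ε).freeSide₁ (T.degree γ.start) =
    (slot₁' s₁).dir (relOr ε (T.degree γ.start)) := by
  have hd := degree_pos γ.puncture_start
  have h := freeSide₁_eq (γ.hook s₁ s₂) ε (T.degree γ.start - 1)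
  have h2 := hook_east₁ (γ := γ) (s₁ := s₁) (s₂ := s₂)
  rw [Nat.sub_add_cancel hd] at h h2
  refine h.trans ?_
  cases s₁
  · rw [if_pos (h2.2 rfl)]; rfl
  · rw [if_neg fun h' => by cases h2.1 h']; rfl

theorem loopGraph_free₂ : (γ.hookedSnake s₁ s₂ ε).freeSide₂ (T.degree γ.start + γ.len - 1) =
    (slot₂' s₂).dir (relOr ε (T.degree γ.start + γ.len - 1)) := by
  have h := freeSide₂_eq (γ.hook s₁ s₂) ε (T.degree γ.start + γ.len - 1)
  have h2 := hook_east₂ (γ := γ) (s₁ := s₁) (s₂ := s₂)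
  refine h.trans ?_
  cases s₂
  · rw [if_pos (h2.2 rfl)]; rfl
  · rw [if_neg fun h' => by cases h2.1 h']; rfl

theorem quadSide_slot₁' : (γ.hook s₁ s₂).quadSide (T.degree γ.start) (slot₁' s₁) =
    thirdSide γ.start (turn γ.start γ.puncture_start s₁).start := by
  have h1 : (γ.hook s₁ s₂).cross (T.degree γ.start) = γ.start := hook_cross_middle γ.len_pos
  rw [thirdSide]
  cases s₁
  · rw [if_pos ((turn_start_iff γ.start γ.puncture_start .ccw).2 rfl), slot₁', quadSide, h1]
  · rw [if_neg (fun h' => by cases (turn_start_iff γ.start γ.puncture_start .cw).1 h'), slot₁',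
      quadSide, h1]

/-- The first turn begins in the triangle at the start of `γ`. So this triangle is the lower half
both of the first tile and of the first tile of `γ`, and `c₁` and `c₁'` are put on the same side of
it. -/
theorem quadSide_slot₁ : (γ.hook s₁ s₂).quadSide 0 (slot₁ s₁) =
    thirdSide γ.start (turn γ.start γ.puncture_start s₁).start := by
  have h11 : (1 + 1 : ZMod 3) = 2 := by decide
  have h22 : (2 + 2 : ZMod 3) = 1 := by decide
  have hd := degree_pos γ.puncture_start
  have h1 : (γ.hook s₁ s₂).cross 0 = (turn γ.start γ.puncture_start s₁).start :=
    hook_cross_start hd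
  rw [thirdSide]
  cases s₁
  · rw [if_pos ((turn_start_iff γ.start γ.puncture_start .ccw).2 rfl), slot₁, quadSide, h1,
      turn_start_eq]
    simp only [add_assoc, h11]
  · rw [if_neg (fun h' => by cases (turn_start_iff γ.start γ.puncture_start .cw).1 h'), slot₁,
      quadSide, h1, turn_start_eq]
    simp only [add_assoc, h22]

theorem quadSide_slot₂' :
    (γ.hook s₁ s₂).quadSide (T.degree γ.start + γ.len - 1) (slot₂' s₂) =
      thirdSide (turn γ.finish γ.puncture_finish s₂).finish γ.finish := by
  have h0 := γ.len_pos
  have h1 : T.glue ((γ.hook s₁ s₂).cross (T.degree γ.start + γ.len - 1)) = γ.finish := by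
    rw [Nat.add_sub_assoc h0, hook_cross_middle (by omega)]
    rfl
  have h22 : (2 + 2 : ZMod 3) = 1 := by decide
  have h11 : (1 + 1 : ZMod 3) = 2 := by decide
  rw [thirdSide]
  cases s₂
  · rw [if_pos ((turn_finish_iff γ.finish γ.puncture_finish .ccw).2 rfl), slot₂', quadSide, h1,
      turn_finish_eq]
    simp only [add_assoc, h22]
  · rw [if_neg (fun h' => by cases (turn_finish_iff γ.finish γ.puncture_finish .cw).1 h'), slot₂',
      quadSide, h1, turn_finish_eq]
    simp only [add_assoc, h11]

theorem hook_glue_last :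
    T.glue ((γ.hook s₁ s₂).cross (T.degree γ.start + γ.len + T.degree γ.finish - 1)) =
      (turn γ.finish γ.puncture_finish s₂).finish := by
  have hd := degree_pos γ.puncture_finish
  rw [Nat.add_sub_assoc hd, hook_cross_finish, ← turn_len γ.finish γ.puncture_finish s₂]
  rfl

theorem quadSide_slot₂ :
    (γ.hook s₁ s₂).quadSide (T.degree γ.start + γ.len + T.degree γ.finish - 1) (slot₂ s₂) =
      thirdSide (turn γ.finish γ.puncture_finish s₂).finish γ.finish := by
  have h1 := hook_glue_last (γ := γ) (s₁ := s₁) (s₂ := s₂)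
  rw [thirdSide]
  cases s₂
  · rw [if_pos ((turn_finish_iff γ.finish γ.puncture_finish .ccw).2 rfl), slot₂, quadSide, h1]
  · rw [if_neg (fun h' => by cases (turn_finish_iff γ.finish γ.puncture_finish .cw).1 h'), slot₂,
      quadSide, h1]

theorem loopGraph_cut₁ : (γ.loopGraph s₁ s₂ ε).cut₁ = (slot₁ s₁).dir (relOr ε 0) := by
  have hx : (γ.hookedSnake s₁ s₂ ε).label (T.degree γ.start)
      ((γ.hookedSnake s₁ s₂ ε).freeSide₁ (T.degree γ.start)) =
        (γ.hook s₁ s₂).quadSide 0 (slot₁ s₁) := by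
    rw [loopGraph_free₁, hookedSnake, label_dir, quadSide_slot₁', quadSide_slot₁]
  -- The two back sides are different sides of one triangle, even if the triangle is self-folded;
  -- hence labels by sides, not arcs, identify the cut.
  have n12 : ∀ x : ZMod 3, x + 1 ≠ x + 2 := by decide
  have hne : (γ.hook s₁ s₂).quadSide 0 .backLeft ≠ (γ.hook s₁ s₂).quadSide 0 .backRight :=
    fun h => n12 _ (congrArg Prod.snd h)
  classical
  change (if (γ.hookedSnake s₁ s₂ ε).label 0 .S = (γ.hookedSnake s₁ s₂ ε).label (T.degree γ.start)
      ((γ.hookedSnake s₁ s₂ ε).freeSide₁ (T.degree γ.start)) then Dir.S else Dir.W) = _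
  rw [hx]
  refine (back_side_eq (γ.hook s₁ s₂) ε 0 _ ?_).trans ?_
  · cases s₁ <;> simp [slot₁, hne, hne.symm]
  · cases s₁ <;> simp [slot₁, hne]

theorem loopGraph_cut₂ : (γ.loopGraph s₁ s₂ ε).cut₂ =
    (slot₂ s₂).dir (relOr ε (T.degree γ.start + γ.len + T.degree γ.finish - 1)) := by
  have hx : (γ.hookedSnake s₁ s₂ ε).label (T.degree γ.start + γ.len - 1)
      ((γ.hookedSnake s₁ s₂ ε).freeSide₂ (T.degree γ.start + γ.len - 1)) =
      (γ.hook s₁ s₂).quadSide (T.degree γ.start + γ.len + T.degree γ.finish - 1) (slot₂ s₂) := by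
    rw [loopGraph_free₂, hookedSnake, label_dir, quadSide_slot₂', quadSide_slot₂]
  have n12 : ∀ x : ZMod 3, x + 2 ≠ x + 1 := by decide
  have hne : ∀ j, (γ.hook s₁ s₂).quadSide j .frontLeft ≠ (γ.hook s₁ s₂).quadSide j .frontRight :=
    fun j h => n12 _ (congrArg Prod.snd h)
  classical
  change (if (γ.hookedSnake s₁ s₂ ε).label ((γ.hook s₁ s₂).len - 1) .N =
    (γ.hookedSnake s₁ s₂ ε).label (T.degree γ.start + γ.len - 1)
      ((γ.hookedSnake s₁ s₂ ε).freeSide₂ (T.degree γ.start + γ.len - 1)) then Dir.N else Dir.E) = _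
  rw [hx, hook_len]
  refine (front_side_eq (γ.hook s₁ s₂) ε _ _ ?_).trans ?_
  · cases s₂ <;> simp [slot₂, hne, (hne _).symm]
  · cases s₂ <;> simp [slot₂, hne]

/-- The edge `c₁` is present when the first tile has the right sign, and `c₁'` when the first tile
of `γ` has the opposite of that sign. The disjunction of the two is the bound that `hook_valid`
leaves out; likewise at the other hook. -/
theorem meets_iff (hc : (γ.hook s₁ s₂).Valid (γ.hookBits s₁ s₂ a u w)) :
    (γ.loopGraph s₁ s₂ ε).Meets ((γ.hook s₁ s₂).matchingOf ε (γ.hookBits s₁ s₂ a u w)) ↔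
      TurnStartOK s₁ (T.degree γ.start) u (a 0) ∧
        TurnFinishOK s₂ (T.degree γ.finish) w (a (γ.len - 1)) := by
  have hd := degree_pos γ.puncture_start
  have hd' := degree_pos γ.puncture_finish
  have h0 := γ.len_pos
  have hlen := hook_len γ s₁ s₂
  have e1 : (γ.loopGraph s₁ s₂ ε).c₁ =
      ((γ.hook s₁ s₂).snakeGraph ε).edge 0 ((slot₁ s₁).dir (relOr ε 0)) := by
    rw [← loopGraph_cut₁ (γ := γ) (s₂ := s₂)]
    rfl
  have e2 : (γ.loopGraph s₁ s₂ ε).c₁' = ((γ.hook s₁ s₂).snakeGraph ε).edge (T.degree γ.start)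
      ((slot₁' s₁).dir (relOr ε (T.degree γ.start))) := by
    rw [← loopGraph_free₁ (γ := γ) (s₂ := s₂)]
    rfl
  have e3 : (γ.loopGraph s₁ s₂ ε).c₂ = ((γ.hook s₁ s₂).snakeGraph ε).edge
      (T.degree γ.start + γ.len + T.degree γ.finish - 1)
      ((slot₂ s₂).dir (relOr ε (T.degree γ.start + γ.len + T.degree γ.finish - 1))) := by
    rw [← loopGraph_cut₂ (γ := γ) (s₁ := s₁), ← hook_len γ s₁ s₂]
    rfl
  have e4 : (γ.loopGraph s₁ s₂ ε).c₂' = ((γ.hook s₁ s₂).snakeGraph ε).edge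
      (T.degree γ.start + γ.len - 1)
      ((slot₂' s₂).dir (relOr ε (T.degree γ.start + γ.len - 1))) := by
    rw [← loopGraph_free₂ (γ := γ) (s₁ := s₁)]
    rfl
  have b1 : γ.hookBits s₁ s₂ a u w 0 = turnBits s₁ (T.degree γ.start) u 0 := hookBits_start hd
  have b2 : γ.hookBits s₁ s₂ a u w (T.degree γ.start) = a 0 := hookBits_middle (j := 0) h0
  have b3 : γ.hookBits s₁ s₂ a u w (T.degree γ.start + γ.len - 1) = a (γ.len - 1) := by
    rw [Nat.add_sub_assoc h0, hookBits_middle (by omega)]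
  have b4 : γ.hookBits s₁ s₂ a u w (T.degree γ.start + γ.len + T.degree γ.finish - 1) =
      turnBits s₂ (T.degree γ.finish) w (T.degree γ.finish - 1) := by
    rw [Nat.add_sub_assoc hd', hookBits_finish]
  have m1 : (γ.hook s₁ s₂).MemBits (γ.hookBits s₁ s₂ a u w) 0 (slot₁ s₁) ↔
      (slot₁ s₁).Cond (turnBits s₁ (T.degree γ.start) u 0) := by
    rw [MemBits, b1]
    exact and_iff_left ⟨fun _ => by cases s₁ <;> trivial, fun i hi => by omega⟩
  -- The side `c₁'` is by definition not glued to the preceding tile, so the sign of that tile is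
  -- irrelevant.
  have m2 : (γ.hook s₁ s₂).MemBits (γ.hookBits s₁ s₂ a u w) (T.degree γ.start) (slot₁' s₁) ↔
      (slot₁' s₁).Cond (a 0) := by
    rw [MemBits, b2]
    refine and_iff_left ⟨fun _ => by cases s₁ <;> trivial, fun i hi => ?_⟩
    obtain rfl : i = T.degree γ.start - 1 := by omega
    have h2 := hook_east₁ (γ := γ) (s₁ := s₁) (s₂ := s₂)
    rw [hi] at h2
    cases s₁
    · exact fun h => absurd (h2.2 rfl) h
    · intro h
      cases h2.1 h
  have m3 : (γ.hook s₁ s₂).MemBits (γ.hookBits s₁ s₂ a u w)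
      (T.degree γ.start + γ.len + T.degree γ.finish - 1) (slot₂ s₂) ↔
      (slot₂ s₂).Cond (turnBits s₂ (T.degree γ.finish) w (T.degree γ.finish - 1)) := by
    rw [MemBits, b4]
    exact and_iff_left ⟨fun h => by omega, fun _ _ => by cases s₂ <;> trivial⟩
  have m4 : (γ.hook s₁ s₂).MemBits (γ.hookBits s₁ s₂ a u w)
      (T.degree γ.start + γ.len - 1) (slot₂' s₂) ↔ (slot₂' s₂).Cond (a (γ.len - 1)) := by
    rw [MemBits, b3]
    refine and_iff_left ⟨fun _ => ?_, fun _ _ => by cases s₂ <;> trivial⟩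
    have h2 := hook_east₂ (γ := γ) (s₁ := s₁) (s₂ := s₂)
    cases s₂
    · exact fun h => absurd (h2.2 rfl) h
    · intro h
      cases h2.1 h
  rw [LoopGraph.Meets, e1, e2, e3, e4, edge_mem_matchingOf_iff hc (by omega),
    edge_mem_matchingOf_iff hc (by omega), edge_mem_matchingOf_iff hc (by omega),
    edge_mem_matchingOf_iff hc (by omega), m1, m2, m3, m4]
  refine and_congr ?_ ?_
  · cases s₁
    · simp only [slot₁, slot₁', Slot.Cond, turnBits, TurnStartOK]
      cases a 0 <;> cases u 0 <;> simp
    · simp only [slot₁, slot₁', Slot.Cond, turnBits, TurnStartOK, Nat.sub_zero]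
      cases a 0 <;> cases u (T.degree γ.start - 1) <;> simp
  · cases s₂
    · simp only [slot₂, slot₂', Slot.Cond, turnBits, TurnFinishOK]
      cases a (γ.len - 1) <;> cases w (T.degree γ.finish - 1) <;> simp
    · simp only [slot₂, slot₂', Slot.Cond, turnBits, TurnFinishOK, Nat.sub_self]
      cases a (γ.len - 1) <;> cases w 0 <;> simp

end DoublyNotched

end IdealTriangulation

namespace IdealTriangulation

variable {Tri : Type*} {T : IdealTriangulation Tri}

theorem Curve.bitProd_ne_zero (γ : T.Curve) {g : TriSide Tri → Bool → T.FunctionField}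
    (hg : ∀ e x, g e x ≠ 0) (b : ℕ → Bool) : γ.bitProd g b ≠ 0 :=
  prod_ne_zero_iff.2 fun _ _ => hg _ _

theorem Curve.thirdProd_ne_zero (γ : T.Curve) {w : TriSide Tri → T.FunctionField}
    (hw : ∀ e, w e ≠ 0) : γ.thirdProd w ≠ 0 :=
  prod_ne_zero_iff.2 fun _ _ => hw _

/-- Needed because `γ.reverse.finish` equals `γ.start` only propositionally, while the proof of
being a puncture depends on the corner. -/
theorem turnCCW_congr {M : Type*} (F : T.Curve → M) {c c' : TriSide Tri} (hcc : c = c')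
    (h : T.IsPuncture c) (h' : T.IsPuncture c') : F (turnCCW c h) = F (turnCCW c' h') := by
  subst hcc
  rfl

namespace DoublyNotched

open Curve

variable {γ : T.DoublyNotched} {A B : Choice} {s₁ s₂ : Sense} {ε : ℤˣ} {a a' u w : ℕ → Bool}

/-! ### Pairs of symmetric matchings -/

/-- The perfect matching of the snake graph of `ℓ_p` with the signs `a` on the copies of `γ`
(in the direction of `γ`) and the signs `u` on the turn. -/
noncomputable def matchP (γ : T.DoublyNotched) (A : Choice) (a u : ℕ → Bool) :
    Finset (Sym2 LatticePt) :=
  (γ.toCurve.reverse.enclose γ.puncture_reverse A.sense).matchingOf A.rel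
    (γ.toCurve.reverse.loopBits A.sense (fun j => a (γ.len - 1 - j)) u)

/-- The perfect matching of the snake graph of `ℓ_q` with the signs `a` on the copies of `γ` and the
signs `w` on the turn. -/
noncomputable def matchQ (γ : T.DoublyNotched) (B : Choice) (a w : ℕ → Bool) :
    Finset (Sym2 LatticePt) :=
  (γ.toCurve.enclose γ.puncture_finish B.sense).matchingOf B.rel
    (γ.toCurve.loopBits B.sense a w)

/-- The signs `u`, `a`, `w` on the two turns and on `γ` are compatible with each other. -/
def IsSigns (γ : T.DoublyNotched) (a u w : ℕ → Bool) : Prop :=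
  γ.Valid a ∧ TurnOK (T.degree γ.start) u (a 0) ∧ TurnOK (T.degree γ.finish) w (a (γ.len - 1))

theorem reverse_valid (ha : γ.Valid a) :
    γ.toCurve.reverse.Valid fun j => a (γ.len - 1 - j) :=
  (valid_reverse fun _ _ => rfl).2 ha

theorem reverse_turnOK (hu : TurnOK (T.degree γ.start) u (a 0)) :
    TurnOK (T.degree γ.toCurve.reverse.finish) u (a (γ.len - 1 - (γ.toCurve.reverse.len - 1))) := by
  rw [reverse_finish, show γ.toCurve.reverse.len = γ.len from rfl, Nat.sub_self]
  exact hu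

theorem isSymmetric_reverse_iff {P : Finset (Sym2 LatticePt)} :
    γ.toCurve.reverse.IsSymmetric γ.puncture_reverse A.sense A.rel P ↔
      ∃ a u, γ.Valid a ∧ TurnOK (T.degree γ.start) u (a 0) ∧ P = γ.matchP A a u := by
  have h0 := γ.len_pos
  have hlen : γ.toCurve.reverse.len = γ.len := rfl
  rw [isSymmetric_iff]
  constructor
  · rintro ⟨a, u, ha, hu, rfl⟩
    have hrev : ∀ j < γ.len, a j = a (γ.len - 1 - (γ.len - 1 - j)) := fun j hj => by
      rw [show γ.len - 1 - (γ.len - 1 - j) = j by omega]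
    refine ⟨fun j => a (γ.len - 1 - j), u, (valid_reverse hrev).1 ha, ?_,
      matchingOf_congr fun j hj => loopBits_congr (γ := γ.toCurve.reverse) hrev
        (fun _ _ => rfl) j ?_⟩
    · rwa [reverse_finish, hlen] at hu
    · rwa [enclose_len] at hj
  · rintro ⟨a, u, ha, hu, rfl⟩
    exact ⟨_, u, reverse_valid ha, reverse_turnOK hu, rfl⟩

/-- On free copies the edges of both matchings are described by `MemBits` for the signs on `γ`
alone, and these memberships determine the signs. -/
theorem matchAlong_iff (ha : γ.Valid a) (hu : TurnOK (T.degree γ.start) u (a 0))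
    (ha' : γ.Valid a') (hw : TurnOK (T.degree γ.finish) w (a' (γ.len - 1))) {i j : Copy} :
    γ.MatchAlong A B i j (γ.matchP A a u) (γ.matchQ B a' w) ↔
      CopyFree A.sense (T.degree γ.start) u i ∧ CopyFree B.sense (T.degree γ.finish) w j ∧
        ∀ m < γ.len, a m = a' m := by
  have hrf : γ.toCurve.reverse.finish = γ.start := reverse_finish _
  have hP : (γ.copyP A i).graph.IsPerfectMatching
      (SnakeGraph.restrict (γ.matchP A a u) (γ.copyP A i)) ↔
        CopyFree A.sense (T.degree γ.start) u i := by
    have := restrict_perfect_iff (h := γ.puncture_reverse) (s := A.sense) (ε := A.rel)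
      (reverse_valid ha) (reverse_turnOK hu) i
    rwa [hrf] at this
  have hQ : (γ.copyQ B j).graph.IsPerfectMatching
      (SnakeGraph.restrict (γ.matchQ B a' w) (γ.copyQ B j)) ↔
        CopyFree B.sense (T.degree γ.finish) w j :=
    restrict_perfect_iff ha' hw j
  rw [MatchAlong, hP, hQ]
  refine and_congr_right fun hi => and_congr_right fun hj => ?_
  have key : ∀ m < γ.len, ∀ σ : Slot, (γ.copyEdgeP A i m σ ∈ γ.matchP A a u ↔
      γ.copyEdgeQ B j m σ ∈ γ.matchQ B a' w) ↔ (γ.MemBits a m σ ↔ γ.MemBits a' m σ) := by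
    intro m hm σ
    have e1 : γ.copyEdgeP A i m σ ∈ γ.matchP A a u ↔ γ.MemBits a m σ := by
      have h1 := copyEdge_mem_iff (h := γ.puncture_reverse) (s := A.sense) (ε := A.rel)
        (reverse_valid ha) (reverse_turnOK hu) (i := i) (by rwa [hrf]) (m := γ.len - 1 - m)
        (show γ.len - 1 - m < γ.len by omega) σ.opp
      rw [memBits_reverse (b := a) (fun _ _ => rfl) (show γ.len - 1 - m < γ.len by omega),
        Slot.opp_opp, show γ.len - 1 - (γ.len - 1 - m) = m by omega] at h1
      exact h1
    have e2 : γ.copyEdgeQ B j m σ ∈ γ.matchQ B a' w ↔ γ.MemBits a' m σ :=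
      copyEdge_mem_iff ha' hw hj hm σ
    rw [e1, e2]
  constructor
  · exact fun H => eq_of_memBits_iff fun m hm σ _ => (key m hm σ).1 (H m hm σ)
  · exact fun H m hm σ => (key m hm σ).2 (memBits_congr H hm σ)

/-- Since free copies always exist, compatibility only requires that both loops carry the same signs
on `γ`. -/
theorem isCompatiblePair_iff {P : Finset (Sym2 LatticePt) × Finset (Sym2 LatticePt)} :
    γ.IsCompatiblePair A B P ↔
      ∃ a u w, γ.IsSigns a u w ∧ P = (γ.matchP A a u, γ.matchQ B a w) := by
  have h0 := γ.len_pos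
  constructor
  · rintro ⟨h1, h2, i, j, h3⟩
    obtain ⟨P, Q⟩ := P
    obtain ⟨a, u, ha, hu, rfl⟩ := isSymmetric_reverse_iff.1 h1
    obtain ⟨a', w, ha', hw, rfl⟩ := isSymmetric_iff.1 h2
    have h := ((matchAlong_iff ha hu ha' hw).1 h3).2.2
    -- The signs `a'` found for the second loop agree with `a` on the crossings of `γ`, so they can
    -- be replaced by `a`.
    refine ⟨a, u, w, ⟨ha, hu, ?_⟩, Prod.ext rfl (matchingOf_congr fun j hj =>
      loopBits_congr (fun m hm => (h m hm).symm) (fun _ _ => rfl) j ?_)⟩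
    · rwa [h _ (by omega)]
    · rwa [enclose_len] at hj
  · rintro ⟨a, u, w, ⟨ha, hu, hw⟩, rfl⟩
    obtain ⟨i, hi⟩ := exists_copyFree A.sense (degree_pos γ.puncture_start) hu.1
    obtain ⟨j, hj⟩ := exists_copyFree B.sense (degree_pos γ.puncture_finish) hw.1
    exact ⟨isSymmetric_reverse_iff.2 ⟨a, u, ha, hu, rfl⟩, isSymmetric_iff.2 ⟨a, w, ha, hw, rfl⟩,
      i, j, (matchAlong_iff ha hu ha hw).2 ⟨hi, hj, fun _ _ => rfl⟩⟩

theorem pair_eq_iff {u' w' : ℕ → Bool} :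
    (γ.matchP A a u, γ.matchQ B a w) = (γ.matchP A a' u', γ.matchQ B a' w') ↔
      (∀ j < γ.len, a j = a' j) ∧ (∀ j < T.degree γ.start, u j = u' j) ∧
        ∀ j < T.degree γ.finish, w j = w' j := by
  constructor
  · intro h
    obtain ⟨h1, h2⟩ := Prod.mk.inj h
    have hP := eq_of_matchingOf_eq h1
    have hQ := eq_of_matchingOf_eq h2
    rw [enclose_len] at hP hQ
    have hP := (eq_of_loopBits_eq hP).2
    rw [reverse_finish] at hP
    exact ⟨(eq_of_loopBits_eq hQ).1, hP, (eq_of_loopBits_eq hQ).2⟩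
  · rintro ⟨ha, hu, hw⟩
    refine Prod.ext (matchingOf_congr fun j hj => loopBits_congr (fun m hm => ?_) ?_ j ?_)
      (matchingOf_congr fun j hj => loopBits_congr ha hw j ?_)
    · have hm : m < γ.len := hm
      exact ha _ (by omega)
    · rwa [reverse_finish]
    · rwa [enclose_len] at hj
    · rwa [enclose_len] at hj

/-! ### Good matchings -/

/-- The perfect matching of the snake graph of the hooked arc with the signs `u`, `a`, `w` on its
three parts. -/
noncomputable def matchHook (γ : T.DoublyNotched) (s₁ s₂ : Sense) (ε : ℤˣ) (a u w : ℕ → Bool) :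
    Finset (Sym2 LatticePt) :=
  (γ.hook s₁ s₂).matchingOf ε (γ.hookBits s₁ s₂ a u w)

/-- For each turn, validity supplies the bound at the end where it meets `γ`, and the cut edges
supply the other. -/
theorem isSigns_iff : γ.IsSigns a u w ↔ (γ.hook s₁ s₂).Valid (γ.hookBits s₁ s₂ a u w) ∧
    (γ.loopGraph s₁ s₂ ε).Meets (γ.matchHook s₁ s₂ ε a u w) := by
  constructor
  · rintro ⟨ha, hu, hw⟩
    have hu := (turnOK_iff s₁).1 hu
    have hw := (turnOK_iff s₂).1 hw
    have hv : (γ.hook s₁ s₂).Valid (γ.hookBits s₁ s₂ a u w) :=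
      hook_valid.2 ⟨⟨hu.1, hu.2.2, ha⟩, hw.2.1, hw.1⟩
    exact ⟨hv, (meets_iff hv).2 ⟨hu.2.1, hw.2.2⟩⟩
  · rintro ⟨hv, hm⟩
    have hm := (meets_iff hv).1 hm
    have hv := hook_valid.1 hv
    exact ⟨hv.1.2.2, (turnOK_iff s₁).2 ⟨hv.1.1, hm.1, hv.1.2.1⟩,
      (turnOK_iff s₂).2 ⟨hv.2.2, hv.2.1, hm.2⟩⟩

section

variable (hp : ¬ T.IsFoldedCorner γ.start) (hq : ¬ T.IsFoldedCorner γ.finish)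
include hp

theorem two_le_k₁ : 2 ≤ (γ.loopGraph s₁ s₂ ε).k₁ := two_le_degree γ.puncture_start hp

omit hp in
include hq in
theorem k₂_add_three_le :
    (γ.loopGraph s₁ s₂ ε).k₂ + 3 ≤ (γ.loopGraph s₁ s₂ ε).snake.numTiles := by
  have h0 := γ.len_pos
  have h1 := two_le_degree γ.puncture_finish hq
  have h2 := hook_len γ s₁ s₂
  change T.degree γ.start + γ.len - 1 + 3 ≤ (γ.hook s₁ s₂).len
  omega

include hq

/-- An extension has the matching of the loop graph as its core, and the core is injective. Hence
the coefficient monomial of a good matching does not depend on the extension. -/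
theorem extends_iff (h : γ.IsSigns a u w) {Q : Finset (Sym2 LatticePt)} :
    (γ.loopGraph s₁ s₂ ε).Extends
      ((γ.loopGraph s₁ s₂ ε).core (γ.matchHook s₁ s₂ ε a u w)) Q ↔
        Q = γ.matchHook s₁ s₂ ε a u w := by
  obtain ⟨hv, hm⟩ := isSigns_iff.1 h
  have hM := isPerfectMatching_matchingOf ε hv
  have hE := LoopGraph.extends_core (two_le_k₁ hp) (k₂_add_three_le hq) hM hm
  constructor
  · intro hQ
    obtain ⟨hm', he⟩ :=
      LoopGraph.meets_and_eq_core (two_le_k₁ hp) (k₂_add_three_le hq) hE.1 hQ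
    exact LoopGraph.core_injective (two_le_k₁ hp) (k₂_add_three_le hq) hQ.1 hM hm' hm he.symm
  · rintro rfl
    exact hE.2

theorem isGoodMatching_iff {P : Finset (Sym2 LatticePt)} :
    (γ.loopGraph s₁ s₂ ε).IsGoodMatching P ↔ ∃ a u w, γ.IsSigns a u w ∧
      P = (γ.loopGraph s₁ s₂ ε).core (γ.matchHook s₁ s₂ ε a u w) := by
  constructor
  · rintro ⟨hP, Q, hPQ⟩
    obtain ⟨hm, he⟩ := LoopGraph.meets_and_eq_core (two_le_k₁ hp) (k₂_add_three_le hq) hP hPQ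
    obtain ⟨c, hc, rfl⟩ := exists_eq_matchingOf (γ := γ.hook s₁ s₂) hPQ.1
    obtain ⟨a, u, w, hauw⟩ := exists_eq_hookBits (γ := γ) (s₁ := s₁) (s₂ := s₂) c
    rw [← hook_len γ s₁ s₂] at hauw
    rw [matchingOf_congr hauw] at hm he
    exact ⟨a, u, w, isSigns_iff.2 ⟨(valid_congr hauw).1 hc, hm⟩, he⟩
  · rintro ⟨a, u, w, h, rfl⟩
    obtain ⟨hv, hm⟩ := isSigns_iff.1 h
    have hE := LoopGraph.extends_core (two_le_k₁ hp) (k₂_add_three_le hq)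
      (isPerfectMatching_matchingOf ε hv) hm
    exact ⟨hE.1, _, hE.2⟩

theorem core_eq_iff {u' w' : ℕ → Bool} (h : γ.IsSigns a u w) (h' : γ.IsSigns a' u' w') :
    (γ.loopGraph s₁ s₂ ε).core (γ.matchHook s₁ s₂ ε a u w) =
        (γ.loopGraph s₁ s₂ ε).core (γ.matchHook s₁ s₂ ε a' u' w') ↔
      (∀ j < γ.len, a j = a' j) ∧ (∀ j < T.degree γ.start, u j = u' j) ∧
        ∀ j < T.degree γ.finish, w j = w' j := by
  constructor
  · intro he
    -- The second matching extends the common core, so it is the unique extension of the first.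
    have h2 := (extends_iff hp hq h).1 (he ▸ (extends_iff hp hq h' (s₁ := s₁) (s₂ := s₂)
      (ε := ε)).2 rfl)
    have h3 := eq_of_matchingOf_eq h2.symm
    rw [hook_len] at h3
    exact eq_of_hookBits_eq h3
  · rintro ⟨ha, hu, hw⟩
    refine congrArg _ (matchingOf_congr fun j hj => hookBits_congr ha hu hw j ?_)
    rwa [hook_len] at hj

end

/-! ### Monomials -/

theorem yMonomial_matchHook : yMonomial (γ.loopGraph s₁ s₂ ε).snake (γ.matchHook s₁ s₂ ε a u w) =
    (turnCCW γ.start γ.puncture_start).bitProd (yFactor T) u * γ.bitProd (yFactor T) a *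
      (turnCCW γ.finish γ.puncture_finish).bitProd (yFactor T) w := by
  rw [← hook_bitProd (yFactor T) yFactor_glue (s₁ := s₁) (s₂ := s₂)]
  exact yMonomial_matchingOf _ ε _

/-- The two joints of the hooked curve contribute one third side each, and the removed edges `c₁`,
`c₂` contribute the complementary ones. By `thirdSide_turn` they combine to the two sides at each
puncture, independently of the senses. -/
theorem xMonomial_core (hp : ¬ T.IsFoldedCorner γ.start) (hq : ¬ T.IsFoldedCorner γ.finish)
    (h : γ.IsSigns a u w) :
    xMonomial (γ.loopGraph s₁ s₂ ε).snake
        ((γ.loopGraph s₁ s₂ ε).core (γ.matchHook s₁ s₂ ε a u w)) *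
      ((T.xWeight (γ.start.1, γ.start.2 + 1) * T.xWeight (γ.start.1, γ.start.2 + 2)) *
        (T.xWeight (γ.finish.1, γ.finish.2 + 1) * T.xWeight (γ.finish.1, γ.finish.2 + 2)) *
        (turnCCW γ.start γ.puncture_start).thirdProd T.xWeight * γ.thirdProd T.xWeight *
        (turnCCW γ.finish γ.puncture_finish).thirdProd T.xWeight) =
    (turnCCW γ.start γ.puncture_start).bitProd (xFactor T) u * γ.bitProd (xFactor T) a *
      (turnCCW γ.finish γ.puncture_finish).bitProd (xFactor T) w := by
  obtain ⟨hv, hm⟩ := isSigns_iff (s₁ := s₁) (s₂ := s₂) (ε := ε).1 h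
  have l1 : (γ.loopGraph s₁ s₂ ε).snake.label 0 (γ.loopGraph s₁ s₂ ε).cut₁ =
      thirdSide γ.start (turn γ.start γ.puncture_start s₁).start := by
    rw [loopGraph_cut₁, ← quadSide_slot₁ (s₂ := s₂)]
    exact label_dir _ ε _ _
  have l2 : (γ.loopGraph s₁ s₂ ε).snake.label (γ.loopGraph s₁ s₂ ε).last
      (γ.loopGraph s₁ s₂ ε).cut₂ =
      thirdSide (turn γ.finish γ.puncture_finish s₂).finish γ.finish := by
    rw [loopGraph_cut₂, ← quadSide_slot₂ (s₁ := s₁),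
      show (γ.loopGraph s₁ s₂ ε).last = (γ.hook s₁ s₂).len - 1 from rfl, hook_len]
    exact label_dir _ ε _ _
  have l3 : (γ.loopGraph s₁ s₂ ε).snake.label (γ.loopGraph s₁ s₂ ε).k₁
      ((γ.loopGraph s₁ s₂ ε).snake.freeSide₁ (γ.loopGraph s₁ s₂ ε).k₁) =
      thirdSide γ.start (turn γ.start γ.puncture_start s₁).start := by
    rw [← quadSide_slot₁' (s₂ := s₂), ← label_dir _ ε, ← loopGraph_free₁ (s₂ := s₂)]
    rfl
  have l4 : (γ.loopGraph s₁ s₂ ε).snake.label (γ.loopGraph s₁ s₂ ε).k₂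
      ((γ.loopGraph s₁ s₂ ε).snake.freeSide₂ (γ.loopGraph s₁ s₂ ε).k₂) =
      thirdSide (turn γ.finish γ.puncture_finish s₂).finish γ.finish := by
    rw [← quadSide_slot₂' (s₁ := s₁), ← label_dir _ ε, ← loopGraph_free₂ (s₁ := s₁)]
    rfl
  have e1 := LoopGraph.weightProd_core (two_le_k₁ hp) (k₂_add_three_le hq) hm T.xWeight
    (l3.trans l1.symm) (l4.trans l2.symm)
  rw [l1, l2] at e1
  have e2 := xMonomial_matchingOf ε hv
  rw [hook_thirdProd, hook_bitProd (xFactor T) xFactor_glue] at e2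
  rw [← e2]
  change _ = (γ.loopGraph s₁ s₂ ε).snake.weightProd T.xWeight (γ.matchHook s₁ s₂ ε a u w) * _
  rw [← e1, ← thirdSide_turn T.xWeight γ.start γ.puncture_start s₁,
    ← thirdSide_turn T.xWeight γ.finish γ.puncture_finish s₂, xMonomial]
  ring

theorem monomials_matchP (ha : γ.Valid a) (hu : TurnOK (T.degree γ.start) u (a 0)) :
    xMonomial (γ.snakeP A) (γ.matchP A a u) * (γ.thirdProd T.xWeight ^ 2 *
        (turnCCW γ.start γ.puncture_start).thirdProd T.xWeight *
        (T.xWeight (γ.start.1, γ.start.2 + 1) * T.xWeight (γ.start.1, γ.start.2 + 2))) =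
      γ.bitProd (xFactor T) a ^ 2 * (turnCCW γ.start γ.puncture_start).bitProd (xFactor T) u ∧
    yMonomial (γ.snakeP A) (γ.matchP A a u) =
      γ.bitProd (yFactor T) a ^ 2 * (turnCCW γ.start γ.puncture_start).bitProd (yFactor T) u := by
  have hrf : γ.toCurve.reverse.finish = γ.start := reverse_finish _
  have h1 := xMonomial_matchingOf A.rel (enclose_valid_loopBits (h := γ.puncture_reverse)
    (s := A.sense).2 ⟨reverse_valid ha, reverse_turnOK hu⟩)
  have h2 := yMonomial_matchingOf (γ.toCurve.reverse.enclose γ.puncture_reverse A.sense) A.rel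
    (γ.toCurve.reverse.loopBits A.sense (fun j => a (γ.len - 1 - j)) u)
  rw [enclose_thirdProd, enclose_bitProd _ xFactor_glue, thirdProd_reverse,
    bitProd_reverse (b := a) xFactor_glue (fun _ _ => rfl),
    turnCCW_congr (fun c => c.bitProd (xFactor T) u) hrf _ γ.puncture_start,
    turnCCW_congr (fun c => c.thirdProd T.xWeight) hrf _ γ.puncture_start, hrf] at h1
  rw [enclose_bitProd _ yFactor_glue, bitProd_reverse (b := a) yFactor_glue (fun _ _ => rfl),
    turnCCW_congr (fun c => c.bitProd (yFactor T) u) hrf _ γ.puncture_start] at h2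
  exact ⟨h1, h2⟩

theorem monomials_matchQ (ha : γ.Valid a) (hw : TurnOK (T.degree γ.finish) w (a (γ.len - 1))) :
    xMonomial (γ.snakeQ B) (γ.matchQ B a w) * (γ.thirdProd T.xWeight ^ 2 *
        (turnCCW γ.finish γ.puncture_finish).thirdProd T.xWeight *
        (T.xWeight (γ.finish.1, γ.finish.2 + 1) * T.xWeight (γ.finish.1, γ.finish.2 + 2))) =
      γ.bitProd (xFactor T) a ^ 2 * (turnCCW γ.finish γ.puncture_finish).bitProd (xFactor T) w ∧
    yMonomial (γ.snakeQ B) (γ.matchQ B a w) =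
      γ.bitProd (yFactor T) a ^ 2 *
        (turnCCW γ.finish γ.puncture_finish).bitProd (yFactor T) w := by
  have h1 := xMonomial_matchingOf B.rel (enclose_valid_loopBits (h := γ.puncture_finish)
    (s := B.sense).2 ⟨ha, hw⟩)
  have h2 := yMonomial_matchingOf (γ.toCurve.enclose γ.puncture_finish B.sense) B.rel
    (γ.toCurve.loopBits B.sense a w)
  rw [enclose_thirdProd, enclose_bitProd _ xFactor_glue] at h1
  rw [enclose_bitProd _ yFactor_glue] at h2
  exact ⟨h1, h2⟩

theorem monomials_copyP (ha : γ.Valid a) (hu : TurnOK (T.degree γ.start) u (a 0)) {i : Copy}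
    (hi : CopyFree A.sense (T.degree γ.start) u i) :
    xMonomial (γ.copyP A i) (SnakeGraph.restrict (γ.matchP A a u) (γ.copyP A i)) *
        γ.thirdProd T.xWeight = γ.bitProd (xFactor T) a ∧
      yMonomial (γ.copyP A i) (SnakeGraph.restrict (γ.matchP A a u) (γ.copyP A i)) =
        γ.bitProd (yFactor T) a := by
  have hrf : γ.toCurve.reverse.finish = γ.start := reverse_finish _
  have h := copy_monomials (h := γ.puncture_reverse) (s := A.sense) (ε := A.rel)
    (reverse_valid ha) (reverse_turnOK hu) (i := i) (by rwa [hrf])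
  rwa [thirdProd_reverse, bitProd_reverse (b := a) xFactor_glue (fun _ _ => rfl),
    bitProd_reverse (b := a) yFactor_glue (fun _ _ => rfl)] at h

theorem pairX_eq (hp : ¬ T.IsFoldedCorner γ.start) (hq : ¬ T.IsFoldedCorner γ.finish)
    (h : γ.IsSigns a u w) {i : Copy} (hi : CopyFree A.sense (T.degree γ.start) u i) :
    γ.pairX A B i (γ.matchP A a u, γ.matchQ B a w) = xMonomial (γ.loopGraph s₁ s₂ ε).snake
      ((γ.loopGraph s₁ s₂ ε).core (γ.matchHook s₁ s₂ ε a u w)) := by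
  have hP := (monomials_matchP (A := A) h.1 h.2.1).1
  have hQ := (monomials_matchQ (B := B) h.1 h.2.2).1
  have hC := (monomials_copyP h.1 h.2.1 hi).1
  have hH := xMonomial_core (s₁ := s₁) (s₂ := s₂) (ε := ε) hp hq h
  have hw := xWeight_ne_zero (T := T)
  have n1 := mul_ne_zero (hw (γ.start.1, γ.start.2 + 1)) (hw (γ.start.1, γ.start.2 + 2))
  have n2 := mul_ne_zero (hw (γ.finish.1, γ.finish.2 + 1)) (hw (γ.finish.1, γ.finish.2 + 2))
  have n3 := (turnCCW γ.start γ.puncture_start).thirdProd_ne_zero hw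
  have n4 := (turnCCW γ.finish γ.puncture_finish).thirdProd_ne_zero hw
  have n5 := γ.thirdProd_ne_zero hw
  have n6 := γ.bitProd_ne_zero xFactor_ne_zero a
  rw [← hC] at hP hQ hH n6
  have n7 := left_ne_zero_of_mul n6
  rw [pairX, div_eq_iff (pow_ne_zero 3 n7)]
  generalize T.xWeight (γ.start.1, γ.start.2 + 1) * T.xWeight (γ.start.1, γ.start.2 + 2) = S₁ at *
  generalize
    T.xWeight (γ.finish.1, γ.finish.2 + 1) * T.xWeight (γ.finish.1, γ.finish.2 + 2) = S₂ at *
  generalize (turnCCW γ.start γ.puncture_start).thirdProd T.xWeight = R₁ at *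
  generalize (turnCCW γ.finish γ.puncture_finish).thirdProd T.xWeight = R₂ at *
  generalize γ.thirdProd T.xWeight = R at *
  -- The cancelled factor is the product of the third-side factors in the two loop monomials, each
  -- of which contains `R ^ 2` for its two copies of `γ`. After this, four contributions of `γ` on
  -- the left face three from the cube and one from the hooked curve.
  refine mul_right_cancel₀ (mul_ne_zero (mul_ne_zero (mul_ne_zero (pow_ne_zero 4 n5) n1) n2)
    (mul_ne_zero n3 n4)) ?_
  linear_combination (xMonomial (γ.snakeQ B) (γ.matchQ B a w) * (R ^ 2 * R₂ * S₂)) * hP +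
    (xMonomial (γ.copyP A i) (SnakeGraph.restrict (γ.matchP A a u) (γ.copyP A i)) * R) ^ 2 *
      (turnCCW γ.start γ.puncture_start).bitProd (xFactor T) u * hQ -
    (xMonomial (γ.copyP A i) (SnakeGraph.restrict (γ.matchP A a u) (γ.copyP A i)) * R) ^ 3 * hH

theorem pairY_eq (h : γ.IsSigns a u w) {i : Copy}
    (hi : CopyFree A.sense (T.degree γ.start) u i) :
    γ.pairY A B i (γ.matchP A a u, γ.matchQ B a w) =
      yMonomial (γ.loopGraph s₁ s₂ ε).snake (γ.matchHook s₁ s₂ ε a u w) := by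
  rw [pairY, (monomials_matchP h.1 h.2.1).2, (monomials_matchQ h.1 h.2.2).2,
    (monomials_copyP h.1 h.2.1 hi).2, yMonomial_matchHook,
    div_eq_iff (pow_ne_zero 3 (γ.bitProd_ne_zero yFactor_ne_zero a))]
  ring

end DoublyNotched

end IdealTriangulation

/-! ### The bijection through triples of signs -/

theorem proposition6p2 {Tri : Type*} [Finite Tri] (T : IdealTriangulation Tri)
    (γ : T.DoublyNotched)
    (hp : ¬ T.IsFoldedCorner γ.start) (hq : ¬ T.IsFoldedCorner γ.finish)
    (a b : IdealTriangulation.DoublyNotched.Choice)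
    (s₁ s₂ : IdealTriangulation.Sense) (ε : ℤˣ) :
    ∃ Φ : {P : Finset (Sym2 LatticePt) × Finset (Sym2 LatticePt) // γ.IsCompatiblePair a b P} ≃
        {P : Finset (Sym2 LatticePt) // (γ.loopGraph s₁ s₂ ε).IsGoodMatching P},
      ∀ P i j, γ.MatchAlong a b i j P.1.1 P.1.2 →
        γ.pairX a b i P.1 =
          IdealTriangulation.xMonomial (γ.loopGraph s₁ s₂ ε).snake (Φ P).1 ∧
        ∀ Q, (γ.loopGraph s₁ s₂ ε).Extends (Φ P).1 Q →
          γ.pairY a b i P.1 =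
            IdealTriangulation.yMonomial (γ.loopGraph s₁ s₂ ε).snake Q := by
  open IdealTriangulation DoublyNotched in
  let D := {d : (ℕ → Bool) × (ℕ → Bool) × (ℕ → Bool) // γ.IsSigns d.1 d.2.1 d.2.2}
  let f : D → {P // γ.IsCompatiblePair a b P} := fun d =>
    ⟨_, isCompatiblePair_iff.2 ⟨d.1.1, d.1.2.1, d.1.2.2, d.2, rfl⟩⟩
  let g : D → {P // (γ.loopGraph s₁ s₂ ε).IsGoodMatching P} := fun d =>
    ⟨_, (isGoodMatching_iff hp hq).2 ⟨d.1.1, d.1.2.1, d.1.2.2, d.2, rfl⟩⟩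
  have hf : Function.Surjective f := by
    rintro ⟨P, hP⟩
    obtain ⟨x, u, w, h, rfl⟩ := isCompatiblePair_iff.1 hP
    exact ⟨⟨(x, u, w), h⟩, rfl⟩
  have hg : Function.Surjective g := by
    rintro ⟨P, hP⟩
    obtain ⟨x, u, w, h, rfl⟩ := (isGoodMatching_iff hp hq).1 hP
    exact ⟨⟨(x, u, w), h⟩, rfl⟩
  obtain ⟨Φ, hΦ⟩ := exists_equiv_of_surjective hf hg fun d d' =>
    Subtype.ext_iff.trans (pair_eq_iff.trans ((core_eq_iff hp hq d.2 d'.2).symm.trans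
      (Subtype.ext_iff (a1 := g d) (a2 := g d')).symm))
  refine ⟨Φ, fun P i j hP => ?_⟩
  obtain ⟨d, rfl⟩ := hf P
  rw [hΦ]
  -- An admissible `i` is one whose copy is free, and the monomial of the restriction to any free
  -- copy is the same.
  have hi := ((matchAlong_iff d.2.1 d.2.2.1 d.2.1 d.2.2.2).1 hP).1
  refine ⟨pairX_eq hp hq d.2 hi, fun Q hQ => ?_⟩
  rw [(extends_iff hp hq d.2).1 hQ]
  exact pairY_eq d.2 hi
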